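/- **Setting.** Consider the Cauchy problem $$\partial_t u+\nabla\cdot \mathbf f(u)=\sum_{i,j=1}^d\partial^2_{x_ix_j}A_{ij}(u)\quad (t>0,\ x\in\mathbb R^d),\qquad u(0,\cdot)=u_0, \tag{1}$$ where $f_i,A_{ij}:\mathbb R\to\mathbb R$ are smooth, $(A_{ij})$ is symmetric, and $a_{ij}:=A_{ij}'=\sum_{k=1}^d\sigma_{ik}\sigma_{jk}$ with smooth $\sigma_{ij}:\mathbb R\to\mathbb R$. For $u_0\in L^\infty(\mathbb R^d)$ (real valued), an *entropy solution* of (1) is a function $u\in L^\infty((0,\infty)\times\mathbb R^d)$ such that, writing $I_R(x)=\{y:\max_i|y_i-x_i|\le R/2\}$ and $I_R=I_R(0)$, and understanding derivatives in the sense of distributions on $(0,\infty)\times\mathbb R^d$: 1. for all $k$ and $R,T>0$: $\sum_i\partial_{x_i}\beta_{ik}(u)\in L^2((0,T)\times I_R)$, where $\beta_{ik}'=\sigma_{ik}$; 2. for all $\psi\in C(\mathbb R)$, all $k$ and $R,T>0$: $\sum_i\partial_{x_i}\beta^\psi_{ik}(u)=\psi(u)\sum_i\partial_{x_i}\beta_{ik}(u)\in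 L^2((0,T)\times I_R)$, where $(\beta_{ik}^\psi)'=\psi\,\sigma_{ik}$; 3. for every convex $\eta\in C^2(\mathbb R)$, with $q_i'=\eta' f_i'$ and $r_{ij}'=\eta' a_{ij}$, $$\partial_t\eta(u)+\nabla\cdot \mathbf q(u)-\sum_{i,j}\partial^2_{x_ix_j}r_{ij}(u)\le-\eta''(u)\sum_k\Big(\sum_i\partial_{x_i}\beta_{ik}(u)\Big)^2;$$ 4. for every $R>0$: $\int_{I_R}|u(t,x)-u_0(x)|\,dx\to0$ as $t\to0+$ (essential limit). A *trigonometric polynomial* is a finite sum $\sum_\lambda a_\lambda e^{2\pi i\lambda\cdot x}$, $\lambda\in\mathbb R^d$, $a_\lambda\in\mathbb C$. Put $$\|g\|_S=\sup_{x\in\mathbb R^d}\int_{I_1(x)}|g(y)|\,dy,\qquad N_1(g)=\limsup_{R\to\infty}R^{-d}\int_{I_R}|g(x)|\,dx .$$ A locally integrable function is *Stepanoff almost periodic* (S-a.p.), respectively belongs to $\mathrm{BAP}(\mathbb R^d)$, if it is a limit of trigonometric polynomials for $\|\cdot\|_S$, respectively for $N_1$. An *$\varepsilon$-inclusion interval*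 of $g$ is a length $l>0$ such that every cube $I_l(x)$, $x\in\mathbb R^d$, contains some $\tau$ with $\|g(\cdot+\tau)-g\|_S\le\varepsilon$. **Lemma 4.1.** There is a constant $K>0$ depending only on $d$ such that, for all $\mathbf f,A,\sigma$ as above, the following holds. (a) For every $M$ there is $C>0$, depending only on $d,\mathbf f,A,\sigma,M$, such that for every real-valued trigonometric polynomial $u_0$ with $|u_0|\le M$ and every entropy solution $u$ of (1): $u$ has a representative (again denoted by $u$) in $C([0,\infty);L^1_{\rm loc}(\mathbb R^d))$ with $u(0,\cdot)=u_0$, and for all $t>0$ * $u(t,\cdot)$ is S-a.p., and it has an $\varepsilon$-inclusion interval for every $\varepsilon>0$; * for every $\varepsilon>0$ with $|\log\varepsilon|\ge K$ (in particular for all sufficiently small $\varepsilon$), with $$\varepsilon'=\varepsilon'(\varepsilon,t)=\varepsilon\,|\log\varepsilon|^{-1}e^{-Ct},$$ the function $u_0$ has an $\varepsilon'$-inclusion interval, and every $\varepsilon'$-inclusion interval of $u_0$ is an $\varepsilon$-inclusion interval of $u(t,\cdot)$; that is, one may take $l_\varepsilon(t)=l_{\varepsilon'}(0)$. (b) If $u_0\in\mathrm{BAP}(\mathbb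 R^d)\cap L^\infty(\mathbb R^d)$ is real valued and $u$ is an entropy solution of (1), then $u(t,\cdot)\in \mathrm{BAP}(\mathbb R^d)$ for a.e. $t>0$. -/

import Mathlib

open Set Filter Topology MeasureTheory
open scoped ENNReal ContDiff

noncomputable section

namespace AnisotropicAP

/-- The space `ℝ^d`; its norm as a product space is `|x|_∞ = max_i |x_i|`. -/
abbrev Space (d : ℕ) := Fin d → ℝ

/-- The closed cube `I_R(x) = {y : |y - x|_∞ ≤ R / 2}`. -/
def cube {d : ℕ} (R : ℝ) (x : Space d) : Set (Space d) := Metric.closedBall x (R / 2)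

/-! ### Almost periodic functions -/

/-- Trigonometric polynomials: finite sums `∑_λ a_λ e^{2πi λ·x}`. -/
def IsTrigPoly {d : ℕ} (P : Space d → ℂ) : Prop :=
  ∃ (Λ : Finset (Space d)) (a : Space d → ℂ), ∀ x,
    P x = ∑ l ∈ Λ, a l * Complex.exp (2 * Real.pi * Complex.I * ((∑ i, l i * x i : ℝ) : ℂ))

/-- `N_1(g) = limsup_{R → ∞} R^{-d} ∫_{I_R} |g|`. -/
def besicovitchSeminorm {d : ℕ} (g : Space d → ℂ) : ℝ≥0∞ :=
  limsup (fun R : ℝ => (∫⁻ x in cube R 0, ‖g x‖ₑ) / ENNReal.ofReal (R ^ d)) atTop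

/-- Besicovitch almost periodic functions (exponent 1): the locally integrable functions that are
limits of trigonometric polynomials for `N_1`. -/
def IsBAP {d : ℕ} (g : Space d → ℂ) : Prop :=
  LocallyIntegrable g ∧
    ∀ ε : ℝ, 0 < ε → ∃ P : Space d → ℂ, IsTrigPoly P ∧
      besicovitchSeminorm (fun x => g x - P x) ≤ ENNReal.ofReal ε

/-- `‖g‖_S = sup_x ∫_{I_1(x)} |g|`. -/
def stepanoffNorm {d : ℕ} (g : Space d → ℂ) : ℝ≥0∞ :=
  ⨆ x : Space d, ∫⁻ y in cube 1 x, ‖g y‖ₑ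

/-- Stepanoff almost periodic functions (exponent 1): the locally integrable functions that are
limits of trigonometric polynomials for `‖·‖_S`. -/
def IsSAP {d : ℕ} (g : Space d → ℂ) : Prop :=
  LocallyIntegrable g ∧
    ∀ ε : ℝ, 0 < ε → ∃ P : Space d → ℂ, IsTrigPoly P ∧
      stepanoffNorm (fun x => g x - P x) ≤ ENNReal.ofReal ε

/-- The set `E_S{ε, g}` of Stepanoff `ε`-periods of `g`. -/
def stepanoffPeriods {d : ℕ} (ε : ℝ) (g : Space d → ℂ) : Set (Space d) :=
  {τ | stepanoffNorm (fun x => g (x + τ) - g x) ≤ ENNReal.ofReal ε}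

/-- The length `l > 0` is an `ε`-inclusion interval of `g`: every cube of edge `l` contains an
`ε`-period of `g`. -/
def IsInclusionInterval {d : ℕ} (ε : ℝ) (g : Space d → ℂ) (l : ℝ) : Prop :=
  0 < l ∧ ∀ x : Space d, ∃ τ ∈ cube l x, τ ∈ stepanoffPeriods ε g

/-! ### Distributions on `(0, ∞) × ℝ^d` -/

/-- The domain `(0, ∞) × ℝ^d`. -/
def domain (d : ℕ) : Set (ℝ × Space d) := Ioi 0 ×ˢ univ

/-- Test functions: smooth, with compact support contained in `(0, ∞) × ℝ^d`. -/
structure IsTestFunction {d : ℕ} (φ : ℝ × Space d → ℝ) : Prop where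
  smooth : ContDiff ℝ ∞ φ
  hasCompactSupport : HasCompactSupport φ
  tsupport_subset : tsupport φ ⊆ domain d

/-- `∂_t φ`. -/
def dt {d : ℕ} (φ : ℝ × Space d → ℝ) (p : ℝ × Space d) : ℝ := fderiv ℝ φ p (1, 0)

/-- `∂_{x_i} φ`. -/
def dx {d : ℕ} (i : Fin d) (φ : ℝ × Space d → ℝ) (p : ℝ × Space d) : ℝ :=
  fderiv ℝ φ p (0, Pi.single i 1)

/-- `∑_i ∂_{x_i} F_i = g` in the sense of distributions on `(0, ∞) × ℝ^d`, with
`g ∈ L²((0, T) × I_R)` for all `T, R > 0`. -/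
def HasL2Divergence {d : ℕ} (F : Fin d → ℝ × Space d → ℝ) (g : ℝ × Space d → ℝ) : Prop :=
  (∀ T R : ℝ, 0 < T → 0 < R → MemLp g 2 (volume.restrict (Ioo 0 T ×ˢ cube R 0))) ∧
    ∀ φ : ℝ × Space d → ℝ, IsTestFunction φ →
      ∫ p in domain d, ∑ i, F i p * dx i φ p = -∫ p in domain d, g p * φ p

/-! ### The equation `∂_t u + ∇·f(u) = ∇² : A(u)` and its entropy solutions -/

/-- The assumptions on the coefficients: `f_i`, `A_ij` and `σ_ij` are smooth, `A` is symmetric, and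
`A' = σ σᵀ` (so that `A'` is a nonnegative matrix). -/
structure IsAdmissible {d : ℕ} (f : Fin d → ℝ → ℝ) (A σ : Fin d → Fin d → ℝ → ℝ) : Prop where
  smooth_f : ∀ i, ContDiff ℝ ∞ (f i)
  smooth_A : ∀ i j, ContDiff ℝ ∞ (A i j)
  smooth_σ : ∀ i j, ContDiff ℝ ∞ (σ i j)
  symm_A : ∀ i j, A i j = A j i
  deriv_A : ∀ i j s, deriv (A i j) s = ∑ k, σ i k s * σ j k s

/-- Entropy solutions `u ∈ L^∞((0, ∞) × ℝ^d)` of `∂_t u + ∇·f(u) = ∇² : A(u)`, `u(0, ·) = u₀`,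
where `A' = σ σᵀ`. The function `g k` is the distribution `∑_i ∂_{x_i} β_ik(u)`, `β_ik' = σ_ik`.
The initial condition is an essential limit, so that the notion does not depend on the
representative of `u`. -/
def IsEntropySolution {d : ℕ} (f : Fin d → ℝ → ℝ) (A σ : Fin d → Fin d → ℝ → ℝ)
    (u₀ : Space d → ℝ) (u : ℝ → Space d → ℝ) : Prop :=
  MemLp (fun p : ℝ × Space d => u p.1 p.2) ∞ (volume.restrict (domain d)) ∧
  (∃ g : Fin d → ℝ × Space d → ℝ,
    -- regularity
    (∀ k, HasL2Divergence (fun i p => ∫ v in (0 : ℝ)..u p.1 p.2, σ i k v) (g k)) ∧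
    -- chain rule
    (∀ ψ : ℝ → ℝ, Continuous ψ → ∀ k,
      HasL2Divergence (fun i p => ∫ v in (0 : ℝ)..u p.1 p.2, ψ v * σ i k v)
        (fun p => ψ (u p.1 p.2) * g k p)) ∧
    -- entropy inequality, in the sense of distributions
    (∀ η : ℝ → ℝ, ContDiff ℝ 2 η → ConvexOn ℝ univ η →
      ∀ φ : ℝ × Space d → ℝ, IsTestFunction φ → (∀ p, 0 ≤ φ p) →
        ∫ p in domain d, deriv (deriv η) (u p.1 p.2) * (∑ k, g k p ^ 2) * φ p ≤
          ∫ p in domain d,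
            (η (u p.1 p.2) * dt φ p
              + ∑ i, (∫ v in (0 : ℝ)..u p.1 p.2, deriv η v * deriv (f i) v) * dx i φ p
              + ∑ i, ∑ j, (∫ v in (0 : ℝ)..u p.1 p.2, deriv η v * deriv (A i j) v)
                  * dx i (dx j φ) p))) ∧
  -- initial condition
  (∀ R : ℝ, 0 < R →
    Tendsto (fun t => ∫⁻ x in cube R 0, ‖u t x - u₀ x‖ₑ) (𝓝[>] 0 ⊓ ae volume) (𝓝 0))

/-- `w` is the representative of `u` in `C([0, ∞); L¹_loc(ℝ^d))`, with value `u₀` at `t = 0`. -/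
structure IsContinuousVersion {d : ℕ} (u₀ : Space d → ℝ) (u w : ℝ → Space d → ℝ) : Prop where
  ae_eq : ∀ᵐ p ∂(volume.restrict (domain d)), w p.1 p.2 = u p.1 p.2
  initial : w 0 = u₀
  locallyIntegrable : ∀ t, 0 ≤ t → LocallyIntegrable (w t)
  continuous : ∀ R : ℝ, 0 < R → ∀ t, 0 ≤ t →
    Tendsto (fun s => ∫⁻ x in cube R 0, ‖w s x - w t x‖ₑ) (𝓝[Ici 0] t) (𝓝 0)

end AnisotropicAP

end

open Set Filter Topology MeasureTheory
open scoped ENNReal ContDiff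

noncomputable section

namespace AnisotropicAP

/-! ### Directional derivatives of test functions -/

/-! Everything rests on one estimate: if `u`, `v` are entropy solutions with data bounded by `M`,
then ∫ |u - v|(t) w ≤ e^{Ct} ∫ |u₀ - v₀| w for all weights w(x) = (1 + |(x - z)/L|²)^{-(d+1)}, with
`C` independent of the center `z` and of the scale `L ≥ 1`. The equation is translation invariant,
so `v` may be a spatial translate of `u`: in each weighted norm the translation modulus of `u(t)` is
at most e^{Ct} times that of `u₀`. Weights of scale 1 with arbitrary center compare with the
Stepanoff norm, and weights centered at 0 with `L → ∞` control the Besicovitch mean.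

The contraction comes from doubling the variables. The entropy inequality of `u` at `p` is used with
a smoothed Kružkov entropy centered at `v q`, and that of `v` at `q` with one centered at `u p`.
Their sum lacks the mixed derivatives ∂_{x_i}∂_{y_j} of the test function. The parabolic dissipation
supplies them: 2gh ≤ g² + h², and the chain rule, applied in `p` and then in `q`, turns the product
term ∫ P'(u - v) g h Φ into the Kružkov flux of `A` against mixed derivatives
(`exists_crossDissipation_bound`, `integral_cross_diss`). After the smoothing is removed
(`doubled_kruzhkov`), test functions φ(p) θ(p - q) concentrated on the diagonal give
`kato_inequality`. The fluxes are Lipschitz and the weights bound their own derivatives, so a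
Gronwall argument yields `weighted_contraction`. Comparison with the constants ±M replaces the a
priori bound of `u` by that of the data, and comparison with time shifts produces the representative
that is continuous in time.

Inclusion intervals are then inherited with the factor `stepanoffConst d` · e^{Ct}: the exponential
is cancelled by the one in ε', and the dimensional constant is absorbed by |log ε|. This is why `K`
depends on `d` only.

Approximation by trigonometric polynomials uses a kernel of Bochner-Fejér type, a high power of ∏ (1
+ cos 2πλ·τ)/2. Averages of w(· + τ) against this nonnegative trigonometric polynomial over growing
cubes converge, along a subsequence, to a trigonometric polynomial `Q`. The distance from `w` to `Q`
is at most the average of the distances from `w` to its translates, and the kernel sits near the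
common almost periods of the frequencies of the data. For Besicovitch data a first approximant `P`
of `u₀` fixes the kernel; a second one `P'`, chosen afterwards, is so close to `u₀` that the density
bound of the kernel does no harm. -/

/-- The derivative of `φ` in the direction `e`. -/
def dirDeriv {V : Type*} [NormedAddCommGroup V] [NormedSpace ℝ V] (e : V) (φ : V → ℝ) (p : V) : ℝ :=
  fderiv ℝ φ p e

/-- The indices of the terms of the equation: time derivative, first and second order fluxes. -/
abbrev Idx (d : ℕ) := Unit ⊕ (Fin d ⊕ Fin d × Fin d)

/-- The nonlinearities `u`, `f_i(u)`, `A_ij(u)`. -/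
def fluxFn {d : ℕ} (f : Fin d → ℝ → ℝ) (A : Fin d → Fin d → ℝ → ℝ) : Idx d → ℝ → ℝ :=
  Sum.elim (fun _ => id) (Sum.elim f (fun ij => A ij.1 ij.2))

/-- The operators `∂_t`, `∂_{x_i}`, `∂_{x_i} ∂_{x_j}`. -/
def diffOp {d : ℕ} : Idx d → (ℝ × Space d → ℝ) → ℝ × Space d → ℝ :=
  Sum.elim (fun _ => dt) (Sum.elim dx (fun ij φ => dx ij.1 (dx ij.2 φ)))

section
variable {d : ℕ}

instance : (volume : Measure (ℝ × Space d)).IsAddHaarMeasure :=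
  inferInstanceAs ((volume : Measure ℝ).prod (volume : Measure (Space d))).IsAddHaarMeasure

lemma dt_eq_dirDeriv (φ : ℝ × Space d → ℝ) : dt φ = dirDeriv (1, 0) φ := rfl

lemma dx_eq_dirDeriv (i : Fin d) (φ : ℝ × Space d → ℝ) :
    dx i φ = dirDeriv (0, Pi.single i 1) φ := rfl

section
variable {V : Type*} [NormedAddCommGroup V] [NormedSpace ℝ V]

lemma contDiff_dirDeriv (e : V) {φ : V → ℝ} (h : ContDiff ℝ ∞ φ) :
    ContDiff ℝ ∞ (dirDeriv e φ) := by
  unfold dirDeriv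
  exact (h.fderiv_right (m := ∞) (by simp)).clm_apply contDiff_const

lemma tsupport_dirDeriv_subset (e : V) (φ : V → ℝ) : tsupport (dirDeriv e φ) ⊆ tsupport φ :=
  tsupport_fderiv_apply_subset ℝ e

lemma dirDeriv_comm {φ : V → ℝ} (h : ContDiff ℝ ∞ φ) (e e' : V) :
    dirDeriv e (dirDeriv e' φ) = dirDeriv e' (dirDeriv e φ) := by
  ext p
  have hs : IsSymmSndFDerivAt ℝ φ p := h.contDiffAt.isSymmSndFDerivAt
    (by simpa using WithTop.coe_le_coe.2 (le_top : (2 : ℕ∞) ≤ ⊤))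
  have hd : DifferentiableAt ℝ (fderiv ℝ φ) p :=
    ((h.fderiv_right (m := ∞) (by simp)).differentiable (by simp)) p
  have key : ∀ a b : V, dirDeriv a (dirDeriv b φ) p = fderiv ℝ (fderiv ℝ φ) p a b := by
    intro a b
    change fderiv ℝ (fun p => fderiv ℝ φ p b) p a = _
    rw [fderiv_clm_apply hd (differentiableAt_const b)]
    simp
  rw [key, key, hs.eq]

lemma dirDeriv_add_left (e e' : V) (φ : V → ℝ) (p : V) :
    dirDeriv (e + e') φ p = dirDeriv e φ p + dirDeriv e' φ p :=
  map_add _ _ _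

lemma dirDeriv_add_right {φ ψ : V → ℝ} (hφ : ContDiff ℝ ∞ φ) (hψ : ContDiff ℝ ∞ ψ) (e : V) (p : V) :
    dirDeriv e (fun p => φ p + ψ p) p = dirDeriv e φ p + dirDeriv e ψ p := by
  unfold dirDeriv
  rw [fderiv_fun_add (hφ.differentiable (by simp) p) (hψ.differentiable (by simp) p)]
  rfl

end

lemma IsTestFunction.dirDeriv {φ : ℝ × Space d → ℝ} (h : IsTestFunction φ) (e : ℝ × Space d) :
    IsTestFunction (dirDeriv e φ) where
  smooth := contDiff_dirDeriv e h.smooth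
  hasCompactSupport := h.hasCompactSupport.fderiv_apply ℝ e
  tsupport_subset := (tsupport_dirDeriv_subset e φ).trans h.tsupport_subset

lemma IsTestFunction.diffOp {φ : ℝ × Space d → ℝ} (h : IsTestFunction φ) (ι : Idx d) :
    IsTestFunction (diffOp ι φ) := by
  rcases ι with _ | i | ij
  · exact h.dirDeriv _
  · exact h.dirDeriv _
  · exact (h.dirDeriv _).dirDeriv _

lemma IsTestFunction.continuous {φ : ℝ × Space d → ℝ} (h : IsTestFunction φ) : Continuous φ :=
  h.smooth.continuous

lemma IsTestFunction.integrable {φ : ℝ × Space d → ℝ} (h : IsTestFunction φ) : Integrable φ :=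
  h.continuous.integrable_of_hasCompactSupport h.hasCompactSupport

lemma IsTestFunction.eq_zero {φ : ℝ × Space d → ℝ} (h : IsTestFunction φ) {p : ℝ × Space d}
    (hp : p ∉ domain d) : φ p = 0 :=
  image_eq_zero_of_notMem_tsupport fun h' => hp (h.tsupport_subset h')

lemma IsTestFunction.differentiable {φ : ℝ × Space d → ℝ} (h : IsTestFunction φ) :
    Differentiable ℝ φ :=
  h.smooth.differentiable (by simp)

/-- Integration by parts against the constant 1. Because of it, entropy fluxes matter only up to
additive constants. -/
lemma integral_dirDeriv_eq_zero {φ : ℝ × Space d → ℝ} (h : IsTestFunction φ) (e : ℝ × Space d) :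
    ∫ p, dirDeriv e φ p = 0 := by
  have := integral_mul_fderiv_eq_neg_fderiv_mul_of_integrable (𝕜 := ℝ) (μ := (volume : Measure (ℝ × Space d)))
    (f := fun _ => (1 : ℝ)) (g := φ) (v := e) (by simp)
    (by simp only [one_mul]; exact (h.dirDeriv e).integrable) (by simpa using h.integrable)
    (by simp) (fun x _ => h.differentiable x)
  simpa [dirDeriv] using this

lemma integral_diffOp_eq_zero {φ : ℝ × Space d → ℝ} (h : IsTestFunction φ) (ι : Idx d) :
    ∫ p, diffOp ι φ p = 0 := by
  rcases ι with _ | i | ij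
  · exact integral_dirDeriv_eq_zero h _
  · exact integral_dirDeriv_eq_zero h _
  · exact integral_dirDeriv_eq_zero (h.dirDeriv _) _

lemma measurableSet_domain : MeasurableSet (domain d) := measurableSet_Ioi.prod MeasurableSet.univ

lemma setIntegral_domain {F : ℝ × Space d → ℝ} (h : ∀ p ∉ domain d, F p = 0) :
    ∫ p in domain d, F p = ∫ p, F p :=
  setIntegral_eq_integral_of_forall_compl_eq_zero h

/-! ### Shifts -/

lemma dirDeriv_comp_sub (e a : ℝ × Space d) (φ : ℝ × Space d → ℝ) (p : ℝ × Space d) :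
    dirDeriv e (fun p => φ (p - a)) p = dirDeriv e φ (p - a) := by
  simp [dirDeriv, fderiv_comp_sub]

lemma diffOp_comp_sub (ι : Idx d) (a : ℝ × Space d) (φ : ℝ × Space d → ℝ) (p : ℝ × Space d) :
    diffOp ι (fun p => φ (p - a)) p = diffOp ι φ (p - a) := by
  rcases ι with _ | i | ij
  · exact dirDeriv_comp_sub _ _ _ _
  · exact dirDeriv_comp_sub _ _ _ _
  · change dirDeriv _ (dirDeriv _ _) _ = dirDeriv _ (dirDeriv _ _) _
    rw [funext (dirDeriv_comp_sub (0, Pi.single ij.2 1) a φ)]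
    exact dirDeriv_comp_sub _ _ _ _

/-- The support moves by `a`, and `0 ≤ a.1` keeps it inside `t > 0`. Solutions can therefore be
shifted in all space directions, but only forward in time. -/
lemma IsTestFunction.comp_sub {φ : ℝ × Space d → ℝ} (h : IsTestFunction φ) {a : ℝ × Space d}
    (ha : 0 ≤ a.1) : IsTestFunction (fun p => φ (p - a)) where
  smooth := h.smooth.comp (contDiff_id.sub contDiff_const)
  hasCompactSupport := h.hasCompactSupport.comp_homeomorph (Homeomorph.subRight a)
  tsupport_subset := by
    intro p hp
    have : p - a ∈ tsupport φ := by
      have := tsupport_comp_subset_preimage φ (f := fun p => p - a) (by fun_prop) hp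
      exact this
    have := h.tsupport_subset this
    simp only [domain, mem_prod, mem_Ioi, mem_univ, and_true, Prod.fst_sub] at this ⊢
    linarith

/-! ### Entropy pairs -/

lemma Continuous.exists_bound_Icc {h : ℝ → ℝ} (hh : Continuous h) (B : ℝ) :
    ∃ M, 0 ≤ M ∧ ∀ s, |s| ≤ B → |h s| ≤ M := by
  obtain ⟨M, hM⟩ := (isCompact_Icc (a := -B) (b := B)).exists_bound_of_continuousOn hh.continuousOn
  exact ⟨max M 0, le_max_right _ _, fun s hs => (hM s (abs_le.1 hs)).trans (le_max_left _ _)⟩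

lemma integrable_comp_mul {α : Type*} [MeasurableSpace α] {μ : Measure α} {v φ : α → ℝ} {B : ℝ}
    (hv : Measurable v) (hB : ∀ p, |v p| ≤ B) {h : ℝ → ℝ} (hh : Continuous h)
    (hφ : Integrable φ μ) : Integrable (fun p => h (v p) * φ p) μ := by
  obtain ⟨M, -, hM⟩ := Continuous.exists_bound_Icc hh B
  exact hφ.bdd_mul (hh.measurable.comp hv).aestronglyMeasurable
    (Eventually.of_forall fun p => hM _ (hB p))

lemma continuous_primitive_mul {h : ℝ → ℝ} (hh : Continuous h) (a : ℝ) :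
    Continuous fun s => ∫ v in a..s, h v :=
  intervalIntegral.continuous_primitive (fun _ _ => hh.intervalIntegrable _ _) a

lemma contDiff_fluxFn {f : Fin d → ℝ → ℝ} {A σ : Fin d → Fin d → ℝ → ℝ}
    (h : IsAdmissible f A σ) (ι : Idx d) : ContDiff ℝ ∞ (fluxFn f A ι) := by
  rcases ι with _ | i | ij
  · exact contDiff_id
  · exact h.smooth_f i
  · exact h.smooth_A _ _

lemma continuous_deriv_fluxFn {f : Fin d → ℝ → ℝ} {A σ : Fin d → Fin d → ℝ → ℝ}
    (h : IsAdmissible f A σ) (ι : Idx d) : Continuous (deriv (fluxFn f A ι)) :=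
  (contDiff_fluxFn h ι).continuous_deriv (by simp)

/-- A globally defined bounded representative of an entropy solution together with its dissipation
functions. -/
structure IsEntropyPair (f : Fin d → ℝ → ℝ) (A σ : Fin d → Fin d → ℝ → ℝ) (B : ℝ)
    (u : ℝ × Space d → ℝ) (g : Fin d → ℝ × Space d → ℝ) : Prop where
  measurable : Measurable u
  bound : ∀ p, |u p| ≤ B
  measurable_diss : ∀ k, Measurable (g k)
  locallyIntegrable_sq : ∀ k, LocallyIntegrable (fun p => g k p ^ 2)
  chain : ∀ ψ : ℝ → ℝ, Continuous ψ → ∀ k, ∀ φ : ℝ × Space d → ℝ, IsTestFunction φ →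
    ∫ p, ∑ i, (∫ v in (0 : ℝ)..u p, ψ v * σ i k v) * dx i φ p = -∫ p, ψ (u p) * g k p * φ p
  entropy : ∀ η : ℝ → ℝ, ContDiff ℝ 2 η → ConvexOn ℝ univ η →
    ∀ φ : ℝ × Space d → ℝ, IsTestFunction φ → (∀ p, 0 ≤ φ p) →
      ∫ p, deriv (deriv η) (u p) * (∑ k, g k p ^ 2) * φ p ≤
        ∫ p, ∑ ι, (∫ v in (0 : ℝ)..u p, deriv η v * deriv (fluxFn f A ι) v) * diffOp ι φ p

variable {f : Fin d → ℝ → ℝ} {A σ : Fin d → Fin d → ℝ → ℝ} {B : ℝ} {u : ℝ × Space d → ℝ}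
  {g : Fin d → ℝ × Space d → ℝ}

/-- Fluxes of a constant are constants, which integrate to zero against derivatives of test
functions. The constants ±M serve as barriers in the maximum principle. -/
lemma IsEntropyPair.const {c : ℝ} (hc : |c| ≤ B) :
    IsEntropyPair f A σ B (fun _ => c) (fun _ _ => 0) where
  measurable := measurable_const
  bound _ := hc
  measurable_diss _ := measurable_const
  locallyIntegrable_sq _ := by simpa using (locallyIntegrable_zero)
  chain ψ _ k φ hφ := by
    rw [integral_finsetSum]
    · simp only [integral_const_mul]
      simp [dx_eq_dirDeriv, integral_dirDeriv_eq_zero hφ]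
    · exact fun i _ => ((hφ.dirDeriv _).integrable).const_mul _
  entropy η _ _ φ hφ _ := by
    rw [integral_finsetSum]
    · simp only [integral_const_mul]
      simp [integral_diffOp_eq_zero hφ]
    · exact fun i _ => ((hφ.diffOp _).integrable).const_mul _

/-- The coefficients do not depend on `(t, x)`, so the shift can be moved to the test function.
Spatial shifts yield the translation modulus, time shifts the continuity in time. -/
lemma IsEntropyPair.shift (h : IsEntropyPair f A σ B u g) {a : ℝ × Space d} (ha : 0 ≤ a.1) :
    IsEntropyPair f A σ B (fun p => u (p + a)) (fun k p => g k (p + a)) where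
  measurable := h.measurable.comp (measurable_id.add_const a)
  bound _ := h.bound _
  measurable_diss k := (h.measurable_diss k).comp (measurable_id.add_const a)
  locallyIntegrable_sq k := by
    intro x
    obtain ⟨s, hs, hi⟩ := h.locallyIntegrable_sq k (x + a)
    refine ⟨(fun p => p + a) ⁻¹' s, (continuous_add_const a).continuousAt hs, ?_⟩
    exact ((measurePreserving_add_right volume a).integrableOn_comp_preimage
      (Homeomorph.addRight a).measurableEmbedding).2 hi
  chain ψ hψ k φ hφ := by
    have := h.chain ψ hψ k _ (hφ.comp_sub ha)
    rw [← integral_add_right_eq_self _ a,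
      ← integral_add_right_eq_self (fun p => ψ (u p) * g k p * φ (p - a)) a] at this
    simpa [dx_eq_dirDeriv, dirDeriv_comp_sub] using this
  entropy η h1 h2 φ hφ h0 := by
    have := h.entropy η h1 h2 _ (hφ.comp_sub ha) (fun p => h0 _)
    rw [← integral_add_right_eq_self _ a,
      ← integral_add_right_eq_self
        (fun p => ∑ ι, (∫ v in (0 : ℝ)..u p, deriv η v * deriv (fluxFn f A ι) v) *
          diffOp ι (fun p => φ (p - a)) p) a] at this
    simpa [diffOp_comp_sub] using this

/-- An entropy solution has a globally defined representative which, with its dissipation, is an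
entropy pair. -/
lemma IsEntropySolution.exists_pair {u₀ : Space d → ℝ} {u : ℝ → Space d → ℝ}
    (hadm : IsAdmissible f A σ) (h : IsEntropySolution f A σ u₀ u) {B : ℝ} (hB : 0 ≤ B)
    (hu : ∀ᵐ p ∂(volume.restrict (domain d)), |u p.1 p.2| ≤ B) :
    ∃ (v : ℝ × Space d → ℝ) (g : Fin d → ℝ × Space d → ℝ), IsEntropyPair f A σ B v g ∧
      ∀ᵐ p ∂(volume.restrict (domain d)), v p = u p.1 p.2 := by
  obtain ⟨hm, ⟨g, hreg, hch, hent⟩, -⟩ := h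
  have hgm : ∀ k, AEStronglyMeasurable (g k) (volume.restrict (domain d)) := by
    intro k
    -- The functions `g k` are known to be measurable only on bounded boxes; countably many boxes
    -- exhaust the domain.
    have : domain d ⊆ ⋃ n : ℕ, Ioo (0 : ℝ) (n + 1) ×ˢ cube ((n : ℝ) + 1) (0 : Space d) := by
      intro p hp
      obtain ⟨n, hn⟩ := exists_nat_gt (max p.1 (2 * ‖p.2‖))
      have h1 := (le_max_left _ _).trans_lt hn
      have h2 := (le_max_right _ _).trans_lt hn
      refine mem_iUnion.2 ⟨n, ⟨⟨hp.1, by linarith⟩, ?_⟩⟩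
      simp only [cube, Metric.mem_closedBall, dist_zero_right]
      linarith
    refine AEStronglyMeasurable.mono_set this ?_
    exact aestronglyMeasurable_iUnion_iff.2 fun n =>
      ((hreg k).1 (n + 1) (n + 1) (by positivity) (by positivity)).1
  have hum := hm.1.aemeasurable
  set u1 := hum.mk _ with hu1
  have hu1m : Measurable u1 := hum.measurable_mk
  have hu1e : ∀ᵐ p ∂(volume.restrict (domain d)), u p.1 p.2 = u1 p := hum.ae_eq_mk
  set v : ℝ × Space d → ℝ := (domain d).indicator fun p => max (-B) (min B (u1 p)) with hv
  have hve : ∀ᵐ p ∂(volume.restrict (domain d)), v p = u p.1 p.2 := by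
    filter_upwards [hu1e, hu, ae_restrict_mem measurableSet_domain] with p h1 h2 h3
    rw [hv, indicator_of_mem h3, ← h1]
    rw [abs_le] at h2
    rw [min_eq_right h2.2, max_eq_right h2.1]
  set g1 : Fin d → ℝ × Space d → ℝ := fun k => (domain d).indicator ((hgm k).aemeasurable.mk _)
  have hge : ∀ k, ∀ᵐ p ∂(volume.restrict (domain d)), g1 k p = g k p := by
    intro k
    filter_upwards [(hgm k).aemeasurable.ae_eq_mk, ae_restrict_mem measurableSet_domain] with p h1 h3
    simp only [g1]
    rw [indicator_of_mem h3, ← h1]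
  have hvm : Measurable v :=
    (measurable_const.max (measurable_const.min hu1m)).indicator measurableSet_domain
  have hvB : ∀ p, |v p| ≤ B := by
    intro p
    by_cases hp : p ∈ domain d
    · rw [hv, indicator_of_mem hp, abs_le]
      exact ⟨le_max_left _ _, max_le (by linarith) (min_le_left _ _)⟩
    · rw [hv, indicator_of_notMem hp]; simpa using hB
  refine ⟨v, g1, ⟨hvm, hvB, ?_, ?_, ?_, ?_⟩, hve⟩
  · exact fun k => (hgm k).aemeasurable.measurable_mk.indicator measurableSet_domain
  · intro k
    rw [locallyIntegrable_iff]
    intro K hK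
    obtain ⟨r, hr, hKr⟩ : ∃ r, 0 < r ∧ K ⊆ Metric.closedBall 0 r := by
      obtain ⟨r, hr⟩ := hK.isBounded.subset_closedBall 0
      exact ⟨max r 1, by positivity, hr.trans (Metric.closedBall_subset_closedBall (le_max_left _ _))⟩
    -- The L² bound is valid down to `t = 0`, so the squares extended by zero are locally integrable
    -- across the initial time as well.
    set S : Set (ℝ × Space d) := Ioo (0 : ℝ) (r + 1) ×ˢ cube (2 * r) (0 : Space d) with hS
    have hSd : S ⊆ domain d := fun p hp => ⟨hp.1.1, mem_univ _⟩
    have hSm : MeasurableSet S := measurableSet_Ioo.prod Metric.isClosed_closedBall.measurableSet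
    have h2 : IntegrableOn (fun p => g k p ^ 2) S := by
      have := ((hreg k).1 (r + 1) (2 * r) (by positivity) (by positivity))
      exact this.integrable_sq
    have h3 : IntegrableOn (fun p => g1 k p ^ 2) S := by
      refine h2.congr ?_
      filter_upwards [ae_restrict_of_ae_restrict_of_subset hSd (hge k)] with p hp
      rw [hp]
    have h4 : Integrable (S.indicator (fun p => g1 k p ^ 2)) := h3.integrable_indicator hSm
    refine h4.integrableOn.congr_fun_ae (s := K) ?_
    filter_upwards [ae_restrict_mem hK.measurableSet] with p hp
    by_cases hpS : p ∈ S
    · simp [indicator_of_mem hpS]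
    · rw [indicator_of_notMem hpS]
      have : p ∉ domain d := by
        intro hpd
        apply hpS
        have := hKr hp
        simp only [Metric.mem_closedBall, dist_zero_right, Prod.norm_def, sup_le_iff] at this
        refine ⟨⟨hpd.1, ?_⟩, ?_⟩
        · have := this.1
          rw [Real.norm_eq_abs, abs_le] at this
          linarith
        · simp only [cube, Metric.mem_closedBall, dist_zero_right]
          linarith
      simp [g1, indicator_of_notMem this]
  · intro ψ hψ k φ hφ
    have := (hch ψ hψ k).2 φ hφ
    rw [← setIntegral_domain, ← setIntegral_domain (F := fun p => ψ (v p) * g1 k p * φ p)]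
    · rw [integral_congr_ae (g := fun p => ∑ i, (∫ w in (0 : ℝ)..u p.1 p.2, ψ w * σ i k w) * dx i φ p),
        this, integral_congr_ae]
      · filter_upwards [hve, hge k] with p h1 h2
        rw [h1, h2]
      · filter_upwards [hve] with p h1
        rw [h1]
    · intro p hp; simp [hφ.eq_zero hp]
    · intro p hp
      exact Finset.sum_eq_zero fun i _ => by
        rw [dx_eq_dirDeriv, (hφ.dirDeriv _).eq_zero hp, mul_zero]
  · intro η h1 h2 φ hφ h0
    have := hent η h1 h2 φ hφ h0
    rw [← setIntegral_domain, ← setIntegral_domain (F := fun p => ∑ ι, _)]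
    · have e1 : ∫ p in domain d, deriv (deriv η) (v p) * (∑ k, g1 k p ^ 2) * φ p =
          ∫ p in domain d, deriv (deriv η) (u p.1 p.2) * (∑ k, g k p ^ 2) * φ p := by
        apply integral_congr_ae
        filter_upwards [hve, ae_all_iff.2 hge] with p h1 h2
        simp only [h1, h2]
      rw [e1]
      refine this.trans (le_of_eq ?_)
      have hd : ∀ s : ℝ, ∫ w in (0 : ℝ)..s, deriv η w = η s - η 0 := by
        intro s
        have hη : ContDiff ℝ 1 η := h1.of_le (by norm_num)
        refine intervalIntegral.integral_deriv_eq_sub (fun x _ => hη.differentiable (by simp) x) ?_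
        exact (hη.continuous_deriv (by simp)).intervalIntegrable _ _
      -- The time entropy of the solution is `η(u)`, that of the pair is `∫_0^u η' = η(u) - η(0)`;
      -- the constant `η(0)` pairs to zero with `dt φ`.
      have hz : ∫ p in domain d, η 0 * dt φ p = 0 := by
        rw [setIntegral_domain]
        · rw [integral_const_mul, dt_eq_dirDeriv, integral_dirDeriv_eq_zero hφ, mul_zero]
        · intro p hp
          rw [dt_eq_dirDeriv, (hφ.dirDeriv _).eq_zero hp, mul_zero]
      have hη : Continuous (deriv η) := (h1.of_le one_le_two).continuous_deriv le_rfl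
      have hint : ∀ ι, Integrable (fun p => (∫ w in (0 : ℝ)..v p, deriv η w *
          deriv (fluxFn f A ι) w) * diffOp ι φ p) := fun ι =>
        integrable_comp_mul (h := fun s => ∫ w in (0 : ℝ)..s, deriv η w * deriv (fluxFn f A ι) w)
          hvm hvB (continuous_primitive_mul (hη.mul (continuous_deriv_fluxFn hadm ι)) 0)
          (hφ.diffOp ι).integrable
      refine Eq.trans ?_ ((integral_add (integrable_finsetSum _ fun ι _ => hint ι).integrableOn
        ((hφ.dirDeriv _).integrable.const_mul _).integrableOn).trans
          ((congrArg _ hz).trans (add_zero _)))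
      · refine integral_congr_ae ?_
        filter_upwards [hve] with p hp
        rw [← hp]
        have e2 : ∫ w in (0 : ℝ)..v p, deriv η w * deriv id w = η (v p) - η 0 := by
          rw [← hd]; simp
        simp only [Fintype.sum_sum_type, Fintype.sum_prod_type, fluxFn, diffOp, Sum.elim_inl,
          Sum.elim_inr, Finset.univ_unique, Finset.sum_singleton]
        rw [e2, ← dt_eq_dirDeriv]
        ring
    · intro p hp
      exact Finset.sum_eq_zero fun i _ => by rw [(hφ.diffOp _).eq_zero hp, mul_zero]
    · intro p hp; simp [hφ.eq_zero hp]

end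

/-! ### Smooth approximations of the Heaviside function -/

/-- Smooth monotone functions which vanish on `(-∞, 0]` and equal `1` on `[δ, ∞)`. -/
structure IsSmoothStep (δ : ℝ) (P : ℝ → ℝ) : Prop where
  pos : 0 < δ
  contDiff : ContDiff ℝ ∞ P
  monotone : Monotone P
  eq_zero : ∀ r, r ≤ 0 → P r = 0
  eq_one : ∀ r, δ ≤ r → P r = 1

lemma exists_isSmoothStep {δ : ℝ} (hδ : 0 < δ) : ∃ P, IsSmoothStep δ P := by
  refine ⟨fun r => Real.smoothTransition (r / δ), hδ, ?_, ?_, ?_, ?_⟩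
  · exact Real.smoothTransition.contDiff.comp (contDiff_id.div_const δ)
  · exact fun a b hab => Real.smoothTransition.monotone (by gcongr)
  · exact fun r hr => Real.smoothTransition.zero_of_nonpos (div_nonpos_of_nonpos_of_nonneg hr hδ.le)
  · exact fun r hr => Real.smoothTransition.one_of_one_le ((one_le_div hδ).2 hr)

namespace IsSmoothStep
variable {δ : ℝ} {P : ℝ → ℝ} (hP : IsSmoothStep δ P)
include hP

lemma nonneg (r : ℝ) : 0 ≤ P r := by
  rcases le_total r 0 with h | h
  · rw [hP.eq_zero r h]
  · rw [← hP.eq_zero 0 le_rfl]; exact hP.monotone h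

lemma le_one (r : ℝ) : P r ≤ 1 := by
  rcases le_total δ r with h | h
  · rw [hP.eq_one r h]
  · rw [← hP.eq_one δ le_rfl]; exact hP.monotone h

lemma continuous : Continuous P := hP.contDiff.continuous

lemma differentiable : Differentiable ℝ P := hP.contDiff.differentiable (by simp)

lemma continuous_deriv : Continuous (deriv P) := hP.contDiff.continuous_deriv (by simp)

lemma deriv_nonneg (r : ℝ) : 0 ≤ deriv P r := hP.monotone.deriv_nonneg

lemma deriv_eq_zero {r : ℝ} (h : δ < |r|) : deriv P r = 0 := by
  have hδ := hP.pos
  rcases lt_abs.1 h with h | h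
  · have : P =ᶠ[𝓝 r] fun _ => 1 := by
      filter_upwards [lt_mem_nhds h] with s hs using hP.eq_one s hs.le
    rw [this.deriv_eq, deriv_const]
  · have : P =ᶠ[𝓝 r] fun _ => 0 := by
      filter_upwards [gt_mem_nhds (show r < 0 by linarith)] with s hs using hP.eq_zero s hs.le
    rw [this.deriv_eq, deriv_const]

/-- The integrand is at most 1 and vanishes beyond `δ`. This is the price of replacing the Heaviside
function by `P` in a flux. -/
lemma integral_one_sub_le {x : ℝ} (hx : 0 ≤ x) : ∫ r in (0 : ℝ)..x, (1 - P r) ≤ δ := by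
  have hc : Continuous fun r => 1 - P r := continuous_const.sub hP.continuous
  have key : ∀ y, 0 ≤ y → y ≤ δ → ∫ r in (0 : ℝ)..y, (1 - P r) ≤ δ := by
    intro y hy hyδ
    calc ∫ r in (0 : ℝ)..y, (1 - P r) ≤ ∫ r in (0 : ℝ)..y, (1 : ℝ) :=
          intervalIntegral.integral_mono_on hy (hc.intervalIntegrable _ _) (by simp)
            fun r _ => by linarith [hP.nonneg r]
      _ ≤ δ := by simpa using hyδ
  rcases le_total x δ with h | h
  · exact key x hx h
  · rw [← intervalIntegral.integral_add_adjacent_intervals (hc.intervalIntegrable 0 δ)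
      (hc.intervalIntegrable δ x)]
    have : ∫ r in δ..x, (1 - P r) = 0 := by
      rw [intervalIntegral.integral_congr (g := fun _ => (0 : ℝ))]
      · simp
      · intro r hr
        rw [uIcc_of_le h] at hr
        simp [hP.eq_one r hr.1]
    linarith [key δ hP.pos.le le_rfl]

variable {H : ℝ → ℝ} {B L : ℝ}

/-- For `u ≤ c` both terms vanish. For `u ≥ c` the difference is the integral of `(P(w - c) - 1)
H'(w)` over `[c, u]`, where only the layer of width `δ` above `c` contributes. -/
lemma abs_integral_sub_left_le (hH : ContDiff ℝ ∞ H) (hL : ∀ s, |s| ≤ B → |deriv H s| ≤ L)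
    (hL0 : 0 ≤ L) {u c : ℝ} (hu : |u| ≤ B) (hc : |c| ≤ B) :
    |(∫ w in c..u, P (w - c) * deriv H w) - (H (max u c) - H c)| ≤ L * δ := by
  have hδ := hP.pos
  have hd : Continuous (deriv H) := hH.continuous_deriv (by simp)
  have hPc := hP.continuous
  rcases le_total u c with h | h
  · rw [intervalIntegral.integral_congr (g := fun _ => (0 : ℝ)), max_eq_right h]
    · simp; positivity
    · intro w hw
      rw [uIcc_of_ge h] at hw
      simp [hP.eq_zero (w - c) (by linarith [hw.2])]
  · rw [max_eq_left h, ← intervalIntegral.integral_deriv_eq_sub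
      (fun x _ => hH.differentiable (by simp) x) (hd.intervalIntegrable _ _),
      ← intervalIntegral.integral_sub (Continuous.intervalIntegrable (by fun_prop) _ _)
        (Continuous.intervalIntegrable (by fun_prop) _ _), ← Real.norm_eq_abs]
    calc ‖∫ w in c..u, (P (w - c) * deriv H w - deriv H w)‖
        ≤ ∫ w in c..u, L * (1 - P (w - c)) := by
          refine intervalIntegral.norm_integral_le_of_norm_le h (ae_of_all _ fun w hw => ?_)
            (Continuous.intervalIntegrable (by fun_prop) _ _)
          have h1 := hL w (by rw [abs_le] at *; constructor <;> linarith [hw.1, hw.2])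
          have h2 := hP.le_one (w - c)
          rw [show P (w - c) * deriv H w - deriv H w = -((1 - P (w - c)) * deriv H w) by ring,
            norm_neg, norm_mul, Real.norm_eq_abs, Real.norm_eq_abs, abs_of_nonneg (by linarith),
            mul_comm]
          exact mul_le_mul_of_nonneg_right h1 (by linarith)
      _ = L * ∫ r in (0 : ℝ)..(u - c), (1 - P r) := by
          rw [intervalIntegral.integral_const_mul,
            intervalIntegral.integral_comp_sub_right (fun r => 1 - P r) c, sub_self]
      _ ≤ L * δ := mul_le_mul_of_nonneg_left (hP.integral_one_sub_le (by linarith)) hL0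

/-- The mirror image, for the entropy with derivative `-P(c - ·)`; the reflection `w ↦ c - w` leads
to the same integral of `1 - P`. -/
lemma abs_integral_sub_right_le (hH : ContDiff ℝ ∞ H) (hL : ∀ s, |s| ≤ B → |deriv H s| ≤ L)
    (hL0 : 0 ≤ L) {v c : ℝ} (hv : |v| ≤ B) (hc : |c| ≤ B) :
    |(∫ w in v..c, P (c - w) * deriv H w) - (H (max c v) - H v)| ≤ L * δ := by
  have hδ := hP.pos
  have hd : Continuous (deriv H) := hH.continuous_deriv (by simp)
  have hPc := hP.continuous
  rcases le_total c v with h | h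
  · rw [intervalIntegral.integral_congr (g := fun _ => (0 : ℝ)), max_eq_right h]
    · simp; positivity
    · intro w hw
      rw [uIcc_of_ge h] at hw
      simp [hP.eq_zero (c - w) (by linarith [hw.1])]
  · rw [max_eq_left h, ← intervalIntegral.integral_deriv_eq_sub
      (fun x _ => hH.differentiable (by simp) x) (hd.intervalIntegrable _ _),
      ← intervalIntegral.integral_sub (Continuous.intervalIntegrable (by fun_prop) _ _)
        (Continuous.intervalIntegrable (by fun_prop) _ _), ← Real.norm_eq_abs]
    calc ‖∫ w in v..c, (P (c - w) * deriv H w - deriv H w)‖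
        ≤ ∫ w in v..c, L * (1 - P (c - w)) := by
          refine intervalIntegral.norm_integral_le_of_norm_le h (ae_of_all _ fun w hw => ?_)
            (Continuous.intervalIntegrable (by fun_prop) _ _)
          have h1 := hL w (by rw [abs_le] at *; constructor <;> linarith [hw.1, hw.2])
          have h2 := hP.le_one (c - w)
          rw [show P (c - w) * deriv H w - deriv H w = -((1 - P (c - w)) * deriv H w) by ring,
            norm_neg, norm_mul, Real.norm_eq_abs, Real.norm_eq_abs, abs_of_nonneg (by linarith),
            mul_comm]
          exact mul_le_mul_of_nonneg_right h1 (by linarith)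
      _ = L * ∫ r in (0 : ℝ)..(c - v), (1 - P r) := by
          rw [intervalIntegral.integral_const_mul,
            intervalIntegral.integral_comp_sub_left (fun r => 1 - P r) c, sub_self]
      _ ≤ L * δ := mul_le_mul_of_nonneg_left (hP.integral_one_sub_le (by linarith)) hL0

lemma integral_deriv_comp_sub (u c : ℝ) :
    ∫ w in (0 : ℝ)..u, deriv P (w - c) = P (u - c) - P (-c) := by
  rw [intervalIntegral.integral_comp_sub_right (fun r => deriv P r) c,
    intervalIntegral.integral_deriv_eq_sub (fun x _ => hP.differentiable x)
      (hP.continuous_deriv.intervalIntegrable _ _)]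
  simp

/-- `P' (· - c)` acts on Lipschitz functions like a multiple of the evaluation at `c`. -/
lemma abs_integral_deriv_mul_sub_le {s : ℝ → ℝ} (hs : Continuous s) (hL0 : 0 ≤ L)
    (hL : ∀ w c, |w| ≤ B → |c| ≤ B → |s w - s c| ≤ L * |w - c|) {u c : ℝ} (hu : |u| ≤ B)
    (hc : |c| ≤ B) :
    |(∫ w in (0 : ℝ)..u, deriv P (w - c) * s w) - (P (u - c) - P (-c)) * s c| ≤ L * δ := by
  have hδ := hP.pos
  have hd := hP.continuous_deriv
  rw [← hP.integral_deriv_comp_sub, ← intervalIntegral.integral_mul_const,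
    ← intervalIntegral.integral_sub (Continuous.intervalIntegrable (by fun_prop) _ _)
        (Continuous.intervalIntegrable (by fun_prop) _ _), ← Real.norm_eq_abs]
  have h0 := abs_nonneg u
  calc _ ≤ |∫ w in (0 : ℝ)..u, deriv P (w - c) * (L * δ)| := by
        refine intervalIntegral.norm_integral_le_abs_of_norm_le
          (ae_restrict_of_forall_mem measurableSet_uIoc fun w hw => ?_)
          (Continuous.intervalIntegrable (by fun_prop) _ _)
        have hw' : |w| ≤ B := by
          rcases mem_uIoc.1 hw with h | h <;> rw [abs_le] at * <;> constructor <;> linarith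
        rw [← mul_sub, norm_mul, Real.norm_eq_abs, abs_of_nonneg (hP.deriv_nonneg _)]
        -- `P'(w - c)` is carried by `|w - c| ≤ δ`, where the Lipschitz bound gives `L δ`. What
        -- remains is the total variation of `P(· - c)`, at most 1.
        rcases le_or_gt |w - c| δ with h | h
        · refine mul_le_mul_of_nonneg_left ((hL w c hw' hc).trans ?_) (hP.deriv_nonneg _)
          exact mul_le_mul_of_nonneg_left h hL0
        · rw [hP.deriv_eq_zero h]; simp
    _ = |P (u - c) - P (-c)| * (L * δ) := by
        rw [intervalIntegral.integral_mul_const, hP.integral_deriv_comp_sub, abs_mul,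
          abs_of_nonneg (by positivity : 0 ≤ L * δ)]
    _ ≤ 1 * (L * δ) := by
        refine mul_le_mul_of_nonneg_right ?_ (by positivity)
        rw [abs_le]
        constructor <;> linarith [hP.nonneg (u - c), hP.nonneg (-c), hP.le_one (u - c), hP.le_one (-c)]
    _ = L * δ := one_mul _

lemma deriv_primitive_left (c : ℝ) :
    deriv (fun r => ∫ w in (0 : ℝ)..r, P (w - c)) = fun r => P (r - c) := by
  ext r
  have := hP.continuous
  exact Continuous.deriv_integral (fun w => P (w - c)) (by fun_prop) 0 r

lemma deriv_primitive_right (c : ℝ) :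
    deriv (fun r => ∫ w in (0 : ℝ)..r, -P (c - w)) = fun r => -P (c - r) := by
  ext r
  have := hP.continuous
  exact Continuous.deriv_integral (fun w => -P (c - w)) (by fun_prop) 0 r

end IsSmoothStep

lemma contDiff_two_primitive {h : ℝ → ℝ} (hh : ContDiff ℝ ∞ h) :
    ContDiff ℝ 2 (fun r => ∫ w in (0 : ℝ)..r, h w) := by
  have hd : deriv (fun r => ∫ w in (0 : ℝ)..r, h w) = h := by
    ext r; exact Continuous.deriv_integral h hh.continuous 0 r
  have : ContDiff ℝ ∞ (fun r => ∫ w in (0 : ℝ)..r, h w) := by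
    rw [contDiff_infty_iff_deriv, hd]
    refine ⟨fun r => ?_, hh⟩
    exact (intervalIntegral.integral_hasDerivAt_right (hh.continuous.intervalIntegrable _ _)
      (hh.continuous.stronglyMeasurableAtFilter _ _) hh.continuous.continuousAt).differentiableAt
  exact this.of_le (WithTop.coe_le_coe.2 le_top)

lemma convexOn_primitive {h : ℝ → ℝ} (hh : Continuous h) (hm : Monotone h) :
    ConvexOn ℝ univ (fun r => ∫ w in (0 : ℝ)..r, h w) := by
  have hd : deriv (fun r => ∫ w in (0 : ℝ)..r, h w) = h := by
    ext r; exact Continuous.deriv_integral h hh 0 r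
  refine Monotone.convexOn_univ_of_deriv (fun r => ?_) (by rwa [hd])
  exact (intervalIntegral.integral_hasDerivAt_right (hh.intervalIntegrable _ _)
      (hh.stronglyMeasurableAtFilter _ _) hh.continuousAt).differentiableAt

/-! ### Kružkov inequalities with smoothed entropies -/

section
variable {d : ℕ} {f : Fin d → ℝ → ℝ} {A σ : Fin d → Fin d → ℝ → ℝ} {B : ℝ} {u : ℝ × Space d → ℝ}
  {g : Fin d → ℝ × Space d → ℝ} {δ : ℝ} {P : ℝ → ℝ}

/-- The Kružkov flux `1_{a > b} (H(a) - H(b))`. -/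
def kruzhkovFlux (H : ℝ → ℝ) (a b : ℝ) : ℝ := H (max a b) - H b

lemma continuous_kruzhkovFlux {H : ℝ → ℝ} (hH : Continuous H) :
    Continuous fun x : ℝ × ℝ => kruzhkovFlux H x.1 x.2 := by
  unfold kruzhkovFlux; fun_prop

/-- Used to exchange exact entropy fluxes for simpler ones: the constants `κ ι` are invisible to
derivatives of `φ`, so only the error `E` is paid. -/
lemma integral_sum_diffOp_le {φ : ℝ × Space d → ℝ} (hφ : IsTestFunction φ)
    {a T : Idx d → ℝ × Space d → ℝ} {κ : Idx d → ℝ} {E : ℝ}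
    (ha : ∀ ι, Integrable fun p => a ι p * diffOp ι φ p)
    (hT : ∀ ι, Integrable fun p => T ι p * diffOp ι φ p)
    (h : ∀ ι p, |a ι p - κ ι - T ι p| ≤ E) :
    ∫ p, ∑ ι, a ι p * diffOp ι φ p ≤
      (∫ p, ∑ ι, T ι p * diffOp ι φ p) + E * ∫ p, ∑ ι, |diffOp ι φ p| := by
  have hD := fun ι => (hφ.diffOp ι).integrable
  have hz : ∫ p, ∑ ι, κ ι * diffOp ι φ p = 0 := by
    rw [integral_finsetSum _ fun ι _ => (hD ι).const_mul _]
    simp [integral_const_mul, integral_diffOp_eq_zero hφ]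
  have hi1 : Integrable fun p => ∑ ι, a ι p * diffOp ι φ p := integrable_finsetSum _ fun ι _ => ha ι
  have hi2 : Integrable fun p => ∑ ι, T ι p * diffOp ι φ p := integrable_finsetSum _ fun ι _ => hT ι
  have hi3 : Integrable fun p => ∑ ι, |diffOp ι φ p| := integrable_finsetSum _ fun ι _ => (hD ι).abs
  have hi4 : Integrable fun p => ∑ ι, κ ι * diffOp ι φ p :=
    integrable_finsetSum _ fun ι _ => (hD ι).const_mul _
  rw [← integral_const_mul, ← integral_add hi2 (hi3.const_mul _)]
  rw [← sub_zero (∫ p, ∑ ι, a ι p * diffOp ι φ p), ← hz, ← integral_sub hi1 hi4]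
  refine integral_mono (hi1.sub hi4) (hi2.add (hi3.const_mul _)) fun p => ?_
  simp only [Finset.mul_sum, ← Finset.sum_sub_distrib, ← Finset.sum_add_distrib]
  refine Finset.sum_le_sum fun ι _ => ?_
  have h1 := le_abs_self ((a ι p - κ ι - T ι p) * diffOp ι φ p)
  rw [abs_mul] at h1
  have h2 := mul_le_mul_of_nonneg_right (h ι p) (abs_nonneg (diffOp ι φ p))
  linarith

variable (hadm : IsAdmissible f A σ) (hP : IsSmoothStep δ P) {L : ℝ} (hL0 : 0 ≤ L)
  (hL : ∀ ι s, |s| ≤ B → |deriv (fluxFn f A ι) s| ≤ L) (h : IsEntropyPair f A σ B u g)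
include hadm hP hL0 hL h

/-- The entropy has `η' = P(· - c)` and `η'' = P'(· - c)`; moving the base point of the flux
integrals from 0 to `c` costs only constants. The dissipation is kept, because it must later pay for
the mixed second derivatives. -/
lemma IsEntropyPair.kruzhkov_left {c : ℝ} (hc : |c| ≤ B) {φ : ℝ × Space d → ℝ}
    (hφ : IsTestFunction φ) (h0 : ∀ p, 0 ≤ φ p) :
    ∫ p, deriv P (u p - c) * (∑ k, g k p ^ 2) * φ p ≤
      (∫ p, ∑ ι, kruzhkovFlux (fluxFn f A ι) (u p) c * diffOp ι φ p) +
        L * δ * ∫ p, ∑ ι, |diffOp ι φ p| := by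
  have hPc := hP.continuous
  have hPs : ContDiff ℝ ∞ fun w => P (w - c) := hP.contDiff.comp (contDiff_id.sub contDiff_const)
  have hent := h.entropy _ (contDiff_two_primitive hPs)
    (convexOn_primitive hPs.continuous fun a b hab => hP.monotone (by linarith)) φ hφ h0
  simp only [hP.deriv_primitive_left, deriv_comp_sub_const] at hent
  have hh := fun ι => continuous_deriv_fluxFn hadm ι
  refine hent.trans (integral_sum_diffOp_le hφ
    (κ := fun ι => ∫ w in (0 : ℝ)..c, P (w - c) * deriv (fluxFn f A ι) w) (fun ι => ?_)
    (fun ι => ?_) fun ι p => ?_)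
  · exact integrable_comp_mul
      (h := fun s => ∫ w in (0 : ℝ)..s, P (w - c) * deriv (fluxFn f A ι) w)
      h.measurable h.bound (continuous_primitive_mul (hPs.continuous.mul (hh ι)) 0)
      (hφ.diffOp ι).integrable
  · exact integrable_comp_mul (h := fun s => kruzhkovFlux (fluxFn f A ι) s c) h.measurable h.bound
      ((continuous_kruzhkovFlux (contDiff_fluxFn hadm ι).continuous).comp
        (continuous_id.prodMk continuous_const)) (hφ.diffOp ι).integrable
  · have := hP.abs_integral_sub_left_le (contDiff_fluxFn hadm ι) (hL ι) hL0 (h.bound p) hc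
    have hi : ∀ x y, IntervalIntegrable (fun w => P (w - c) * deriv (fluxFn f A ι) w) volume x y :=
      Continuous.intervalIntegrable (hPs.continuous.mul (hh ι))
    rw [intervalIntegral.integral_interval_sub_left (hi _ _) (hi _ _)]
    exact this

/-- Here `η' = -P(c - ·)`, which is again increasing. The constant now occupies the first slot of
the flux, so with `c = u p` this inequality for `v` has the same flux as the previous one for `u`
with `c = v q`, and the two can be added. -/
lemma IsEntropyPair.kruzhkov_right {c : ℝ} (hc : |c| ≤ B) {φ : ℝ × Space d → ℝ}
    (hφ : IsTestFunction φ) (h0 : ∀ p, 0 ≤ φ p) :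
    ∫ p, deriv P (c - u p) * (∑ k, g k p ^ 2) * φ p ≤
      (∫ p, ∑ ι, kruzhkovFlux (fluxFn f A ι) c (u p) * diffOp ι φ p) +
        L * δ * ∫ p, ∑ ι, |diffOp ι φ p| := by
  have hPc := hP.continuous
  have hPs : ContDiff ℝ ∞ fun w => -P (c - w) :=
    (hP.contDiff.comp (contDiff_const.sub contDiff_id)).neg
  have hent := h.entropy _ (contDiff_two_primitive hPs)
    (convexOn_primitive hPs.continuous fun a b hab => neg_le_neg (hP.monotone (by linarith))) φ hφ h0
  have hdd : ∀ r, deriv (fun r => -P (c - r)) r = deriv P (c - r) := fun r => by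
    rw [deriv.fun_neg, deriv_comp_const_sub, neg_neg]
  simp only [hP.deriv_primitive_right, hdd] at hent
  have hh := fun ι => continuous_deriv_fluxFn hadm ι
  refine hent.trans (integral_sum_diffOp_le hφ
    (κ := fun ι => ∫ w in (0 : ℝ)..c, -P (c - w) * deriv (fluxFn f A ι) w) (fun ι => ?_)
    (fun ι => ?_) fun ι p => ?_)
  · exact integrable_comp_mul
      (h := fun s => ∫ w in (0 : ℝ)..s, -P (c - w) * deriv (fluxFn f A ι) w)
      h.measurable h.bound (continuous_primitive_mul (hPs.continuous.mul (hh ι)) 0)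
      (hφ.diffOp ι).integrable
  · exact integrable_comp_mul (h := fun s => kruzhkovFlux (fluxFn f A ι) c s) h.measurable h.bound
      ((continuous_kruzhkovFlux (contDiff_fluxFn hadm ι).continuous).comp
        (continuous_const.prodMk continuous_id)) (hφ.diffOp ι).integrable
  · have := hP.abs_integral_sub_right_le (contDiff_fluxFn hadm ι) (hL ι) hL0 (h.bound p) hc
    have hi : ∀ x y, IntervalIntegrable (fun w => -P (c - w) * deriv (fluxFn f A ι) w) volume x y :=
      Continuous.intervalIntegrable (hPs.continuous.mul (hh ι))
    rw [intervalIntegral.integral_interval_sub_left (hi _ _) (hi _ _),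
      intervalIntegral.integral_symm]
    simpa [neg_mul, intervalIntegral.integral_neg, kruzhkovFlux] using this

end

/-! ### Cross dissipation of two solutions -/

lemma exists_uniform_bound_Icc {ι : Type*} [Fintype ι] {h : ι → ℝ → ℝ}
    (hh : ∀ i, Continuous (h i)) (B : ℝ) : ∃ L, 0 ≤ L ∧ ∀ i s, |s| ≤ B → |h i s| ≤ L := by
  choose M hM0 hM using fun i => Continuous.exists_bound_Icc (hh i) B
  exact ⟨∑ i, M i, Finset.sum_nonneg fun i _ => hM0 i, fun i s hs => (hM i s hs).trans
    (Finset.single_le_sum (fun i _ => hM0 i) (Finset.mem_univ i))⟩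

lemma abs_sub_le_of_abs_deriv_le {h : ℝ → ℝ} (hh : Differentiable ℝ h) {B L : ℝ}
    (hL : ∀ s, |s| ≤ B → |deriv h s| ≤ L) {a b : ℝ} (ha : |a| ≤ B) (hb : |b| ≤ B) :
    |h a - h b| ≤ L * |a - b| :=
  (convex_Icc (-B) B).norm_image_sub_le_of_norm_deriv_le (fun x _ => hh x)
    (fun x hx => hL x (abs_le.2 hx)) (abs_le.1 hb) (abs_le.1 ha)

/-- The inner integral of the cross dissipation. -/
def crossInner (P s : ℝ → ℝ) (a b : ℝ) : ℝ := ∫ w in (0 : ℝ)..a, deriv P (w - b) * s w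

/-- The cross dissipation `∫_0^b (∫_0^a P'(w - w') s(w) dw) s'(w') dw'`. -/
def crossDissipation (P s s' : ℝ → ℝ) (a b : ℝ) : ℝ := ∫ w in (0 : ℝ)..b, crossInner P s a w * s' w

section
variable {d : ℕ} {f : Fin d → ℝ → ℝ} {A σ : Fin d → Fin d → ℝ → ℝ} {δ : ℝ} {P : ℝ → ℝ}

lemma continuous_crossInner (hP : IsSmoothStep δ P) {s : ℝ → ℝ} (hs : Continuous s) :
    Continuous fun x : ℝ × ℝ => crossInner P s x.1 x.2 := by
  have := hP.continuous_deriv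
  exact intervalIntegral.continuous_parametric_intervalIntegral_of_continuous
    (f := fun x : ℝ × ℝ => fun w => deriv P (w - x.2) * s w) (by fun_prop) continuous_fst

lemma continuous_crossDissipation (hP : IsSmoothStep δ P) {s s' : ℝ → ℝ} (hs : Continuous s)
    (hs' : Continuous s') : Continuous fun x : ℝ × ℝ => crossDissipation P s s' x.1 x.2 := by
  have := continuous_crossInner hP hs
  refine intervalIntegral.continuous_parametric_intervalIntegral_of_continuous
    (f := fun x : ℝ × ℝ => fun w => crossInner P s x.1 w * s' w) ?_ continuous_snd
  exact (this.comp (by fun_prop : Continuous fun y : (ℝ × ℝ) × ℝ => (y.1.1, y.2))).mul (by fun_prop)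

/-- The cross dissipation of the diffusion is, up to functions of one variable, the negative of the
Kružkov flux of the diffusion. -/
lemma exists_crossDissipation_bound (hadm : IsAdmissible f A σ) {B : ℝ} (hB : 0 ≤ B) :
    ∃ C, 0 ≤ C ∧ ∀ (δ : ℝ) (P : ℝ → ℝ), IsSmoothStep δ P → ∀ i j, ∃ κ₁ κ₂ : ℝ → ℝ,
      Continuous κ₁ ∧ Continuous κ₂ ∧ ∀ a b, |a| ≤ B → |b| ≤ B →
        |(∑ k, crossDissipation P (σ i k) (σ j k) a b) -
          (κ₁ a + κ₂ b - kruzhkovFlux (A i j) a b)| ≤ C * δ := by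
  have hσc := fun i k => (hadm.smooth_σ i k).continuous
  obtain ⟨S, hS0, hS⟩ := exists_uniform_bound_Icc (h := fun ik : Fin d × Fin d => σ ik.1 ik.2)
    (fun ik => hσc _ _) B
  obtain ⟨S', hS'0, hS'⟩ := exists_uniform_bound_Icc
    (h := fun ik : Fin d × Fin d => deriv (σ ik.1 ik.2))
    (fun ik => (hadm.smooth_σ _ _).continuous_deriv (by simp)) B
  obtain ⟨L, hL0, hL⟩ := exists_uniform_bound_Icc
    (h := fun ik : Fin d × Fin d => deriv (A ik.1 ik.2))
    (fun ik => (hadm.smooth_A _ _).continuous_deriv (by simp)) B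
  -- `S' δ` is the error of the inner integral, `S` bounds the outer factor, `B` the length of the
  -- outer interval, and `d` counts the `k`. The term `L` comes from the smoothed flux at the end.
  refine ⟨d * (S' * S * B) + L, by positivity, fun δ P hP i j => ?_⟩
  have hδ := hP.pos
  have hPc := hP.continuous
  have hac : Continuous (deriv (A i j)) := (hadm.smooth_A i j).continuous_deriv (by simp)
  -- The inner integral is close to `(P(a - w) - P(-w)) σ_ik(w)`, and `∑_k σ_ik σ_jk = A_ij'`.
  -- Splitting `∫_0^b P(a - w) A_ij'` as `∫_0^a - ∫_b^a` isolates `κ₁ a`; the part with `P(-w)` is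
  -- `κ₂ b`; the integral from `b` to `a` that is left approximates the Kružkov flux.
  refine ⟨fun a => ∫ w in (0 : ℝ)..a, P (a - w) * deriv (A i j) w,
    fun b => -∫ w in (0 : ℝ)..b, P (-w) * deriv (A i j) w, ?_, ?_, fun a b ha hb => ?_⟩
  · exact intervalIntegral.continuous_parametric_intervalIntegral_of_continuous
      (f := fun a w => P (a - w) * deriv (A i j) w) (by fun_prop) continuous_id
  · exact (continuous_primitive_mul (by fun_prop) 0).neg
  have hJ : ∀ k, Continuous fun w => crossInner P (σ i k) a w * σ j k w := fun k =>
    ((continuous_crossInner hP (hσc i k)).comp (by fun_prop : Continuous fun w : ℝ => (a, w))).mul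
      (hσc j k)
  have hQ : ∀ k, Continuous fun w => (P (a - w) - P (-w)) * σ i k w * σ j k w := fun k => by
    have := hσc i k
    have := hσc j k
    fun_prop
  have h1 : ∀ k, |crossDissipation P (σ i k) (σ j k) a b -
      ∫ w in (0 : ℝ)..b, (P (a - w) - P (-w)) * σ i k w * σ j k w| ≤ S' * S * B * δ := by
    intro k
    rw [crossDissipation, ← intervalIntegral.integral_sub ((hJ k).intervalIntegrable _ _)
      ((hQ k).intervalIntegrable _ _), ← Real.norm_eq_abs]
    refine (intervalIntegral.norm_integral_le_of_norm_le_const (C := S' * δ * S)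
      fun w hw => ?_).trans ?_
    · have hw' : |w| ≤ B := by
        have := abs_nonneg b
        rcases mem_uIoc.1 hw with h | h <;> rw [abs_le] at * <;> constructor <;> linarith
      rw [← sub_mul, norm_mul, Real.norm_eq_abs, Real.norm_eq_abs]
      refine mul_le_mul ?_ (hS (j, k) w hw') (abs_nonneg _) (by positivity)
      exact hP.abs_integral_deriv_mul_sub_le (hσc i k) hS'0
        (fun w c hw hc => abs_sub_le_of_abs_deriv_le
          ((hadm.smooth_σ i k).differentiable (by simp)) (hS' (i, k)) hw hc) ha hw'
    · rw [sub_zero]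
      calc S' * δ * S * |b| ≤ S' * δ * S * B := by gcongr
        _ = S' * S * B * δ := by ring
  have h2 : ∑ k, ∫ w in (0 : ℝ)..b, (P (a - w) - P (-w)) * σ i k w * σ j k w =
      (∫ w in (0 : ℝ)..b, P (a - w) * deriv (A i j) w) -
        ∫ w in (0 : ℝ)..b, P (-w) * deriv (A i j) w := by
    rw [← intervalIntegral.integral_finsetSum fun k _ => (hQ k).intervalIntegrable _ _,
      ← intervalIntegral.integral_sub (Continuous.intervalIntegrable (by fun_prop) _ _)
        (Continuous.intervalIntegrable (by fun_prop) _ _)]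
    refine intervalIntegral.integral_congr fun w _ => ?_
    simp only [hadm.deriv_A, mul_assoc]
    rw [← Finset.mul_sum, ← sub_mul]
  have h3 : (∫ w in (0 : ℝ)..b, P (a - w) * deriv (A i j) w) =
      (∫ w in (0 : ℝ)..a, P (a - w) * deriv (A i j) w) -
        ∫ w in b..a, P (a - w) * deriv (A i j) w := by
    have hi : ∀ x y, IntervalIntegrable (fun w => P (a - w) * deriv (A i j) w) volume x y :=
      Continuous.intervalIntegrable (by fun_prop)
    rw [eq_sub_iff_add_eq, intervalIntegral.integral_add_adjacent_intervals (hi _ _) (hi _ _)]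
  have h4 := hP.abs_integral_sub_right_le (hadm.smooth_A i j) (hL (i, j)) hL0 hb ha
  have h5 : |(∑ k, crossDissipation P (σ i k) (σ j k) a b) -
      ∑ k, ∫ w in (0 : ℝ)..b, (P (a - w) - P (-w)) * σ i k w * σ j k w| ≤
        d * (S' * S * B) * δ := by
    rw [← Finset.sum_sub_distrib]
    refine (Finset.abs_sum_le_sum_abs _ _).trans ((Finset.sum_le_sum fun k _ => h1 k).trans ?_)
    simp [mul_assoc]
  rw [h2, h3] at h5
  unfold kruzhkovFlux
  rw [add_mul]
  rw [abs_le] at *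
  constructor <;> linarith [h4.1, h4.2, h5.1, h5.2]

end

/-! ### Test functions in doubled variables -/

section
variable {d : ℕ}

/-- The map `(p, q) ↦ (p, p - q)` is a continuous involution, so the support lies in the image of a
product of compact sets. -/
lemma hasCompactSupport_doubled {a b : ℝ × Space d → ℝ} (ha : HasCompactSupport a)
    (hb : HasCompactSupport b) :
    HasCompactSupport fun z : (ℝ × Space d) × (ℝ × Space d) => a z.1 * b (z.1 - z.2) := by
  refine HasCompactSupport.intro 
    (K := (fun z : (ℝ × Space d) × (ℝ × Space d) => (z.1, z.1 - z.2)) '' (tsupport a ×ˢ tsupport b))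
    ((IsCompact.prod ha hb).image (by fun_prop)) fun z hz => ?_
  by_contra hne
  have h1 : z.1 ∈ tsupport a := subset_tsupport _ (left_ne_zero_of_mul hne)
  have h2 : z.1 - z.2 ∈ tsupport b := subset_tsupport _ (right_ne_zero_of_mul hne)
  exact hz ⟨(z.1, z.1 - z.2), ⟨h1, h2⟩, by simp⟩

end

/-- The doubled space. -/
abbrev Doubled (d : ℕ) := (ℝ × Space d) × (ℝ × Space d)

/-- Nonlinear differential operators of the equation along a family of directions. -/
def diffOpAlong {d : ℕ} {V : Type*} [NormedAddCommGroup V] [NormedSpace ℝ V]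
    (T : ℝ × Space d → V) : Idx d → (V → ℝ) → V → ℝ :=
  Sum.elim (fun _ => dirDeriv (T (1, 0))) (Sum.elim (fun i => dirDeriv (T (0, Pi.single i 1)))
    (fun ij Φ => dirDeriv (T (0, Pi.single ij.1 1)) (dirDeriv (T (0, Pi.single ij.2 1)) Φ)))

/-- Test functions of doubled variables. -/
structure IsTestPair {d : ℕ} (Φ : Doubled d → ℝ) : Prop where
  smooth : ContDiff ℝ ∞ Φ
  hasCompactSupport : HasCompactSupport Φ
  tsupport_subset : tsupport Φ ⊆ domain d ×ˢ domain d

/-- The mixed second derivative `∂_{x_i} ∂_{y_j}`. -/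
def mixedDeriv {d : ℕ} (i j : Fin d) (Φ : Doubled d → ℝ) : Doubled d → ℝ :=
  dirDeriv (0, (0, Pi.single j 1)) (dirDeriv ((0, Pi.single i 1), 0) Φ)

section
variable {d : ℕ}

namespace IsTestPair
variable {Φ : Doubled d → ℝ} (hΦ : IsTestPair Φ)
include hΦ

lemma dirDeriv (e : Doubled d) : IsTestPair (dirDeriv e Φ) where
  smooth := contDiff_dirDeriv e hΦ.smooth
  hasCompactSupport := hΦ.hasCompactSupport.fderiv_apply ℝ e
  tsupport_subset := (tsupport_dirDeriv_subset e Φ).trans hΦ.tsupport_subset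

lemma diffOpAlong (T : ℝ × Space d → Doubled d) (ι : Idx d) : IsTestPair (diffOpAlong T ι Φ) := by
  rcases ι with _ | i | ij
  · exact hΦ.dirDeriv _
  · exact hΦ.dirDeriv _
  · exact (hΦ.dirDeriv _).dirDeriv _

lemma mixedDeriv (i j : Fin d) : IsTestPair (mixedDeriv i j Φ) := (hΦ.dirDeriv _).dirDeriv _

lemma continuous : Continuous Φ := hΦ.smooth.continuous

lemma integrable : Integrable Φ := hΦ.continuous.integrable_of_hasCompactSupport hΦ.hasCompactSupport

lemma slice_left (q : ℝ × Space d) : IsTestFunction fun p => Φ (p, q) where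
  smooth := hΦ.smooth.comp (contDiff_id.prodMk contDiff_const)
  hasCompactSupport := by
    refine HasCompactSupport.intro (IsCompact.image hΦ.hasCompactSupport continuous_fst)
      fun p hp => ?_
    by_contra hne
    exact hp ⟨(p, q), subset_tsupport _ hne, rfl⟩
  tsupport_subset := fun p hp =>
    (hΦ.tsupport_subset (tsupport_comp_subset_preimage Φ (f := fun p => (p, q)) (by fun_prop) hp)).1

lemma slice_right (p : ℝ × Space d) : IsTestFunction fun q => Φ (p, q) where
  smooth := hΦ.smooth.comp (contDiff_const.prodMk contDiff_id)
  hasCompactSupport := by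
    refine HasCompactSupport.intro (IsCompact.image hΦ.hasCompactSupport continuous_snd)
      fun q hq => ?_
    by_contra hne
    exact hq ⟨(p, q), subset_tsupport _ hne, rfl⟩
  tsupport_subset := fun q hq =>
    (hΦ.tsupport_subset (tsupport_comp_subset_preimage Φ (f := fun q => (p, q)) (by fun_prop) hq)).2

lemma dirDeriv_slice_left (e p q : ℝ × Space d) :
    AnisotropicAP.dirDeriv e (fun p => Φ (p, q)) p = AnisotropicAP.dirDeriv (e, 0) Φ (p, q) := by
  have h := (hΦ.smooth.differentiable (by simp) (p, q)).hasFDerivAt.comp p (hasFDerivAt_prodMk_left (𝕜 := ℝ) p q)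
  unfold AnisotropicAP.dirDeriv
  erw [h.fderiv]
  simp

lemma dirDeriv_slice_right (e p q : ℝ × Space d) :
    AnisotropicAP.dirDeriv e (fun q => Φ (p, q)) q = AnisotropicAP.dirDeriv (0, e) Φ (p, q) := by
  have h := (hΦ.smooth.differentiable (by simp) (p, q)).hasFDerivAt.comp q (hasFDerivAt_prodMk_right (𝕜 := ℝ) p q)
  unfold AnisotropicAP.dirDeriv
  erw [h.fderiv]
  simp

lemma diffOp_slice_left (ι : Idx d) (p q : ℝ × Space d) :
    diffOp ι (fun p => Φ (p, q)) p = AnisotropicAP.diffOpAlong (fun e => (e, 0)) ι Φ (p, q) := by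
  rcases ι with _ | i | ij
  · exact hΦ.dirDeriv_slice_left _ p q
  · exact hΦ.dirDeriv_slice_left _ p q
  · change AnisotropicAP.dirDeriv _ (AnisotropicAP.dirDeriv _ _) p = _
    rw [funext fun p => hΦ.dirDeriv_slice_left (0, Pi.single ij.2 1) p q]
    exact (hΦ.dirDeriv _).dirDeriv_slice_left _ p q

lemma diffOp_slice_right (ι : Idx d) (p q : ℝ × Space d) :
    diffOp ι (fun q => Φ (p, q)) q = AnisotropicAP.diffOpAlong (fun e => (0, e)) ι Φ (p, q) := by
  rcases ι with _ | i | ij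
  · exact hΦ.dirDeriv_slice_right _ p q
  · exact hΦ.dirDeriv_slice_right _ p q
  · change AnisotropicAP.dirDeriv _ (AnisotropicAP.dirDeriv _ _) q = _
    rw [funext fun q => hΦ.dirDeriv_slice_right (0, Pi.single ij.2 1) p q]
    exact (hΦ.dirDeriv _).dirDeriv_slice_right _ p q

/-- The operators in both groups of variables and the mixed derivatives add up to the operators
along the diagonal. -/
lemma sum_diffOpAlong {G : Idx d → ℝ}
    (hG : ∀ i j, G (Sum.inr (Sum.inr (i, j))) = G (Sum.inr (Sum.inr (j, i)))) (z : Doubled d) :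
    (∑ ι, G ι * AnisotropicAP.diffOpAlong (fun e => (e, 0)) ι Φ z) +
      (∑ ι, G ι * AnisotropicAP.diffOpAlong (fun e => (0, e)) ι Φ z) +
      2 * ∑ i, ∑ j, G (Sum.inr (Sum.inr (i, j))) * AnisotropicAP.mixedDeriv i j Φ z =
    ∑ ι, G ι * AnisotropicAP.diffOpAlong (fun e => (e, e)) ι Φ z := by
  have hdiag : ∀ (e : ℝ × Space d) (Ψ : Doubled d → ℝ) (z : Doubled d),
      AnisotropicAP.dirDeriv (e, e) Ψ z = AnisotropicAP.dirDeriv (e, 0) Ψ z +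
        AnisotropicAP.dirDeriv (0, e) Ψ z := by
    intro e Ψ z
    rw [← dirDeriv_add_left]; simp
  have hdiag2 : ∀ (e e' : ℝ × Space d),
      AnisotropicAP.dirDeriv (e, e) (AnisotropicAP.dirDeriv (e', e') Φ) z =
        AnisotropicAP.dirDeriv (e, 0) (AnisotropicAP.dirDeriv (e', 0) Φ) z +
        AnisotropicAP.dirDeriv (0, e) (AnisotropicAP.dirDeriv (0, e') Φ) z +
        AnisotropicAP.dirDeriv (0, e') (AnisotropicAP.dirDeriv (e, 0) Φ) z +
        AnisotropicAP.dirDeriv (0, e) (AnisotropicAP.dirDeriv (e', 0) Φ) z := by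
    intro e e'
    rw [hdiag, funext (hdiag e' Φ), dirDeriv_add_right (hΦ.dirDeriv _).smooth (hΦ.dirDeriv _).smooth,
      dirDeriv_add_right (hΦ.dirDeriv _).smooth (hΦ.dirDeriv _).smooth,
      dirDeriv_comm hΦ.smooth (e, 0) (0, e')]
    ring
  -- Expanding `(∂_x + ∂_y)_i (∂_x + ∂_y)_j` produces two mixed terms that are transposes of one
  -- another; the symmetry of `G` merges them into the factor 2.
  have hsym : ∑ i, ∑ j, G (Sum.inr (Sum.inr (i, j))) * AnisotropicAP.mixedDeriv i j Φ z =
      ∑ i, ∑ j, G (Sum.inr (Sum.inr (i, j))) * AnisotropicAP.mixedDeriv j i Φ z := by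
    rw [Finset.sum_comm]
    exact Finset.sum_congr rfl fun i _ => Finset.sum_congr rfl fun j _ => by rw [hG]
  rw [two_mul]
  nth_rewrite 2 [hsym]
  simp only [Fintype.sum_sum_type, Fintype.sum_prod_type, AnisotropicAP.diffOpAlong, Sum.elim_inl,
    Sum.elim_inr, Finset.univ_unique, Finset.sum_singleton, hdiag2, AnisotropicAP.mixedDeriv]
  simp only [hdiag, mul_add, Finset.sum_add_distrib]
  ring

end IsTestPair

/-! ### Integrability in doubled variables -/

/-- `G` is integrable on the compact projection of the support, and the projection to the other
variable has finite measure; the product of the two indicators dominates. -/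
lemma IsTestPair.integrable_fst_mul {Ψ : Doubled d → ℝ} (hΨ : IsTestPair Ψ) {G : ℝ × Space d → ℝ}
    (hG : LocallyIntegrable G) : Integrable fun z : Doubled d => G z.1 * Ψ z := by
  have hK : IsCompact (Prod.fst '' tsupport Ψ) := IsCompact.image hΨ.hasCompactSupport continuous_fst
  have hK' : IsCompact (Prod.snd '' tsupport Ψ) := IsCompact.image hΨ.hasCompactSupport continuous_snd
  have h1 : Integrable ((Prod.fst '' tsupport Ψ).indicator G) :=
    (hG.integrableOn_isCompact hK).integrable_indicator hK.measurableSet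
  have h2 : Integrable ((Prod.snd '' tsupport Ψ).indicator fun _ => (1 : ℝ)) :=
    (integrableOn_const hK'.measure_lt_top.ne).integrable_indicator hK'.measurableSet
  have h3 := h1.mul_prod h2
  obtain ⟨C, hC⟩ := hΨ.hasCompactSupport.exists_bound_of_continuous hΨ.continuous
  refine (h3.mul_bdd hΨ.continuous.aestronglyMeasurable (Eventually.of_forall hC)).congr
    (Eventually.of_forall fun z => ?_)
  by_cases hz : z ∈ tsupport Ψ
  · simp [indicator_of_mem (mem_image_of_mem Prod.fst hz), indicator_of_mem (mem_image_of_mem Prod.snd hz)]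
  · simp [image_eq_zero_of_notMem_tsupport hz]

lemma IsTestPair.integrable_snd_mul {Ψ : Doubled d → ℝ} (hΨ : IsTestPair Ψ) {G : ℝ × Space d → ℝ}
    (hG : LocallyIntegrable G) : Integrable fun z : Doubled d => G z.2 * Ψ z := by
  have hK : IsCompact (Prod.fst '' tsupport Ψ) := IsCompact.image hΨ.hasCompactSupport continuous_fst
  have hK' : IsCompact (Prod.snd '' tsupport Ψ) := IsCompact.image hΨ.hasCompactSupport continuous_snd
  have h1 : Integrable ((Prod.snd '' tsupport Ψ).indicator G) :=
    (hG.integrableOn_isCompact hK').integrable_indicator hK'.measurableSet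
  have h2 : Integrable ((Prod.fst '' tsupport Ψ).indicator fun _ => (1 : ℝ)) :=
    (integrableOn_const hK.measure_lt_top.ne).integrable_indicator hK.measurableSet
  have h3 := h2.mul_prod h1
  obtain ⟨C, hC⟩ := hΨ.hasCompactSupport.exists_bound_of_continuous hΨ.continuous
  refine (h3.mul_bdd hΨ.continuous.aestronglyMeasurable (Eventually.of_forall hC)).congr
    (Eventually.of_forall fun z => ?_)
  by_cases hz : z ∈ tsupport Ψ
  · simp [indicator_of_mem (mem_image_of_mem Prod.fst hz), indicator_of_mem (mem_image_of_mem Prod.snd hz)]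
  · simp [image_eq_zero_of_notMem_tsupport hz]

lemma exists_bound_square {F : ℝ × ℝ → ℝ} (hF : Continuous F) (B : ℝ) :
    ∃ M, ∀ a b, |a| ≤ B → |b| ≤ B → |F (a, b)| ≤ M := by
  obtain ⟨M, hM⟩ := ((isCompact_Icc (a := -B) (b := B)).prod
    (isCompact_Icc (a := -B) (b := B))).exists_bound_of_continuousOn hF.continuousOn
  exact ⟨M, fun a b ha hb => hM (a, b) ⟨abs_le.1 ha, abs_le.1 hb⟩⟩

lemma integrable_comp_prod_mul {u v : ℝ × Space d → ℝ} {B : ℝ} (hu : Measurable u)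
    (hv : Measurable v) (huB : ∀ p, |u p| ≤ B) (hvB : ∀ p, |v p| ≤ B) {F : ℝ × ℝ → ℝ}
    (hF : Continuous F) {Ψ : Doubled d → ℝ} (hΨ : Integrable Ψ) :
    Integrable fun z : Doubled d => F (u z.1, v z.2) * Ψ z := by
  obtain ⟨M, hM⟩ := exists_bound_square hF B
  refine hΨ.bdd_mul (c := M) (hF.measurable.comp ((hu.comp measurable_fst).prodMk
    (hv.comp measurable_snd))).aestronglyMeasurable (Eventually.of_forall fun z => ?_)
  exact hM _ _ (huB _) (hvB _)

variable {f : Fin d → ℝ → ℝ} {A σ : Fin d → Fin d → ℝ → ℝ} {B : ℝ} {u v : ℝ × Space d → ℝ}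
  {g h : Fin d → ℝ × Space d → ℝ} {δ : ℝ} {P : ℝ → ℝ} {Φ : Doubled d → ℝ}

lemma IsEntropyPair.locallyIntegrable_diss (hu : IsEntropyPair f A σ B u g) (k : Fin d) :
    LocallyIntegrable (g k) := by
  have h1 : LocallyIntegrable (fun p => 1 + g k p ^ 2) :=
    (locallyIntegrable_const 1).add (hu.locallyIntegrable_sq k)
  refine h1.mono (hu.measurable_diss k).aestronglyMeasurable (Eventually.of_forall fun p => ?_)
  rw [Real.norm_eq_abs, Real.norm_eq_abs, abs_of_nonneg (by positivity : 0 ≤ 1 + g k p ^ 2), abs_le]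
  constructor <;> nlinarith [sq_nonneg (g k p - 1), sq_nonneg (g k p + 1)]

/-- By `|gh| ≤ g² + h²`, local square integrability of each factor in its own variable suffices. -/
lemma integrable_diss_mul_diss (hu : IsEntropyPair f A σ B u g) (hv : IsEntropyPair f A σ B v h)
    (hΦ : IsTestPair Φ) (k : Fin d) : Integrable fun z : Doubled d => g k z.1 * h k z.2 * Φ z := by
  refine Integrable.mono' (((hΦ.integrable_fst_mul (hu.locallyIntegrable_sq k)).abs).add
    ((hΦ.integrable_snd_mul (hv.locallyIntegrable_sq k)).abs)) ?_ (Eventually.of_forall fun z => ?_)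
  · exact ((((hu.measurable_diss k).comp measurable_fst).mul
      ((hv.measurable_diss k).comp measurable_snd)).mul hΦ.continuous.measurable).aestronglyMeasurable
  · simp only [Pi.add_apply, abs_mul, Real.norm_eq_abs, ← add_mul, abs_pow, sq_abs]
    refine mul_le_mul_of_nonneg_right ?_ (abs_nonneg _)
    nlinarith [sq_nonneg (|g k z.1| - |h k z.2|), sq_abs (g k z.1), sq_abs (h k z.2),
      abs_nonneg (g k z.1), abs_nonneg (h k z.2)]

/-- The chain rule in both groups of variables. -/
lemma integral_cross_diss (hadm : IsAdmissible f A σ) (hP : IsSmoothStep δ P)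
    (hu : IsEntropyPair f A σ B u g) (hv : IsEntropyPair f A σ B v h) (hΦ : IsTestPair Φ)
    (k : Fin d) :
    ∫ z : Doubled d, deriv P (u z.1 - v z.2) * (g k z.1 * h k z.2 * Φ z) =
      ∫ z : Doubled d, ∑ i, ∑ j, crossDissipation P (σ i k) (σ j k) (u z.1) (v z.2) *
        mixedDeriv i j Φ z := by
  have hdP := hP.continuous_deriv
  have hσ := fun i => (hadm.smooth_σ i k).continuous
  have hJ := fun i => continuous_crossInner hP (hσ i)
  have hΓ := fun i j => continuous_crossDissipation hP (hσ i) (hσ j)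
  set D1 : Fin d → Doubled d → ℝ := fun i => dirDeriv ((0, Pi.single i 1), 0) Φ with hD1
  have hD1t : ∀ i, IsTestPair (D1 i) := fun i => hΦ.dirDeriv _
  have hI1 : Integrable fun z : Doubled d => deriv P (u z.1 - v z.2) * (g k z.1 * h k z.2 * Φ z) :=
    integrable_comp_prod_mul (F := fun x => deriv P (x.1 - x.2)) hu.measurable hv.measurable
      hu.bound hv.bound (by fun_prop) (integrable_diss_mul_diss hu hv hΦ k)
  have hI2 : ∀ i, Integrable fun z : Doubled d =>
      crossInner P (σ i k) (u z.1) (v z.2) * (h k z.2 * D1 i z) := fun i =>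
    integrable_comp_prod_mul (F := fun x => crossInner P (σ i k) x.1 x.2) hu.measurable
      hv.measurable hu.bound hv.bound (hJ i)
      ((hD1t i).integrable_snd_mul (hv.locallyIntegrable_diss k))
  have hI3 : ∀ i j, Integrable fun z : Doubled d =>
      crossDissipation P (σ i k) (σ j k) (u z.1) (v z.2) * mixedDeriv i j Φ z := fun i j =>
    integrable_comp_prod_mul (F := fun x => crossDissipation P (σ i k) (σ j k) x.1 x.2) hu.measurable
      hv.measurable hu.bound hv.bound (hΓ i j) (hΦ.mixedDeriv i j).integrable
  -- For frozen `q`, the chain rule of `u` with `ψ = P'(· - v q)` removes `g k` and puts one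
  -- derivative `∂_{x_i}` on `Φ`.
  have step1 : ∫ z : Doubled d, deriv P (u z.1 - v z.2) * (g k z.1 * h k z.2 * Φ z) =
      -∫ z : Doubled d, ∑ i, crossInner P (σ i k) (u z.1) (v z.2) * (h k z.2 * D1 i z) := by
    rw [← integral_neg]
    erw [integral_prod_symm _ hI1, integral_prod_symm _ (integrable_finsetSum _ fun i _ => hI2 i).neg]
    refine integral_congr_ae (Eventually.of_forall fun q => ?_)
    have hc := hu.chain (fun w => deriv P (w - v q)) (by fun_prop) k _ (hΦ.slice_left q)
    have e1 : ∫ p, deriv P (u p - v q) * (g k p * h k q * Φ (p, q)) =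
        h k q * ∫ p, deriv P (u p - v q) * g k p * Φ (p, q) := by
      rw [← integral_const_mul]; congr 1; ext p; ring
    have e2 : ∫ p, -∑ i, crossInner P (σ i k) (u p) (v q) * (h k q * D1 i (p, q)) =
        -(h k q * ∫ p, ∑ i, (∫ w in (0 : ℝ)..u p, deriv P (w - v q) * σ i k w) *
          dx i (fun p => Φ (p, q)) p) := by
      rw [← integral_const_mul, ← integral_neg]; congr 1; ext p
      rw [Finset.mul_sum]
      congr 1
      refine Finset.sum_congr rfl fun i _ => ?_
      rw [dx_eq_dirDeriv, hΦ.dirDeriv_slice_left, crossInner]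
      simp only [hD1]
      ring
    have hcc : (∫ p, deriv P (u p - v q) * (g k p * h k q * Φ (p, q))) =
        ∫ p, -∑ i, crossInner P (σ i k) (u p) (v q) * (h k q * D1 i (p, q)) := by
      rw [e1, e2, hc]; ring
    exact hcc
  -- For frozen `p`, the chain rule of `v` with `ψ = crossInner P (σ i k) (u p)` removes `h k`; its
  -- minus sign cancels the first one. That arbitrary continuous `ψ` are admitted in the chain rule
  -- is essential here.
  have step2 : ∀ i, ∫ z : Doubled d, crossInner P (σ i k) (u z.1) (v z.2) * (h k z.2 * D1 i z) =
      -∫ z : Doubled d, ∑ j, crossDissipation P (σ i k) (σ j k) (u z.1) (v z.2) *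
        mixedDeriv i j Φ z := by
    intro i
    rw [← integral_neg]
    erw [integral_prod _ (hI2 i), integral_prod _ (integrable_finsetSum _ fun j _ => hI3 i j).neg]
    refine integral_congr_ae (Eventually.of_forall fun p => ?_)
    have hc := hv.chain (fun w => crossInner P (σ i k) (u p) w)
      ((hJ i).comp (by fun_prop : Continuous fun w : ℝ => (u p, w))) k _ ((hD1t i).slice_right p)
    have hcc : (∫ q, crossInner P (σ i k) (u p) (v q) * (h k q * D1 i (p, q))) =
        ∫ q, -∑ j, crossDissipation P (σ i k) (σ j k) (u p) (v q) * mixedDeriv i j Φ (p, q) := by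
      rw [integral_neg, ← neg_eq_iff_eq_neg]
      simp only [← mul_assoc]
      rw [← hc]
      congr 1; ext q
      refine Finset.sum_congr rfl fun j _ => ?_
      rw [dx_eq_dirDeriv, (hD1t i).dirDeriv_slice_right]
      rfl
    exact hcc
  rw [step1, integral_finsetSum _ fun i _ => hI2 i, integral_finsetSum _ fun i _ =>
    integrable_finsetSum _ fun j _ => hI3 i j]
  simp [step2]

end

/-! ### Doubling of variables -/

section
variable {d : ℕ} {f : Fin d → ℝ → ℝ} {A σ : Fin d → Fin d → ℝ → ℝ} {B : ℝ}
  {u v : ℝ × Space d → ℝ} {g h : Fin d → ℝ × Space d → ℝ} {δ : ℝ} {P : ℝ → ℝ} {Φ : Doubled d → ℝ}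

lemma integrable_kruzhkovFlux (hadm : IsAdmissible f A σ) (hu : IsEntropyPair f A σ B u g)
    (hv : IsEntropyPair f A σ B v h) (ι : Idx d) {Ψ : Doubled d → ℝ} (hΨ : Integrable Ψ) :
    Integrable fun z : Doubled d => kruzhkovFlux (fluxFn f A ι) (u z.1) (v z.2) * Ψ z :=
  integrable_comp_prod_mul (F := fun x => kruzhkovFlux (fluxFn f A ι) x.1 x.2) hu.measurable
    hv.measurable hu.bound hv.bound (continuous_kruzhkovFlux (contDiff_fluxFn hadm ι).continuous) hΨ

lemma integrable_diss_left (hP : IsSmoothStep δ P) (hu : IsEntropyPair f A σ B u g)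
    (hv : IsEntropyPair f A σ B v h) (hΦ : IsTestPair Φ) (k : Fin d) :
    Integrable fun z : Doubled d => deriv P (u z.1 - v z.2) * (g k z.1 ^ 2 * Φ z) :=
  have := hP.continuous_deriv
  integrable_comp_prod_mul (F := fun x => deriv P (x.1 - x.2)) hu.measurable hv.measurable
    hu.bound hv.bound (by fun_prop) (hΦ.integrable_fst_mul (hu.locallyIntegrable_sq k))

lemma integrable_diss_right (hP : IsSmoothStep δ P) (hu : IsEntropyPair f A σ B u g)
    (hv : IsEntropyPair f A σ B v h) (hΦ : IsTestPair Φ) (k : Fin d) :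
    Integrable fun z : Doubled d => deriv P (u z.1 - v z.2) * (h k z.2 ^ 2 * Φ z) :=
  have := hP.continuous_deriv
  integrable_comp_prod_mul (F := fun x => deriv P (x.1 - x.2)) hu.measurable hv.measurable
    hu.bound hv.bound (by fun_prop) (hΦ.integrable_snd_mul (hv.locallyIntegrable_sq k))

/-- Freeze `q`, use the Kružkov inequality of `u` with `c = v q`, and integrate over `q`. -/
lemma integral_diss_left_le (hadm : IsAdmissible f A σ) (hP : IsSmoothStep δ P)
    {L : ℝ} (hL0 : 0 ≤ L) (hL : ∀ ι s, |s| ≤ B → |deriv (fluxFn f A ι) s| ≤ L)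
    (hu : IsEntropyPair f A σ B u g) (hv : IsEntropyPair f A σ B v h) (hΦ : IsTestPair Φ)
    (h0 : ∀ z, 0 ≤ Φ z) :
    ∫ z : Doubled d, ∑ k, deriv P (u z.1 - v z.2) * (g k z.1 ^ 2 * Φ z) ≤
      (∫ z : Doubled d, ∑ ι, kruzhkovFlux (fluxFn f A ι) (u z.1) (v z.2) *
        diffOpAlong (fun e => (e, 0)) ι Φ z) +
        L * δ * ∫ z : Doubled d, ∑ ι, |diffOpAlong (fun e => (e, 0)) ι Φ z| := by
  have hI1 : Integrable fun z : Doubled d => ∑ k, deriv P (u z.1 - v z.2) * (g k z.1 ^ 2 * Φ z) :=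
    integrable_finsetSum _ fun k _ => integrable_diss_left hP hu hv hΦ k
  have hI2 : Integrable fun z : Doubled d => ∑ ι, kruzhkovFlux (fluxFn f A ι) (u z.1) (v z.2) *
      diffOpAlong (fun e => (e, 0)) ι Φ z := integrable_finsetSum _ fun ι _ =>
    integrable_kruzhkovFlux hadm hu hv ι (hΦ.diffOpAlong _ ι).integrable
  have hI3 : Integrable fun z : Doubled d => ∑ ι, |diffOpAlong (fun e => (e, 0)) ι Φ z| :=
    integrable_finsetSum _ fun ι _ => (hΦ.diffOpAlong _ ι).integrable.abs
  erw [integral_prod_symm _ hI1, integral_prod_symm _ hI2, integral_prod_symm _ hI3]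
  rw [← integral_const_mul, ← integral_add]
  · refine integral_mono hI1.integral_prod_right
      (hI2.integral_prod_right.add (hI3.integral_prod_right.const_mul _)) fun q => ?_
    have key := hu.kruzhkov_left hadm hP hL0 hL (hv.bound q) (hΦ.slice_left q) fun p => h0 _
    simp only [hΦ.diffOp_slice_left, Finset.mul_sum, Finset.sum_mul, mul_assoc] at key
    simpa only [Finset.mul_sum, mul_assoc] using key
  · exact hI2.integral_prod_right
  · exact hI3.integral_prod_right.const_mul _

/-- Freeze `p`, use the Kružkov inequality of `v` with `c = u p`, and integrate over `p`. -/
lemma integral_diss_right_le (hadm : IsAdmissible f A σ) (hP : IsSmoothStep δ P)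
    {L : ℝ} (hL0 : 0 ≤ L) (hL : ∀ ι s, |s| ≤ B → |deriv (fluxFn f A ι) s| ≤ L)
    (hu : IsEntropyPair f A σ B u g) (hv : IsEntropyPair f A σ B v h) (hΦ : IsTestPair Φ)
    (h0 : ∀ z, 0 ≤ Φ z) :
    ∫ z : Doubled d, ∑ k, deriv P (u z.1 - v z.2) * (h k z.2 ^ 2 * Φ z) ≤
      (∫ z : Doubled d, ∑ ι, kruzhkovFlux (fluxFn f A ι) (u z.1) (v z.2) *
        diffOpAlong (fun e => (0, e)) ι Φ z) +
        L * δ * ∫ z : Doubled d, ∑ ι, |diffOpAlong (fun e => (0, e)) ι Φ z| := by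
  have hI1 : Integrable fun z : Doubled d => ∑ k, deriv P (u z.1 - v z.2) * (h k z.2 ^ 2 * Φ z) :=
    integrable_finsetSum _ fun k _ => integrable_diss_right hP hu hv hΦ k
  have hI2 : Integrable fun z : Doubled d => ∑ ι, kruzhkovFlux (fluxFn f A ι) (u z.1) (v z.2) *
      diffOpAlong (fun e => (0, e)) ι Φ z := integrable_finsetSum _ fun ι _ =>
    integrable_kruzhkovFlux hadm hu hv ι (hΦ.diffOpAlong _ ι).integrable
  have hI3 : Integrable fun z : Doubled d => ∑ ι, |diffOpAlong (fun e => (0, e)) ι Φ z| :=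
    integrable_finsetSum _ fun ι _ => (hΦ.diffOpAlong _ ι).integrable.abs
  erw [integral_prod _ hI1, integral_prod _ hI2, integral_prod _ hI3]
  rw [← integral_const_mul, ← integral_add]
  · refine integral_mono hI1.integral_prod_left
      (hI2.integral_prod_left.add (hI3.integral_prod_left.const_mul _)) fun p => ?_
    have key := hv.kruzhkov_right hadm hP hL0 hL (hu.bound p) (hΦ.slice_right p) fun p => h0 _
    simp only [hΦ.diffOp_slice_right, Finset.mul_sum, Finset.sum_mul, mul_assoc] at key
    simpa only [Finset.mul_sum, mul_assoc] using key
  · exact hI2.integral_prod_left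
  · exact hI3.integral_prod_left.const_mul _

/-- For fixed `p` the factor `κ (u p)` is constant, and the `y_j`-derivative integrates to zero in
`q`. This disposes of the one-variable remainder `κ₁` of the cross dissipation. -/
lemma integral_fst_mul_mixedDeriv (hu : IsEntropyPair f A σ B u g) {κ : ℝ → ℝ} (hκ : Continuous κ)
    (hΦ : IsTestPair Φ) (i j : Fin d) :
    Integrable (fun z : Doubled d => κ (u z.1) * mixedDeriv i j Φ z) ∧
    ∫ z : Doubled d, κ (u z.1) * mixedDeriv i j Φ z = 0 := by
  have hI : Integrable (fun z : Doubled d => κ (u z.1) * mixedDeriv i j Φ z) :=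
    integrable_comp_prod_mul (F := fun x => κ x.1) hu.measurable hu.measurable hu.bound
      hu.bound (by fun_prop) (hΦ.mixedDeriv i j).integrable
  refine ⟨hI, ?_⟩
  erw [integral_prod _ hI]
  refine integral_eq_zero_of_ae (Eventually.of_forall fun p => ?_)
  have := integral_dirDeriv_eq_zero ((hΦ.dirDeriv ((0, Pi.single i 1), 0)).slice_right p)
    (0, Pi.single j 1)
  simp only [(hΦ.dirDeriv _).dirDeriv_slice_right] at this
  simp only [integral_const_mul]
  exact mul_eq_zero_of_right _ this

/-- The counterpart for `κ₂`: the derivatives are commuted first, so that the one in `x_i` is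
outermost and integrates to zero in `p`. -/
lemma integral_snd_mul_mixedDeriv (hu : IsEntropyPair f A σ B u g) {κ : ℝ → ℝ} (hκ : Continuous κ)
    (hΦ : IsTestPair Φ) (i j : Fin d) :
    Integrable (fun z : Doubled d => κ (u z.2) * mixedDeriv i j Φ z) ∧
    ∫ z : Doubled d, κ (u z.2) * mixedDeriv i j Φ z = 0 := by
  have hI : Integrable (fun z : Doubled d => κ (u z.2) * mixedDeriv i j Φ z) :=
    integrable_comp_prod_mul (F := fun x => κ x.2) hu.measurable hu.measurable hu.bound
      hu.bound (by fun_prop) (hΦ.mixedDeriv i j).integrable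
  refine ⟨hI, ?_⟩
  erw [integral_prod_symm _ hI]
  refine integral_eq_zero_of_ae (Eventually.of_forall fun q => ?_)
  have := integral_dirDeriv_eq_zero ((hΦ.dirDeriv (0, (0, Pi.single j 1))).slice_left q)
    (0, Pi.single i 1)
  simp only [(hΦ.dirDeriv _).dirDeriv_slice_left] at this
  rw [dirDeriv_comm hΦ.smooth] at this
  simp only [integral_const_mul]
  exact mul_eq_zero_of_right _ this

/-- The Kružkov inequality in doubled variables. -/
lemma doubled_kruzhkov (hadm : IsAdmissible f A σ) (hu : IsEntropyPair f A σ B u g)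
    (hv : IsEntropyPair f A σ B v h) (hΦ : IsTestPair Φ) (h0 : ∀ z, 0 ≤ Φ z) :
    0 ≤ ∫ z : Doubled d, ∑ ι, kruzhkovFlux (fluxFn f A ι) (u z.1) (v z.2) *
      diffOpAlong (fun e => (e, e)) ι Φ z := by
  have hB : 0 ≤ B := (abs_nonneg _).trans (hu.bound 0)
  obtain ⟨L, hL0, hL⟩ := exists_uniform_bound_Icc (fun ι => continuous_deriv_fluxFn hadm ι) B
  obtain ⟨C, hC0, hC⟩ := exists_crossDissipation_bound hadm hB
  set I1 := ∫ z : Doubled d, ∑ ι, |diffOpAlong (fun e => (e, 0)) ι Φ z|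
  set I2 := ∫ z : Doubled d, ∑ ι, |diffOpAlong (fun e => (0, e)) ι Φ z|
  set I3 := ∫ z : Doubled d, ∑ i, ∑ j, |mixedDeriv i j Φ z|
  set T1 := ∫ z : Doubled d, ∑ ι, kruzhkovFlux (fluxFn f A ι) (u z.1) (v z.2) *
        diffOpAlong (fun e => (e, 0)) ι Φ z with hT1
  set T2 := ∫ z : Doubled d, ∑ ι, kruzhkovFlux (fluxFn f A ι) (u z.1) (v z.2) *
        diffOpAlong (fun e => (0, e)) ι Φ z with hT2
  set T3 := ∫ z : Doubled d, ∑ i, ∑ j, kruzhkovFlux (A i j) (u z.1) (v z.2) *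
        mixedDeriv i j Φ z with hT3
  have hiT : ∀ (T : ℝ × Space d → Doubled d), Integrable fun z : Doubled d =>
      ∑ ι, kruzhkovFlux (fluxFn f A ι) (u z.1) (v z.2) * diffOpAlong T ι Φ z := fun T =>
    integrable_finsetSum _ fun ι _ =>
      integrable_kruzhkovFlux hadm hu hv ι (hΦ.diffOpAlong _ ι).integrable
  have hiG : ∀ i j, Integrable fun z : Doubled d =>
      kruzhkovFlux (A i j) (u z.1) (v z.2) * mixedDeriv i j Φ z := fun i j =>
    integrable_kruzhkovFlux hadm hu hv (Sum.inr (Sum.inr (i, j))) (hΦ.mixedDeriv i j).integrable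
  have hiG' : Integrable fun z : Doubled d => ∑ i, ∑ j,
      kruzhkovFlux (A i j) (u z.1) (v z.2) * mixedDeriv i j Φ z :=
    integrable_finsetSum _ fun i _ => integrable_finsetSum _ fun j _ => hiG i j
  have hiM : Integrable fun z : Doubled d => ∑ i, ∑ j, |mixedDeriv i j Φ z| :=
    integrable_finsetSum _ fun i _ => integrable_finsetSum _ fun j _ =>
      (hΦ.mixedDeriv i j).integrable.abs
  have hsum : T1 + T2 + 2 * T3 = ∫ z : Doubled d, ∑ ι,
      kruzhkovFlux (fluxFn f A ι) (u z.1) (v z.2) * diffOpAlong (fun e => (e, e)) ι Φ z := by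
    have a1 := integral_add (hiT fun e => (e, 0)) (hiT fun e => (0, e))
    have a2 := integral_add ((hiT fun e => (e, 0)).add (hiT fun e => (0, e))) (hiG'.const_mul 2)
    simp only [Pi.add_apply] at a2
    rw [a1, integral_const_mul] at a2
    refine a2.symm.trans (integral_congr_ae (Eventually.of_forall fun z => ?_))
    exact hΦ.sum_diffOpAlong (G := fun ι => kruzhkovFlux (fluxFn f A ι) (u z.1) (v z.2))
      (fun i j => by simp only [fluxFn, Sum.elim_inr]; rw [hadm.symm_A]) z
  rw [← hsum]
  -- Up to `O(δ)`, `T1` and `T2` bound the two dissipations from above, while completing the square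
  -- and the chain rule bound the sum of the dissipations from below by `-2 * T3`.
  have main : ∀ δ : ℝ, 0 < δ → 0 ≤ T1 + T2 + 2 * T3 + δ * (L * I1 + L * I2 + 2 * (C * I3)) := by
    intro δ hδ
    obtain ⟨P, hP⟩ := exists_isSmoothStep hδ
    have e1 := integral_diss_left_le hadm hP hL0 hL hu hv hΦ h0
    have e2 := integral_diss_right_le hadm hP hL0 hL hu hv hΦ h0
    -- This is `0 ≤ P'(u - v) Φ (g - h)²` integrated; it uses `P' ≥ 0` and `Φ ≥ 0`.
    have e3 : 2 * ∑ k, ∫ z : Doubled d, deriv P (u z.1 - v z.2) * (g k z.1 * h k z.2 * Φ z) ≤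
        (∫ z : Doubled d, ∑ k, deriv P (u z.1 - v z.2) * (g k z.1 ^ 2 * Φ z)) +
        ∫ z : Doubled d, ∑ k, deriv P (u z.1 - v z.2) * (h k z.2 ^ 2 * Φ z) := by
      rw [integral_finsetSum _ fun k _ => integrable_diss_left hP hu hv hΦ k,
        integral_finsetSum _ fun k _ => integrable_diss_right hP hu hv hΦ k,
        ← Finset.sum_add_distrib, Finset.mul_sum]
      refine Finset.sum_le_sum fun k _ => ?_
      have hPd := hP.continuous_deriv
      have hI : Integrable fun z : Doubled d => deriv P (u z.1 - v z.2) * (g k z.1 * h k z.2 * Φ z) :=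
        integrable_comp_prod_mul (F := fun x => deriv P (x.1 - x.2)) hu.measurable hv.measurable
          hu.bound hv.bound (by fun_prop) (integrable_diss_mul_diss hu hv hΦ k)
      have hI1 := integrable_diss_left hP hu hv hΦ k
      have hI2 := integrable_diss_right hP hu hv hΦ k
      rw [← integral_const_mul, ← integral_add hI1 hI2]
      refine integral_mono (hI.const_mul 2) (hI1.add hI2) fun z => ?_
      have h1 : 0 ≤ deriv P (u z.1 - v z.2) * Φ z := mul_nonneg (hP.deriv_nonneg _) (h0 z)
      have h2 := mul_nonneg h1 (sq_nonneg (g k z.1 - h k z.2))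
      simp only
      nlinarith [h2]
    have hΓi : ∀ i j k, Integrable fun z : Doubled d =>
        crossDissipation P (σ i k) (σ j k) (u z.1) (v z.2) * mixedDeriv i j Φ z := fun i j k =>
      integrable_comp_prod_mul (F := fun x => crossDissipation P (σ i k) (σ j k) x.1 x.2)
        hu.measurable hv.measurable hu.bound hv.bound (continuous_crossDissipation hP
          (hadm.smooth_σ i k).continuous (hadm.smooth_σ j k).continuous) (hΦ.mixedDeriv i j).integrable
    have e4 : ∑ k, ∫ z : Doubled d, deriv P (u z.1 - v z.2) * (g k z.1 * h k z.2 * Φ z) =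
        ∫ z : Doubled d, ∑ i, ∑ j, (∑ k, crossDissipation P (σ i k) (σ j k) (u z.1) (v z.2)) *
          mixedDeriv i j Φ z := by
      rw [Finset.sum_congr rfl fun k _ => integral_cross_diss hadm hP hu hv hΦ k,
        ← integral_finsetSum _ fun k _ => integrable_finsetSum _ fun i _ =>
          integrable_finsetSum _ fun j _ => hΓi i j k]
      refine integral_congr_ae (Eventually.of_forall fun z => ?_)
      simp only [Finset.sum_mul]
      rw [Finset.sum_comm]
      exact Finset.sum_congr rfl fun i _ => Finset.sum_comm
    choose κ₁ κ₂ hκ₁ hκ₂ hκ using hC δ P hP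
    have e5 : -T3 - C * δ * I3 ≤
        ∫ z : Doubled d, ∑ i, ∑ j, (∑ k, crossDissipation P (σ i k) (σ j k) (u z.1) (v z.2)) *
          mixedDeriv i j Φ z := by
      have z1 : ∫ z : Doubled d, ∑ i, ∑ j, κ₁ i j (u z.1) * mixedDeriv i j Φ z = 0 := by
        rw [integral_finsetSum _ fun i _ => integrable_finsetSum _ fun j _ =>
          (integral_fst_mul_mixedDeriv hu (hκ₁ i j) hΦ i j).1]
        refine Finset.sum_eq_zero fun i _ => ?_
        rw [integral_finsetSum _ fun j _ => (integral_fst_mul_mixedDeriv hu (hκ₁ i j) hΦ i j).1]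
        exact Finset.sum_eq_zero fun j _ => (integral_fst_mul_mixedDeriv hu (hκ₁ i j) hΦ i j).2
      have z2 : ∫ z : Doubled d, ∑ i, ∑ j, κ₂ i j (v z.2) * mixedDeriv i j Φ z = 0 := by
        rw [integral_finsetSum _ fun i _ => integrable_finsetSum _ fun j _ =>
          (integral_snd_mul_mixedDeriv hv (hκ₂ i j) hΦ i j).1]
        refine Finset.sum_eq_zero fun i _ => ?_
        rw [integral_finsetSum _ fun j _ => (integral_snd_mul_mixedDeriv hv (hκ₂ i j) hΦ i j).1]
        exact Finset.sum_eq_zero fun j _ => (integral_snd_mul_mixedDeriv hv (hκ₂ i j) hΦ i j).2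
      have i1 : Integrable fun z : Doubled d => ∑ i, ∑ j, κ₁ i j (u z.1) * mixedDeriv i j Φ z :=
        integrable_finsetSum _ fun i _ => integrable_finsetSum _ fun j _ =>
          (integral_fst_mul_mixedDeriv hu (hκ₁ i j) hΦ i j).1
      have i2 : Integrable fun z : Doubled d => ∑ i, ∑ j, κ₂ i j (v z.2) * mixedDeriv i j Φ z :=
        integrable_finsetSum _ fun i _ => integrable_finsetSum _ fun j _ =>
          (integral_snd_mul_mixedDeriv hv (hκ₂ i j) hΦ i j).1
      have i3 : Integrable fun z : Doubled d => ∑ i, ∑ j,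
          (∑ k, crossDissipation P (σ i k) (σ j k) (u z.1) (v z.2)) * mixedDeriv i j Φ z := by
        simp only [Finset.sum_mul]
        exact integrable_finsetSum _ fun i _ => integrable_finsetSum _ fun j _ =>
          integrable_finsetSum _ fun k _ => hΓi i j k
      have e6 : -T3 - C * δ * I3 = ∫ z : Doubled d,
          ((∑ i, ∑ j, κ₁ i j (u z.1) * mixedDeriv i j Φ z) +
          (∑ i, ∑ j, κ₂ i j (v z.2) * mixedDeriv i j Φ z) -
          (∑ i, ∑ j, kruzhkovFlux (A i j) (u z.1) (v z.2) * mixedDeriv i j Φ z) -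
          C * δ * (∑ i, ∑ j, |mixedDeriv i j Φ z|)) := by
        have a1 := integral_add i1 i2
        have a2 := integral_sub (i1.add i2) hiG'
        have a3 := integral_sub ((i1.add i2).sub hiG') (hiM.const_mul (C * δ))
        simp only [Pi.add_apply, Pi.sub_apply] at a2 a3
        rw [a3, a2, a1, z1, z2, integral_const_mul]
        ring
      rw [e6]
      refine integral_mono (((i1.add i2).sub hiG').sub (hiM.const_mul _)) i3 fun z => ?_
      simp only [Finset.mul_sum, ← Finset.sum_add_distrib, ← Finset.sum_sub_distrib]
      refine Finset.sum_le_sum fun i _ => Finset.sum_le_sum fun j _ => ?_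
      have h1 := hκ i j (u z.1) (v z.2) (hu.bound _) (hv.bound _)
      have h2 := neg_abs_le (((∑ k, crossDissipation P (σ i k) (σ j k) (u z.1) (v z.2)) -
        (κ₁ i j (u z.1) + κ₂ i j (v z.2) - kruzhkovFlux (A i j) (u z.1) (v z.2))) *
          mixedDeriv i j Φ z)
      rw [abs_mul] at h2
      have h3 := mul_le_mul_of_nonneg_right h1 (abs_nonneg (mixedDeriv i j Φ z))
      linarith
    rw [← e4] at e5
    linarith
  set K := L * I1 + L * I2 + 2 * (C * I3)
  -- Only the error term involves `δ`; `T1`, `T2`, `T3` already contain the sharp Kružkov fluxes.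
  have ht : Tendsto (fun δ : ℝ => T1 + T2 + 2 * T3 + δ * K) (𝓝[>] 0) (𝓝 (T1 + T2 + 2 * T3)) := by
    have : Tendsto (fun δ : ℝ => T1 + T2 + 2 * T3 + δ * K) (𝓝 0) (𝓝 (T1 + T2 + 2 * T3 + 0 * K)) :=
      (continuous_const.add (continuous_id.mul continuous_const)).tendsto 0
    rw [zero_mul, add_zero] at this
    exact this.mono_left nhdsWithin_le_nhds
  exact ge_of_tendsto ht (eventually_mem_nhdsWithin.mono fun δ hδ => main δ hδ)

end

/-! ### Kato's inequality -/

section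
variable {d : ℕ}

/-- Translations act continuously on L¹, as an instance of the continuity of composition with
measure preserving maps. -/
lemma tendsto_lintegral_translate_sub {v : ℝ × Space d → ℝ} (hv : Integrable v) :
    Tendsto (fun z => ∫⁻ p, ‖v (p - z) - v p‖ₑ) (𝓝 0) (𝓝 0) := by
  have hm : MemLp v 1 volume := memLp_one_iff_integrable.2 hv
  let G : ℝ × Space d → C(ℝ × Space d, ℝ × Space d) := fun z => ⟨fun p => p - z, by fun_prop⟩
  have hG : Continuous G := ContinuousMap.continuous_of_continuous_uncurry _ (by
    change Continuous fun x : (ℝ × Space d) × (ℝ × Space d) => x.2 - x.1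
    fun_prop)
  have hmp : ∀ z, MeasurePreserving (G z) volume volume := fun z =>
    measurePreserving_sub_right volume z
  have h := (tendsto_const_nhds (x := hm.toLp v) (f := 𝓝 (0 : ℝ × Space d))).compMeasurePreservingLp
    (hG.tendsto 0) hmp (hmp 0) (by simp)
  rw [tendsto_iff_edist_tendsto_0] at h
  refine h.congr fun z => ?_
  rw [Lp.toLp_compMeasurePreserving, Lp.toLp_compMeasurePreserving, Lp.edist_toLp_toLp,
    eLpNorm_one_eq_lintegral_enorm]
  simp [G]

/-- As `v` is merely bounded, `m` has to supply the integrability: `(v(· - z) - v) m` is the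
translation difference of `v m` minus `v(· - z)` times that of `m`, and both `v m` and `m` are
integrable. -/
lemma tendsto_integral_translate_mul {v m : ℝ × Space d → ℝ} {B : ℝ} (hv : Measurable v)
    (hB : ∀ p, |v p| ≤ B) (hm : Integrable m) :
    Tendsto (fun z => ∫ p, |v (p - z) - v p| * |m p|) (𝓝 0) (𝓝 0) := by
  have hmv : Integrable fun p => v p * m p :=
    hm.bdd_mul hv.aestronglyMeasurable (Eventually.of_forall hB)
  have hr : ∀ {w : ℝ × Space d → ℝ}, Integrable w →
      Tendsto (fun z => ∫ p, |w (p - z) - w p|) (𝓝 0) (𝓝 0) := by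
    intro w hw
    have := (ENNReal.tendsto_toReal ENNReal.zero_ne_top).comp (tendsto_lintegral_translate_sub hw)
    refine this.congr fun z => ?_
    exact (integral_norm_eq_lintegral_enorm
      ((hw.comp_sub_right z).sub hw).aestronglyMeasurable).symm
  have h1 : Tendsto (fun z => (∫ p, |v (p - z) * m (p - z) - v p * m p|) +
      B * ∫ p, |m (p - z) - m p|) (𝓝 0) (𝓝 0) := by
    simpa using (hr hmv).add ((hr hm).const_mul B)
  refine squeeze_zero (fun z => integral_nonneg fun p => by positivity) (fun z => ?_) h1
  have i1 : Integrable fun p => |v (p - z) * m (p - z) - v p * m p| :=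
    ((hmv.comp_sub_right z).sub hmv).abs
  have i2 : Integrable fun p => |m (p - z) - m p| := ((hm.comp_sub_right z).sub hm).abs
  rw [← integral_const_mul, ← integral_add i1 (i2.const_mul B)]
  refine integral_mono_of_nonneg (Eventually.of_forall fun p => by positivity)
    (i1.add (i2.const_mul B)) (Eventually.of_forall fun p => ?_)
  simp only
  rw [← abs_mul, show (v (p - z) - v p) * m p = (v (p - z) * m (p - z) - v p * m p) -
    v (p - z) * (m (p - z) - m p) by ring]
  refine (abs_sub _ _).trans ?_
  rw [abs_mul (v (p - z))]
  gcongr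
  exact hB _

/-- `p - q` is constant along `(e, e)`, so the derivative falls on `φ` alone and the large
derivatives of the concentrating factor `θ` never appear. -/
lemma dirDeriv_diag {φ θ : ℝ × Space d → ℝ} (hφ : ContDiff ℝ ∞ φ) (hθ : ContDiff ℝ ∞ θ)
    (e : ℝ × Space d) (z : Doubled d) :
    dirDeriv (e, e) (fun z : Doubled d => φ z.1 * θ (z.1 - z.2)) z =
      dirDeriv e φ z.1 * θ (z.1 - z.2) := by
  have h1 : HasFDerivAt (fun z : Doubled d => φ z.1) _ z :=
    (hφ.differentiable (by simp) z.1).hasFDerivAt.comp z hasFDerivAt_fst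
  have h2 : HasFDerivAt (fun z : Doubled d => θ (z.1 - z.2)) _ z :=
    (hθ.differentiable (by simp) (z.1 - z.2)).hasFDerivAt.comp z
      ((hasFDerivAt_fst (𝕜 := ℝ) (p := z)).sub hasFDerivAt_snd)
  unfold dirDeriv
  rw [(h1.fun_mul h2).fderiv]
  simp [mul_comm]

lemma diffOpAlong_diag {φ θ : ℝ × Space d → ℝ} (hφ : ContDiff ℝ ∞ φ) (hθ : ContDiff ℝ ∞ θ)
    (ι : Idx d) (z : Doubled d) :
    diffOpAlong (fun e => (e, e)) ι (fun z : Doubled d => φ z.1 * θ (z.1 - z.2)) z =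
      diffOp ι φ z.1 * θ (z.1 - z.2) := by
  rcases ι with _ | i | ij
  · exact dirDeriv_diag hφ hθ _ z
  · exact dirDeriv_diag hφ hθ _ z
  · change dirDeriv _ (dirDeriv _ _) z = dirDeriv _ (dirDeriv _ _) _ * _
    rw [funext (dirDeriv_diag hφ hθ (0, Pi.single ij.2 1))]
    exact dirDeriv_diag (contDiff_dirDeriv _ hφ) hθ _ z

lemma isTestPair_doubled {φ θ : ℝ × Space d → ℝ} (hφ : IsTestFunction φ) (hθ : ContDiff ℝ ∞ θ)
    (hθc : HasCompactSupport θ) (hsep : ∀ p ∈ tsupport φ, ∀ z ∈ tsupport θ, p - z ∈ domain d) :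
    IsTestPair fun z : Doubled d => φ z.1 * θ (z.1 - z.2) where
  smooth := (hφ.smooth.comp contDiff_fst).mul (hθ.comp (contDiff_fst.sub contDiff_snd))
  hasCompactSupport := hasCompactSupport_doubled hφ.hasCompactSupport hθc
  tsupport_subset := by
    have hcl : IsClosed {z : Doubled d | z.1 ∈ tsupport φ ∧ z.1 - z.2 ∈ tsupport θ} :=
      ((isClosed_tsupport φ).preimage continuous_fst).inter
        ((isClosed_tsupport θ).preimage (continuous_fst.sub continuous_snd))
    refine (closure_minimal (fun z hz => ?_) hcl).trans fun z hz => ?_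
    · exact ⟨subset_tsupport _ (left_ne_zero_of_mul hz), subset_tsupport _ (right_ne_zero_of_mul hz)⟩
    · refine ⟨hφ.tsupport_subset hz.1, ?_⟩
      have := hsep _ hz.1 _ hz.2
      rwa [sub_sub_cancel] at this

lemma isOpen_domain : IsOpen (domain d) := isOpen_Ioi.prod isOpen_univ

variable {f : Fin d → ℝ → ℝ} {A σ : Fin d → Fin d → ℝ → ℝ} {B : ℝ}
  {u v : ℝ × Space d → ℝ} {g h : Fin d → ℝ × Space d → ℝ}

/-- The flux contains its second argument twice, once inside a maximum, which is 1-Lipschitz; hence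
the factor 2. It makes the doubled integral continuous in the shift `p - q`. -/
lemma abs_kruzhkovFlux_sub_le {H : ℝ → ℝ} (hH : ContDiff ℝ ∞ H) {L : ℝ}
    (hL : ∀ s, |s| ≤ B → |deriv H s| ≤ L) {a b c : ℝ} (ha : |a| ≤ B) (hb : |b| ≤ B)
    (hc : |c| ≤ B) : |kruzhkovFlux H a b - kruzhkovFlux H a c| ≤ 2 * L * |b - c| := by
  have hL0 : 0 ≤ L := (abs_nonneg _).trans (hL _ ha)
  have hd := hH.differentiable (by simp)
  have h1 := abs_sub_le_of_abs_deriv_le hd hL hb hc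
  have hm : ∀ {x}, |x| ≤ B → |max a x| ≤ B := fun {x} hx => by
    rcases max_choice a x with h | h <;> rw [h] <;> assumption
  have h2 := abs_sub_le_of_abs_deriv_le hd hL (hm hb) (hm hc)
  have h3 : |max a b - max a c| ≤ |b - c| := by
    simpa using abs_max_sub_max_le_max a b a c
  have h4 := mul_le_mul_of_nonneg_left h3 hL0
  unfold kruzhkovFlux
  calc |H (max a b) - H b - (H (max a c) - H c)| = |(H (max a b) - H (max a c)) - (H b - H c)| := by
        ring_nf
    _ ≤ |H (max a b) - H (max a c)| + |H b - H c| := abs_sub _ _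
    _ ≤ 2 * L * |b - c| := by linarith

/-- **Kato's inequality** for two entropy solutions. -/
theorem kato_inequality (hadm : IsAdmissible f A σ) (hu : IsEntropyPair f A σ B u g)
    (hv : IsEntropyPair f A σ B v h) {φ : ℝ × Space d → ℝ} (hφ : IsTestFunction φ)
    (h0 : ∀ p, 0 ≤ φ p) :
    0 ≤ ∫ p, ∑ ι, kruzhkovFlux (fluxFn f A ι) (u p) (v p) * diffOp ι φ p := by
  obtain ⟨L, hL0, hL⟩ := exists_uniform_bound_Icc (fun ι => continuous_deriv_fluxFn hadm ι) B
  have hTm : ∀ ι, Continuous fun x : ℝ × ℝ => kruzhkovFlux (fluxFn f A ι) x.1 x.2 := fun ι =>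
    continuous_kruzhkovFlux (contDiff_fluxFn hadm ι).continuous
  have hDi := fun ι => (hφ.diffOp ι).integrable
  -- `W z` is Kato's integral with `v` shifted by `z`. Substituting `q = p - z` turns the doubled
  -- inequality into `0 ≤ ∫ W θ`, so continuity of `W` at 0 decides the sign of `W 0`.
  set W : ℝ × Space d → ℝ := fun z =>
    ∫ p, ∑ ι, kruzhkovFlux (fluxFn f A ι) (u p) (v (p - z)) * diffOp ι φ p with hW
  have hWi : ∀ z ι, Integrable fun p =>
      kruzhkovFlux (fluxFn f A ι) (u p) (v (p - z)) * diffOp ι φ p := by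
    intro z ι
    obtain ⟨M, hM⟩ := exists_bound_square (hTm ι) B
    exact (hDi ι).bdd_mul (c := M) ((hTm ι).measurable.comp (hu.measurable.prodMk
      (hv.measurable.comp (measurable_id.sub_const z)))).aestronglyMeasurable
      (Eventually.of_forall fun p => hM _ _ (hu.bound _) (hv.bound _))
  have hWc : Tendsto W (𝓝 0) (𝓝 (W 0)) := by
    rw [tendsto_iff_dist_tendsto_zero]
    have h1 : Tendsto (fun z => 2 * L * ∑ ι, ∫ p, |v (p - z) - v p| * |diffOp ι φ p|) (𝓝 0)
        (𝓝 0) := by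
      have := (tendsto_finsetSum (Finset.univ : Finset (Idx d)) fun ι _ =>
        tendsto_integral_translate_mul hv.measurable hv.bound (hDi ι)).const_mul (2 * L)
      simpa using this
    refine squeeze_zero (fun _ => dist_nonneg) (fun z => ?_) h1
    have hi : ∀ ι, Integrable fun p => |v (p - z) - v p| * |diffOp ι φ p| := fun ι =>
      (hDi ι).abs.bdd_mul (c := 2 * B)
        ((hv.measurable.comp (measurable_id.sub_const z)).sub hv.measurable).abs.aestronglyMeasurable
        (Eventually.of_forall fun p => by
          rw [Real.norm_eq_abs, abs_abs]
          exact (abs_sub _ _).trans (by linarith [hv.bound (p - z), hv.bound p]))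
    rw [Real.dist_eq, hW]
    simp only [sub_zero]
    have hWi0 := hWi 0
    simp only [sub_zero] at hWi0
    rw [← integral_sub (integrable_finsetSum _ fun ι _ => hWi z ι)
      (integrable_finsetSum _ fun ι _ => hWi0 ι), ← integral_finsetSum _ fun ι _ => hi ι,
      ← integral_const_mul]
    refine (norm_integral_le_integral_norm _).trans (integral_mono_of_nonneg
      (Eventually.of_forall fun _ => norm_nonneg (_ : ℝ))
      ((integrable_finsetSum _ fun ι _ => hi ι).const_mul _) (Eventually.of_forall fun p => ?_))
    simp only
    rw [← Finset.sum_sub_distrib, Finset.mul_sum]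
    refine (norm_sum_le _ _).trans (Finset.sum_le_sum fun ι _ => ?_)
    rw [← sub_mul, norm_mul, Real.norm_eq_abs, Real.norm_eq_abs, ← mul_assoc]
    exact mul_le_mul_of_nonneg_right (abs_kruzhkovFlux_sub_le (contDiff_fluxFn hadm ι) (hL ι)
      (hu.bound _) (hv.bound _) (hv.bound _)) (abs_nonneg _)
  have hW0 : W 0 = ∫ p, ∑ ι, kruzhkovFlux (fluxFn f A ι) (u p) (v p) * diffOp ι φ p := by
    simp [hW]
  rw [← hW0]
  by_contra! hneg
  have hev : ∀ᶠ z in 𝓝 (0 : ℝ × Space d), W z < W 0 / 2 :=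
    hWc.eventually (gt_mem_nhds (by linarith))
  obtain ⟨r₁, hr₁, hball⟩ := Metric.eventually_nhds_iff_ball.1 hev
  obtain ⟨r₂, hr₂, hthick⟩ := hφ.hasCompactSupport.isCompact.exists_thickening_subset_open
    isOpen_domain hφ.tsupport_subset
  -- Below `r₁`, the value of `W` stays under `W 0 / 2` on the support of `θ`; below `r₂`, the
  -- second point `p - z` remains in the open domain.
  set r := min r₁ r₂ / 2 with hr
  have hmin : 0 < min r₁ r₂ := lt_min hr₁ hr₂
  have hr0 : 0 < r := by positivity
  have hrr₁ : r < r₁ := by have := min_le_left r₁ r₂; linarith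
  have hrr₂ : r < r₂ := by have := min_le_right r₁ r₂; linarith
  let b : ContDiffBump (0 : ℝ × Space d) := ⟨r / 2, r, by positivity, by linarith⟩
  set θ : ℝ × Space d → ℝ := b.normed volume with hθ
  have hθs : ContDiff ℝ ∞ θ := b.contDiff_normed
  have hθc : HasCompactSupport θ := b.hasCompactSupport_normed
  have hθ0 : ∀ z, 0 ≤ θ z := b.nonneg_normed
  have hθi : ∫ z, θ z = 1 := b.integral_normed
  have hθint : Integrable θ := b.integrable_normed
  have hpair : IsTestPair fun z : Doubled d => φ z.1 * θ (z.1 - z.2) := by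
    refine isTestPair_doubled hφ hθs hθc fun p hp z hz => hthick ?_
    rw [hθ, b.tsupport_normed_eq, mem_closedBall_zero_iff] at hz
    rw [Metric.mem_thickening_iff]
    refine ⟨p, hp, ?_⟩
    simpa [dist_eq_norm] using lt_of_le_of_lt hz hrr₂
  have key := doubled_kruzhkov hadm hu hv hpair fun z => mul_nonneg (h0 _) (hθ0 _)
  simp only [diffOpAlong_diag hφ.smooth hθs] at key
  have hF1 : Integrable fun z : Doubled d => ∑ ι, kruzhkovFlux (fluxFn f A ι) (u z.1) (v z.2) *
      (diffOp ι φ z.1 * θ (z.1 - z.2)) := by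
    have := integrable_finsetSum Finset.univ fun ι _ =>
      integrable_kruzhkovFlux hadm hu hv ι (hpair.diffOpAlong (fun e => (e, e)) ι).integrable
    simpa only [diffOpAlong_diag hφ.smooth hθs] using this
  have hF2 : Integrable fun z : Doubled d => ∑ ι, kruzhkovFlux (fluxFn f A ι) (u z.1)
      (v (z.1 - z.2)) * (diffOp ι φ z.1 * θ z.2) := by
    refine integrable_finsetSum _ fun ι _ => ?_
    obtain ⟨M, hM⟩ := exists_bound_square (hTm ι) B
    exact ((hDi ι).mul_prod hθint).bdd_mul (c := M) ((hTm ι).measurable.comp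
      ((hu.measurable.comp measurable_fst).prodMk
        (hv.measurable.comp (measurable_fst.sub measurable_snd)))).aestronglyMeasurable
      (Eventually.of_forall fun p => hM _ _ (hu.bound _) (hv.bound _))
  have e1 : ∫ z : Doubled d, ∑ ι, kruzhkovFlux (fluxFn f A ι) (u z.1) (v z.2) *
      (diffOp ι φ z.1 * θ (z.1 - z.2)) = ∫ p, ∫ z, ∑ ι, kruzhkovFlux (fluxFn f A ι) (u p)
        (v (p - z)) * (diffOp ι φ p * θ z) := by
    erw [integral_prod _ hF1]
    refine integral_congr_ae (Eventually.of_forall fun p => ?_)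
    have := integral_sub_left_eq_self (fun q => ∑ ι, kruzhkovFlux (fluxFn f A ι) (u p) (v q) *
      (diffOp ι φ p * θ (p - q))) volume p
    simp only [sub_sub_cancel] at this
    exact this.symm
  rw [e1, integral_integral_swap hF2] at key
  have e2 : ∀ z, ∫ p, ∑ ι, kruzhkovFlux (fluxFn f A ι) (u p) (v (p - z)) *
      (diffOp ι φ p * θ z) = W z * θ z := by
    intro z
    rw [hW, ← integral_mul_const]
    simp only [Finset.sum_mul, mul_assoc]
  simp only [e2] at key
  have hF3 : Integrable fun z => W z * θ z := by
    have := hF2.integral_prod_right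
    simpa only [e2] using this
  have h5 : ∫ z, W z * θ z ≤ ∫ z, W 0 / 2 * θ z := by
    refine integral_mono hF3 (hθint.const_mul _) fun z => ?_
    by_cases hz : z ∈ Metric.ball (0 : ℝ × Space d) r₁
    · exact mul_le_mul_of_nonneg_right (hball z hz).le (hθ0 z)
    · have : θ z = 0 := by
        have : z ∉ Function.support θ := by
          rw [hθ, b.support_normed_eq]
          exact fun h' => hz (Metric.ball_subset_ball hrr₁.le h')
        simpa using this
      simp [this]
  rw [integral_const_mul, hθi] at h5
  linarith

end

/-! ### Weights -/

section calculus
variable {V : Type*} [NormedAddCommGroup V] [NormedSpace ℝ V]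

lemma dirDeriv_mul {a b : V → ℝ} (ha : ContDiff ℝ ∞ a) (hb : ContDiff ℝ ∞ b) (e x : V) :
    dirDeriv e (fun x => a x * b x) x = dirDeriv e a x * b x + a x * dirDeriv e b x := by
  unfold dirDeriv
  rw [fderiv_fun_mul (ha.differentiable (by simp) x) (hb.differentiable (by simp) x)]
  simp only [_root_.add_apply, _root_.smul_apply, smul_eq_mul]
  ring

lemma dirDeriv_inv {a : V → ℝ} (ha : ContDiff ℝ ∞ a) (h0 : ∀ x, a x ≠ 0) (e x : V) :
    dirDeriv e (fun x => (a x)⁻¹) x = -dirDeriv e a x * ((a x)⁻¹ * (a x)⁻¹) := by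
  unfold dirDeriv
  have h := (hasDerivAt_inv (h0 x)).comp_hasFDerivAt x (ha.differentiable (by simp) x).hasFDerivAt
  have h' : fderiv ℝ (fun x => (a x)⁻¹) x = _ := h.fderiv
  rw [h']
  simp only [_root_.smul_apply, smul_eq_mul]
  field_simp

lemma dirDeriv_comp_smul_sub {a : V → ℝ} (ha : ContDiff ℝ ∞ a) (r : ℝ) (z e x : V) :
    dirDeriv e (fun x => a (r • (x - z))) x = r * dirDeriv e a (r • (x - z)) := by
  unfold dirDeriv
  have h := (ha.differentiable (by simp) (r • (x - z))).hasFDerivAt.comp x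
    (((hasFDerivAt_id x).sub_const z).const_smul r)
  have h' : fderiv ℝ (fun x => a (r • (x - z))) x = _ := h.fderiv
  rw [h']
  simp

lemma dirDeriv_const_mul {a : V → ℝ} (ha : ContDiff ℝ ∞ a) (r : ℝ) (e x : V) :
    dirDeriv e (fun x => r * a x) x = r * dirDeriv e a x := by
  unfold dirDeriv
  rw [fderiv_const_mul (ha.differentiable (by simp) x)]
  rfl

end calculus

section
variable {d : ℕ}

/-- The function `a` and its derivatives up to order two are bounded by `c w`. -/
structure HasDerivBounds (c : ℝ) (w a : Space d → ℝ) : Prop where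
  smooth : ContDiff ℝ ∞ a
  bound : ∀ x, |a x| ≤ c * w x
  bound_one : ∀ i x, |dirDeriv (Pi.single i 1) a x| ≤ c * w x
  bound_two : ∀ i j x, |dirDeriv (Pi.single i 1) (dirDeriv (Pi.single j 1) a) x| ≤ c * w x

namespace HasDerivBounds
variable {c c' : ℝ} {w w' a b : Space d → ℝ}

/-- The second derivative of a product has four Leibniz terms, each bounded by the product of the
bounds; hence the 4. -/
lemma mul (ha : HasDerivBounds c w a) (hb : HasDerivBounds c' w' b) :
    HasDerivBounds (4 * (c * c')) (fun x => w x * w' x) (fun x => a x * b x) := by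
  have key : ∀ {p q r s : ℝ}, |p| ≤ r → |q| ≤ s → |p * q| ≤ r * s := fun {p q r s} h1 h2 => by
    rw [abs_mul]; exact mul_le_mul h1 h2 (abs_nonneg _) ((abs_nonneg _).trans h1)
  have hpos : ∀ x, 0 ≤ (c * w x) * (c' * w' x) := fun x =>
    (abs_nonneg _).trans (key (ha.bound x) (hb.bound x))
  refine ⟨ha.smooth.mul hb.smooth, fun x => ?_, fun i x => ?_, fun i j x => ?_⟩
  · have := key (ha.bound x) (hb.bound x)
    linarith [hpos x]
  · rw [dirDeriv_mul ha.smooth hb.smooth]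
    refine (abs_add_le _ _).trans ?_
    linarith [hpos x, key (ha.bound_one i x) (hb.bound x), key (ha.bound x) (hb.bound_one i x)]
  · rw [funext (dirDeriv_mul ha.smooth hb.smooth (Pi.single j 1)),
      dirDeriv_add_right ((contDiff_dirDeriv _ ha.smooth).mul hb.smooth)
        (ha.smooth.mul (contDiff_dirDeriv _ hb.smooth)),
      dirDeriv_mul (contDiff_dirDeriv _ ha.smooth) hb.smooth,
      dirDeriv_mul ha.smooth (contDiff_dirDeriv _ hb.smooth)]
    refine (abs_add_le _ _).trans ((add_le_add (abs_add_le _ _) (abs_add_le _ _)).trans ?_)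
    linarith [key (ha.bound_two i j x) (hb.bound x), key (ha.bound_one j x) (hb.bound_one i x),
      key (ha.bound_one i x) (hb.bound_one j x), key (ha.bound x) (hb.bound_two i j x)]

/-- Each derivative produces a factor `r ≤ 1`, so the constant does not grow. This is the source of
the uniformity in the scale `L ≥ 1` and in the center. -/
lemma comp_smul_sub (ha : HasDerivBounds c w a) {r : ℝ} (hr : 0 ≤ r) (hr1 : r ≤ 1) (z : Space d) :
    HasDerivBounds c (fun x => w (r • (x - z))) (fun x => a (r • (x - z))) := by
  have h1 : ∀ {y k : ℝ}, |y| ≤ k → |r * y| ≤ k := fun {y k} h => by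
    rw [abs_mul, abs_of_nonneg hr]
    exact (mul_le_of_le_one_left (abs_nonneg _) hr1).trans h
  refine ⟨ha.smooth.comp (f := fun x => r • (x - z)) (by fun_prop),
    fun x => ha.bound _, fun i x => ?_, fun i j x => ?_⟩
  · rw [dirDeriv_comp_smul_sub ha.smooth]
    exact h1 (ha.bound_one i _)
  · have hs := contDiff_dirDeriv (Pi.single j 1) ha.smooth
    rw [funext (dirDeriv_comp_smul_sub ha.smooth r z (Pi.single j 1)),
      dirDeriv_const_mul (a := fun x => dirDeriv (Pi.single j 1) a (r • (x - z)))
        (hs.comp (f := fun x => r • (x - z)) (by fun_prop)),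
      dirDeriv_comp_smul_sub hs]
    exact h1 (h1 (ha.bound_two i j _))

lemma pow (ha : HasDerivBounds c w a) (n : ℕ) :
    ∃ c', HasDerivBounds c' (fun x => w x ^ (n + 1)) (fun x => a x ^ (n + 1)) := by
  induction n with
  | zero => exact ⟨c, by simpa using ha⟩
  | succ n ih =>
    obtain ⟨c', h⟩ := ih
    exact ⟨_, by simpa only [pow_succ _ (n + 1)] using h.mul ha⟩

lemma mono (ha : HasDerivBounds c w a) (h : ∀ x, c * w x ≤ c' * w' x) : HasDerivBounds c' w' a :=
  ⟨ha.smooth, fun x => (ha.bound x).trans (h x), fun i x => (ha.bound_one i x).trans (h x),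
    fun i j x => (ha.bound_two i j x).trans (h x)⟩

lemma exists_of_hasCompactSupport (ha : ContDiff ℝ ∞ a) (hs : HasCompactSupport a) :
    ∃ c, HasDerivBounds c (fun _ => 1) a := by
  have h1 := fun i : Fin d => contDiff_dirDeriv (Pi.single i 1) ha
  have h2 := fun i j : Fin d => contDiff_dirDeriv (Pi.single i 1) (h1 j)
  have s1 := fun i : Fin d => hs.fderiv_apply ℝ (Pi.single i 1 : Space d)
  have s2 := fun i j : Fin d => (s1 j).fderiv_apply ℝ (Pi.single i 1 : Space d)
  obtain ⟨C0, hC0⟩ := hs.exists_bound_of_continuous ha.continuous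
  choose C1 hC1 using fun i => (s1 i).exists_bound_of_continuous (h1 i).continuous
  choose C2 hC2 using fun i j => (s2 i j).exists_bound_of_continuous (h2 i j).continuous
  have p1 := fun i => (norm_nonneg _).trans (hC1 i 0)
  have p2 := fun i j => (norm_nonneg _).trans (hC2 i j 0)
  have p0 := (norm_nonneg _).trans (hC0 0)
  have q1 : 0 ≤ ∑ i, C1 i := Finset.sum_nonneg fun i _ => p1 i
  have q2 : 0 ≤ ∑ i, ∑ j, C2 i j := Finset.sum_nonneg fun i _ => Finset.sum_nonneg fun j _ => p2 i j
  refine ⟨C0 + ∑ i, C1 i + ∑ i, ∑ j, C2 i j, ha, fun x => ?_, fun i x => ?_, fun i j x => ?_⟩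
  · have := hC0 x
    rw [Real.norm_eq_abs] at this
    linarith
  · have e1 : |dirDeriv (Pi.single i 1) a x| ≤ C1 i := hC1 i x
    have e2 := Finset.single_le_sum (fun i _ => p1 i) (Finset.mem_univ i)
    linarith
  · have e1 : |dirDeriv (Pi.single i 1) (dirDeriv (Pi.single j 1) a) x| ≤ C2 i j := hC2 i j x
    have e2 := Finset.single_le_sum (fun j _ => p2 i j) (Finset.mem_univ j)
    have e3 := Finset.single_le_sum (f := fun i => ∑ j, C2 i j)
      (fun i _ => Finset.sum_nonneg fun j _ => p2 i j) (Finset.mem_univ i)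
    linarith

end HasDerivBounds

/-- The polynomial `1 + |x|²`. -/
def oneAddSq (x : Space d) : ℝ := 1 + ∑ i, x i * x i

lemma one_le_oneAddSq (x : Space d) : 1 ≤ oneAddSq x := by
  unfold oneAddSq
  have : 0 ≤ ∑ i, x i * x i := Finset.sum_nonneg fun i _ => mul_self_nonneg _
  linarith

lemma contDiff_oneAddSq : ContDiff ℝ ∞ (oneAddSq (d := d)) := by
  unfold oneAddSq
  fun_prop

lemma dirDeriv_coord (i j : Fin d) (x : Space d) :
    dirDeriv (Pi.single i 1) (fun x : Space d => x j) x = if i = j then 1 else 0 := by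
  unfold dirDeriv
  have h := (hasFDerivAt_apply (𝕜 := ℝ) j x)
  rw [h.fderiv]
  simp [Pi.single_apply, eq_comm]

lemma dirDeriv_oneAddSq (i : Fin d) (x : Space d) :
    dirDeriv (Pi.single i 1) oneAddSq x = 2 * x i := by
  have h : HasFDerivAt (oneAddSq (d := d)) (∑ j, (x j • ContinuousLinearMap.proj (R := ℝ) (φ := fun _ : Fin d => ℝ) j +
      x j • ContinuousLinearMap.proj (R := ℝ) (φ := fun _ : Fin d => ℝ) j)) x :=
    (HasFDerivAt.fun_sum fun j _ => (hasFDerivAt_apply j x).fun_mul (hasFDerivAt_apply j x)).const_add 1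
  unfold dirDeriv
  rw [h.fderiv, _root_.sum_apply]
  simp [Pi.single_apply, two_mul, Finset.sum_add_distrib]

lemma two_mul_abs_le_oneAddSq (i : Fin d) (x : Space d) : 2 * |x i| ≤ oneAddSq x := by
  have h1 : x i * x i ≤ ∑ j, x j * x j :=
    Finset.single_le_sum (f := fun j => x j * x j) (fun j _ => mul_self_nonneg _) (Finset.mem_univ i)
  unfold oneAddSq
  nlinarith [sq_nonneg (|x i| - 1), abs_mul_abs_self (x i)]

/-- With `y = (1 + |x|²)⁻¹` the first derivatives are `-2 x_i y²` and the second ones `y (-2 δ_ij y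
+ 2 (2 x_i y)(2 x_j y))`. As `|2 x_i y| ≤ 1` and `y ≤ 1`, the bracket is at most 2 + 2. -/
lemma hasDerivBounds_inv : HasDerivBounds 4 (fun x : Space d => (oneAddSq x)⁻¹)
    (fun x => (oneAddSq x)⁻¹) := by
  have hq := fun x : Space d => one_le_oneAddSq x
  have hq0 : ∀ x : Space d, oneAddSq x ≠ 0 := fun x => by linarith [hq x]
  have hi0 : ∀ x : Space d, 0 < (oneAddSq x)⁻¹ := fun x => inv_pos.2 (by linarith [hq x])
  have hs : ContDiff ℝ ∞ (fun x : Space d => (oneAddSq x)⁻¹) := contDiff_oneAddSq.inv hq0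
  have hd : ∀ (i : Fin d) x, dirDeriv (Pi.single i 1) (fun x => (oneAddSq x)⁻¹) x =
      (-2 * x i) * ((oneAddSq x)⁻¹ * (oneAddSq x)⁻¹) := fun i x => by
    rw [dirDeriv_inv contDiff_oneAddSq hq0, dirDeriv_oneAddSq]; ring
  have hb : ∀ (i : Fin d) x, |2 * x i * (oneAddSq x)⁻¹| ≤ 1 := fun i x => by
    rw [abs_mul, abs_mul, abs_of_pos (hi0 x), abs_two, ← div_eq_mul_inv,
      div_le_one (by linarith [hq x])]
    exact two_mul_abs_le_oneAddSq i x
  refine ⟨hs, fun x => ?_, fun i x => ?_, fun i j x => ?_⟩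
  · rw [abs_of_pos (hi0 x)]; linarith [hi0 x]
  · rw [hd, show (-2 * x i) * ((oneAddSq x)⁻¹ * (oneAddSq x)⁻¹) =
      -(2 * x i * (oneAddSq x)⁻¹) * (oneAddSq x)⁻¹ by ring, abs_mul, abs_neg, abs_of_pos (hi0 x)]
    have := mul_le_mul_of_nonneg_right (hb i x) (hi0 x).le
    linarith [hi0 x]
  · have hcd : ContDiff ℝ ∞ (fun x : Space d => -2 * x j) := by fun_prop
    rw [funext (hd j), dirDeriv_mul hcd (hs.mul hs), dirDeriv_mul hs hs, hd,
      dirDeriv_const_mul (a := fun x : Space d => x j) (by fun_prop), dirDeriv_coord]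
    set y := (oneAddSq x)⁻¹ with hy
    have hy0 := hi0 x
    have hy1 : y ≤ 1 := inv_le_one_of_one_le₀ (hq x)
    have e : (-2 * if i = j then (1:ℝ) else 0) * (y * y) + -2 * x j *
        ((-2 * x i) * (y * y) * y + y * ((-2 * x i) * (y * y))) =
        ((-2 * if i = j then (1:ℝ) else 0) * y + 2 * ((2 * x i * y) * (2 * x j * y))) * y := by ring
    rw [e, abs_mul, abs_of_pos hy0]
    refine mul_le_mul_of_nonneg_right ((abs_add_le _ _).trans ?_) hy0.le
    have h1 : |(-2 * if i = j then (1:ℝ) else 0) * y| ≤ 2 := by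
      split_ifs
      · rw [abs_mul, abs_of_pos hy0]; norm_num; linarith
      · simp
    have h2 : |2 * ((2 * x i * y) * (2 * x j * y))| ≤ 2 := by
      rw [abs_mul, abs_mul, abs_two]
      have := mul_le_mul (hb i x) (hb j x) (abs_nonneg _) zero_le_one
      linarith
    linarith

/-- The weight `(1 + |(x - z) / L|²)^{-(d + 1)}`. -/
def weight (L : ℝ) (z x : Space d) : ℝ := (oneAddSq (L⁻¹ • (x - z)))⁻¹ ^ (d + 1)

lemma weight_pos (L : ℝ) (z x : Space d) : 0 < weight L z x :=
  pow_pos (inv_pos.2 (by linarith [one_le_oneAddSq (L⁻¹ • (x - z))])) _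

lemma weight_le_one (L : ℝ) (z x : Space d) : weight L z x ≤ 1 :=
  pow_le_one₀ (inv_nonneg.2 (by linarith [one_le_oneAddSq (L⁻¹ • (x - z))]))
    (inv_le_one_of_one_le₀ (one_le_oneAddSq _))

lemma contDiff_weight (L : ℝ) (z : Space d) : ContDiff ℝ ∞ (weight L z) := by
  unfold weight
  refine ContDiff.pow (ContDiff.inv (contDiff_oneAddSq.comp (f := fun x => L⁻¹ • (x - z))
    (by fun_prop)) fun x => ?_) _
  rw [Function.comp_apply]
  linarith [one_le_oneAddSq (L⁻¹ • (x - z))]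

/-- The weights are limits of compactly supported functions with uniform derivative bounds. -/
lemma exists_cutoff_weight (d : ℕ) : ∃ c : ℝ, 0 ≤ c ∧ ∀ (L : ℝ), 1 ≤ L → ∀ z : Space d,
    ∃ ψ : ℕ → Space d → ℝ, ∀ n, HasDerivBounds c (weight L z) (ψ n) ∧ HasCompactSupport (ψ n) ∧
      (∀ x, 0 ≤ ψ n x ∧ ψ n x ≤ weight L z x) ∧ ∀ x, ‖x‖ ≤ n → ψ n x = weight L z x := by
  obtain ⟨c, hc⟩ := (hasDerivBounds_inv (d := d)).pow d
  let b : ContDiffBump (0 : Space d) := ⟨1, 2, one_pos, one_lt_two⟩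
  obtain ⟨c', hc'⟩ := HasDerivBounds.exists_of_hasCompactSupport (a := b) b.contDiff b.hasCompactSupport
  refine ⟨|4 * (c * c')|, abs_nonneg _, fun L hL z => ?_⟩
  have hw : HasDerivBounds c (weight L z) (weight L z) :=
    hc.comp_smul_sub (inv_nonneg.2 (by linarith)) (inv_le_one_of_one_le₀ hL) z
  -- The bump is dilated until it equals 1 on the ball of radius `n + 1`; the dilation factor is at
  -- most 1, so the derivative bounds are uniform in `n`. The shift by 0 only matches the form of
  -- `comp_smul_sub`.
  refine ⟨fun n x => weight L z x * b (((n : ℝ) + 1)⁻¹ • (x - 0)), fun n => ⟨?_, ?_, ?_, ?_⟩⟩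
  · refine (hw.mul (hc'.comp_smul_sub (r := ((n : ℝ) + 1)⁻¹) (by positivity)
      (inv_le_one_of_one_le₀ (by simp)) 0)).mono fun x => ?_
    rw [mul_one]
    exact mul_le_mul_of_nonneg_right (le_abs_self _) (weight_pos L z x).le
  · refine HasCompactSupport.mul_left ?_
    exact b.hasCompactSupport.comp_homeomorph
      ((Homeomorph.subRight 0).trans (Homeomorph.smulOfNeZero ((n : ℝ) + 1)⁻¹ (by positivity)))
  · intro x
    exact ⟨mul_nonneg (weight_pos L z x).le b.nonneg,
      mul_le_of_le_one_right (weight_pos L z x).le b.le_one⟩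
  · intro x hx
    have : b (((n : ℝ) + 1)⁻¹ • (x - 0)) = 1 := by
      refine b.one_of_mem_closedBall ?_
      rw [sub_zero, mem_closedBall_zero_iff, norm_smul, norm_inv, Real.norm_of_nonneg (by positivity),
        inv_mul_le_iff₀ (by positivity)]
      change ‖x‖ ≤ (n + 1) * 1
      linarith
    simp only [this, mul_one]

lemma one_add_norm_sq_le_oneAddSq (x : Space d) : 1 + ‖x‖ ^ 2 ≤ oneAddSq x := by
  have h0 : 0 ≤ ∑ j, x j * x j := Finset.sum_nonneg fun j _ => mul_self_nonneg _
  have : ‖x‖ ≤ √(∑ j, x j * x j) := by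
    refine (pi_norm_le_iff_of_nonneg (Real.sqrt_nonneg _)).2 fun i => ?_
    refine Real.le_sqrt_of_sq_le ?_
    rw [Real.norm_eq_abs, sq_abs, sq]
    exact Finset.single_le_sum (f := fun j => x j * x j) (fun j _ => mul_self_nonneg _)
      (Finset.mem_univ i)
  have h2 := Real.sq_sqrt h0
  have h3 := pow_le_pow_left₀ (norm_nonneg x) this 2
  unfold oneAddSq
  linarith

lemma oneAddSq_le (x : Space d) : oneAddSq x ≤ 1 + d * ‖x‖ ^ 2 := by
  unfold oneAddSq
  have : ∑ i, x i * x i ≤ ∑ _i : Fin d, ‖x‖ ^ 2 := Finset.sum_le_sum fun i _ => by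
    have := norm_le_pi_norm x i
    rw [← sq, ← sq_abs, ← Real.norm_eq_abs]
    gcongr
  simp only [Finset.sum_const, Finset.card_univ, Fintype.card_fin, nsmul_eq_mul] at this
  linarith

/-- A lower bound of the weight on balls. -/
lemma le_weight {L : ℝ} (z x : Space d) {r : ℝ} (h : ‖L⁻¹ • (x - z)‖ ≤ r) :
    (1 + d * r ^ 2)⁻¹ ^ (d + 1) ≤ weight L z x := by
  unfold weight
  have h1 := oneAddSq_le (L⁻¹ • (x - z))
  have h2 := one_le_oneAddSq (L⁻¹ • (x - z))
  have h3 : (d : ℝ) * ‖L⁻¹ • (x - z)‖ ^ 2 ≤ d * r ^ 2 := by gcongr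
  have : (1 + d * r ^ 2)⁻¹ ≤ (oneAddSq (L⁻¹ • (x - z)))⁻¹ := inv_anti₀ (by linarith) (by linarith)
  gcongr

/-- Any weight is controlled by the standard one, also after a translation. -/
lemma exists_weight_le {L : ℝ} (hL : L ≠ 0) (z : Space d) :
    ∃ C, 0 < C ∧ ∀ x, weight L z x ≤ C * weight 1 0 x := by
  refine ⟨(1 + d * (2 * L ^ 2 + 2 * ‖z‖ ^ 2)) ^ (d + 1), by positivity, fun x => ?_⟩
  unfold weight
  rw [← mul_pow]
  have h1 := one_le_oneAddSq (L⁻¹ • (x - z))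
  have h1' := one_le_oneAddSq ((1 : ℝ)⁻¹ • (x - 0))
  refine pow_le_pow_left₀ (inv_nonneg.2 (by linarith)) ?_ _
  rw [← div_eq_mul_inv, inv_eq_one_div, div_le_div_iff₀ (by linarith) (by linarith), one_mul,
    inv_one, one_smul, sub_zero]
  have h2 := oneAddSq_le x
  have h3 := one_add_norm_sq_le_oneAddSq (L⁻¹ • (x - z))
  set y := L⁻¹ • (x - z) with hy
  have hx : x = L • y + z := by rw [hy, smul_inv_smul₀ hL, sub_add_cancel]
  have h4 : ‖x‖ ≤ |L| * ‖y‖ + ‖z‖ := by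
    rw [hx]
    exact (norm_add_le _ _).trans (by rw [norm_smul, Real.norm_eq_abs])
  have h5 : ‖x‖ ^ 2 ≤ 2 * L ^ 2 * ‖y‖ ^ 2 + 2 * ‖z‖ ^ 2 := by
    have := pow_le_pow_left₀ (norm_nonneg x) h4 2
    nlinarith [sq_nonneg (|L| * ‖y‖ - ‖z‖), sq_abs L]
  have h6 : 2 * L ^ 2 * ‖y‖ ^ 2 + 2 * ‖z‖ ^ 2 ≤ (2 * L ^ 2 + 2 * ‖z‖ ^ 2) * (1 + ‖y‖ ^ 2) := by
    nlinarith [sq_nonneg L, sq_nonneg ‖y‖, sq_nonneg ‖z‖, mul_nonneg (sq_nonneg ‖z‖) (sq_nonneg ‖y‖)]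
  have hd0 : (0 : ℝ) ≤ d := Nat.cast_nonneg d
  have hk : 0 ≤ 2 * L ^ 2 + 2 * ‖z‖ ^ 2 := by positivity
  calc oneAddSq x ≤ 1 + d * ‖x‖ ^ 2 := h2
    _ ≤ 1 + d * ((2 * L ^ 2 + 2 * ‖z‖ ^ 2) * (1 + ‖y‖ ^ 2)) := by gcongr; exact h5.trans h6
    _ ≤ (1 + d * (2 * L ^ 2 + 2 * ‖z‖ ^ 2)) * (1 + ‖y‖ ^ 2) := by nlinarith [sq_nonneg ‖y‖]
    _ ≤ (1 + d * (2 * L ^ 2 + 2 * ‖z‖ ^ 2)) * oneAddSq y := by gcongr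

lemma weight_sub (L : ℝ) (z τ x : Space d) : weight L z (x - τ) = weight L (z + τ) x := by
  unfold weight
  rw [sub_sub, add_comm τ z]

lemma measurableSet_cube (R : ℝ) (x : Space d) : MeasurableSet (cube R x) :=
  Metric.isClosed_closedBall.measurableSet

lemma volume_cube {R : ℝ} (hR : 0 ≤ R) (x : Space d) : volume (cube R x) = ENNReal.ofReal (R ^ d) := by
  rw [cube, Real.volume_pi_closedBall _ (by positivity), mul_div_cancel₀ _ two_ne_zero]
  simp

/-- The constant in the comparison of weighted integrals and averages over large cubes. -/
def weightConst (d : ℕ) : ℝ := 4 ^ (d + 1) * 2 ^ d * 2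

lemma weightConst_pos (d : ℕ) : 0 < weightConst d := by unfold weightConst; positivity

/-- Take the least `k`: minimality gives `2^(k-1) < ρ`. A point thus lies in a dyadic cube whose
size is comparable with its distance from the center, and the weight there is small accordingly. -/
lemma exists_dyadic (ρ : ℝ) : ∃ k : ℕ, ρ ≤ 2 ^ k ∧ (4 : ℝ) ^ k ≤ 4 * (1 + ρ ^ 2) := by
  have hex : ∃ k : ℕ, ρ ≤ 2 ^ k := by
    obtain ⟨k, hk⟩ := pow_unbounded_of_one_lt ρ one_lt_two
    exact ⟨k, hk.le⟩
  classical
  refine ⟨Nat.find hex, Nat.find_spec hex, ?_⟩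
  rcases h : Nat.find hex with _ | k
  · have := sq_nonneg ρ
    norm_num; linarith
  · have h1 := Nat.find_min hex (m := k) (by omega)
    push Not at h1
    have h2 : ((2 : ℝ) ^ k) ^ 2 ≤ ρ ^ 2 := by gcongr
    rw [← pow_mul, mul_comm k 2, pow_mul] at h2
    norm_num at h2
    rw [pow_succ]
    linarith

/-- Weighted integrals are controlled by the averages over large cubes. -/
lemma lintegral_weight_mul_le {L : ℝ} (hL : 0 < L) (z : Space d) {g : Space d → ℝ≥0∞}
    (hg : AEMeasurable g) {S : ℝ≥0∞}
    (hS : ∀ R, 2 * L ≤ R → ∫⁻ x in cube R z, g x ≤ S * ENNReal.ofReal (R ^ d)) :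
    ∫⁻ x, ENNReal.ofReal (weight L z x) * g x ≤ ENNReal.ofReal (weightConst d * L ^ d) * S := by
  -- `a k` bounds the weight on the k-th dyadic shell. Against the cube volume, of order `2^(kd)`,
  -- the exponent `d + 1` leaves at most `2^(-k)`; the geometric sum 2 is the last factor of
  -- `weightConst`.
  set a : ℕ → ℝ := fun k => (4 / 4 ^ k) ^ (d + 1) with ha
  have hpt : ∀ x, ENNReal.ofReal (weight L z x) * g x ≤
      ∑' k, ENNReal.ofReal (a k) * (cube (2 ^ k * (2 * L)) z).indicator g x := by
    intro x
    obtain ⟨k, hk1, hk2⟩ := exists_dyadic ‖L⁻¹ • (x - z)‖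
    refine le_trans ?_ (ENNReal.le_tsum k)
    have hx : x ∈ cube (2 ^ k * (2 * L)) z := by
      rw [cube, Metric.mem_closedBall, dist_eq_norm]
      rw [norm_smul, norm_inv, Real.norm_of_nonneg hL.le, inv_mul_le_iff₀ hL] at hk1
      linarith
    rw [indicator_of_mem hx]
    refine mul_le_mul_left (ENNReal.ofReal_le_ofReal ?_) _
    unfold weight
    have h3 := one_add_norm_sq_le_oneAddSq (L⁻¹ • (x - z))
    have h4 := one_le_oneAddSq (L⁻¹ • (x - z))
    refine pow_le_pow_left₀ (inv_nonneg.2 (by linarith)) ?_ _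
    rw [inv_eq_one_div, div_le_div_iff₀ (by linarith) (by positivity)]
    linarith
  have hterm : ∀ k : ℕ, ENNReal.ofReal (a k) * ∫⁻ x in cube (2 ^ k * (2 * L)) z, g x ≤
      ENNReal.ofReal (4 ^ (d + 1) * 2 ^ d * L ^ d * (1 / 2) ^ k) * S := by
    intro k
    have h2k : (1 : ℝ) ≤ 2 ^ k := one_le_pow₀ one_le_two
    refine (mul_le_mul_right (hS _ (by nlinarith)) _).trans ?_
    rw [mul_comm S, ← mul_assoc, ← ENNReal.ofReal_mul (by positivity)]
    refine mul_le_mul_left (ENNReal.ofReal_le_ofReal ?_) _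
    have e : a k * (2 ^ k * (2 * L)) ^ d =
        4 ^ (d + 1) * 2 ^ d * L ^ d * ((2 ^ k / 4 ^ k) ^ d * (1 / 4 ^ k)) := by
      rw [ha]
      simp only [div_pow, mul_pow, pow_succ]
      field_simp
    rw [e]
    have h24 : (2 : ℝ) ^ k / 4 ^ k = (1 / 2) ^ k := by rw [← div_pow]; norm_num
    have h14 : (1 : ℝ) / 4 ^ k ≤ (1 / 2) ^ k := by
      rw [← one_div_pow]; gcongr; norm_num
    rw [h24]
    have h5 : ((1 / 2 : ℝ) ^ k) ^ d ≤ 1 := pow_le_one₀ (by positivity) (pow_le_one₀ (by norm_num) (by norm_num))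
    gcongr
    calc ((1 / 2 : ℝ) ^ k) ^ d * (1 / 4 ^ k) ≤ 1 * (1 / 2) ^ k := by gcongr
      _ = (1 / 2) ^ k := one_mul _
  calc ∫⁻ x, ENNReal.ofReal (weight L z x) * g x
      ≤ ∫⁻ x, ∑' k, ENNReal.ofReal (a k) * (cube (2 ^ k * (2 * L)) z).indicator g x :=
        lintegral_mono hpt
    _ = ∑' k, ENNReal.ofReal (a k) * ∫⁻ x in cube (2 ^ k * (2 * L)) z, g x := by
        rw [lintegral_tsum fun k => (hg.indicator (measurableSet_cube _ _)).const_mul _]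
        refine tsum_congr fun k => ?_
        rw [lintegral_const_mul' _ _ ENNReal.ofReal_ne_top, lintegral_indicator (measurableSet_cube _ _)]
    _ ≤ ∑' k : ℕ, ENNReal.ofReal (4 ^ (d + 1) * 2 ^ d * L ^ d * (1 / 2) ^ k) * S :=
        ENNReal.tsum_le_tsum hterm
    _ = ENNReal.ofReal (weightConst d * L ^ d) * S := by
        rw [ENNReal.tsum_mul_right, ← ENNReal.ofReal_tsum_of_nonneg (fun k => by positivity)
          (summable_geometric_two.mul_left _), tsum_mul_left, tsum_geometric_two]
        congr 2
        unfold weightConst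
        ring

lemma integrable_weight {L : ℝ} (hL : 0 < L) (z : Space d) : Integrable (weight L z) := by
  refine ⟨(contDiff_weight L z).continuous.aestronglyMeasurable, ?_⟩
  have h := lintegral_weight_mul_le hL z (g := fun _ => 1) aemeasurable_const (S := 1)
    fun R hR => by
      rw [setLIntegral_const, volume_cube (by linarith)]
  have h2 : ∀ x, ‖weight L z x‖ₑ = ENNReal.ofReal (weight L z x) := fun x =>
    Real.enorm_of_nonneg (weight_pos L z x).le
  rw [hasFiniteIntegral_iff_enorm]
  simp only [mul_one] at h
  simp only [h2]
  exact h.trans_lt ENNReal.ofReal_lt_top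

end

/-! ### Weighted contraction -/

section
variable {d : ℕ}

lemma dirDeriv_prod_time {χ : ℝ → ℝ} {ψ : Space d → ℝ} (hχ : ContDiff ℝ ∞ χ)
    (hψ : ContDiff ℝ ∞ ψ) (p : ℝ × Space d) :
    dirDeriv (1, 0) (fun p : ℝ × Space d => χ p.1 * ψ p.2) p = deriv χ p.1 * ψ p.2 := by
  have h1 : HasFDerivAt (fun p : ℝ × Space d => χ p.1) _ p :=
    (hχ.differentiable (by simp) p.1).hasFDerivAt.comp p hasFDerivAt_fst
  have h2 : HasFDerivAt (fun p : ℝ × Space d => ψ p.2) _ p :=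
    (hψ.differentiable (by simp) p.2).hasFDerivAt.comp p hasFDerivAt_snd
  unfold dirDeriv
  rw [(h1.fun_mul h2).fderiv]
  simp [mul_comm]

lemma dirDeriv_prod_space {χ : ℝ → ℝ} {ψ : Space d → ℝ} (hχ : ContDiff ℝ ∞ χ)
    (hψ : ContDiff ℝ ∞ ψ) (e : Space d) (p : ℝ × Space d) :
    dirDeriv (0, e) (fun p : ℝ × Space d => χ p.1 * ψ p.2) p = χ p.1 * dirDeriv e ψ p.2 := by
  have h1 : HasFDerivAt (fun p : ℝ × Space d => χ p.1) _ p :=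
    (hχ.differentiable (by simp) p.1).hasFDerivAt.comp p hasFDerivAt_fst
  have h2 : HasFDerivAt (fun p : ℝ × Space d => ψ p.2) _ p :=
    (hψ.differentiable (by simp) p.2).hasFDerivAt.comp p hasFDerivAt_snd
  unfold dirDeriv
  rw [(h1.fun_mul h2).fderiv]
  simp

lemma isTestFunction_prod {χ : ℝ → ℝ} {ψ : Space d → ℝ} (hχ : ContDiff ℝ ∞ χ)
    (hχc : HasCompactSupport χ) (hχs : tsupport χ ⊆ Ioi 0) (hψ : ContDiff ℝ ∞ ψ)
    (hψc : HasCompactSupport ψ) : IsTestFunction fun p : ℝ × Space d => χ p.1 * ψ p.2 where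
  smooth := (hχ.comp contDiff_fst).mul (hψ.comp contDiff_snd)
  hasCompactSupport := by
    refine HasCompactSupport.intro (IsCompact.prod hχc hψc) fun p hp => ?_
    by_contra hne
    exact hp ⟨subset_tsupport _ (left_ne_zero_of_mul hne), subset_tsupport _ (right_ne_zero_of_mul hne)⟩
  tsupport_subset := fun p hp => by
    have : p ∈ tsupport fun p : ℝ × Space d => χ p.1 := tsupport_mul_subset_left hp
    exact ⟨hχs (tsupport_comp_subset_preimage χ (f := Prod.fst) continuous_fst this), mem_univ _⟩

variable {f : Fin d → ℝ → ℝ} {A σ : Fin d → Fin d → ℝ → ℝ} {B : ℝ}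
  {u v : ℝ × Space d → ℝ} {g h : Fin d → ℝ × Space d → ℝ}

/-- All fluxes are dominated by the zeroth one, `(a - b)⁺`, which is what lets Gronwall's argument
close. -/
lemma abs_kruzhkovFlux_le {H : ℝ → ℝ} (hH : ContDiff ℝ ∞ H) {L : ℝ}
    (hL : ∀ s, |s| ≤ B → |deriv H s| ≤ L) {a b : ℝ} (ha : |a| ≤ B) (hb : |b| ≤ B) :
    |kruzhkovFlux H a b| ≤ L * (max a b - b) := by
  have hm : |max a b| ≤ B := by rcases max_choice a b with h | h <;> rw [h] <;> assumption
  have := abs_sub_le_of_abs_deriv_le (hH.differentiable (by simp)) hL hm hb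
  rwa [abs_of_nonneg (sub_nonneg.2 (le_max_right a b))] at this

lemma max_sub_bounds {a b : ℝ} (ha : |a| ≤ B) (hb : |b| ≤ B) :
    0 ≤ max a b - b ∧ max a b - b ≤ 2 * B := by
  have hm : |max a b| ≤ B := by rcases max_choice a b with h | h <;> rw [h] <;> assumption
  exact ⟨sub_nonneg.2 (le_max_right a b), by linarith [(abs_le.1 hm).2, (abs_le.1 hb).1]⟩

lemma IsEntropyPair.measurable_posPart (hu : IsEntropyPair f A σ B u g)
    (hv : IsEntropyPair f A σ B v h) : Measurable fun p => max (u p) (v p) - v p :=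
  (hu.measurable.max hv.measurable).sub hv.measurable

/-- Kato's inequality tested with a product of a function of time and a weight. -/
lemma kato_weighted (hadm : IsAdmissible f A σ) {Λ c : ℝ}
    (hΛ : ∀ ι s, |s| ≤ B → |deriv (fluxFn f A ι) s| ≤ Λ) (hu : IsEntropyPair f A σ B u g)
    (hv : IsEntropyPair f A σ B v h) {w : Space d → ℝ} (hwc : Continuous w) (hw0 : ∀ x, 0 ≤ w x)
    (hwi : Integrable w) {ψ : ℕ → Space d → ℝ}
    (hψ : ∀ n, HasDerivBounds c w (ψ n) ∧ HasCompactSupport (ψ n) ∧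
      (∀ x, 0 ≤ ψ n x ∧ ψ n x ≤ w x) ∧ ∀ x, ‖x‖ ≤ n → ψ n x = w x)
    {χ : ℝ → ℝ} (hχ : ContDiff ℝ ∞ χ) (hχc : HasCompactSupport χ) (hχs : tsupport χ ⊆ Ioi 0)
    (hχ0 : ∀ t, 0 ≤ χ t) :
    0 ≤ ∫ p : ℝ × Space d, (max (u p) (v p) - v p) *
      ((deriv χ p.1 + Λ * c * (d + d * d) * χ p.1) * w p.2) := by
  set N : ℝ × Space d → ℝ := fun p => max (u p) (v p) - v p with hN
  have hN0 : ∀ p, 0 ≤ N p := fun p => (max_sub_bounds (hu.bound p) (hv.bound p)).1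
  have hNB : ∀ p, N p ≤ 2 * B := fun p => (max_sub_bounds (hu.bound p) (hv.bound p)).2
  have hNm : Measurable N := hu.measurable_posPart hv
  have hχi : Integrable χ := hχ.continuous.integrable_of_hasCompactSupport hχc
  have hχ'c : Continuous (deriv χ) := hχ.continuous_deriv (by simp)
  have hχ'i : Integrable (deriv χ) := hχ'c.integrable_of_hasCompactSupport hχc.deriv
  set K := Λ * c * (d + d * d) with hK
  have hbdd : ∀ {F : ℝ × Space d → ℝ}, Integrable F → Integrable fun p => N p * F p := fun hF =>
    hF.bdd_mul (c := 2 * B) hNm.aestronglyMeasurable (Eventually.of_forall fun p => by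
      rw [Real.norm_eq_abs, abs_of_nonneg (hN0 p)]; exact hNB p)
  -- The time term is kept exactly; each of the `d` first order and `d * d` second order terms is at
  -- most `Λ c N χ w`, since the cutoff weights have derivatives bounded by `c w`.
  have step : ∀ n, 0 ≤ ∫ p : ℝ × Space d, N p * (deriv χ p.1 * ψ n p.2 + K * χ p.1 * w p.2) := by
    intro n
    obtain ⟨hb, hc, h01, -⟩ := hψ n
    have hφ := isTestFunction_prod hχ hχc hχs hb.smooth hc
    have hk := kato_inequality hadm hu hv hφ fun p => mul_nonneg (hχ0 _) (h01 _).1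
    have hi : Integrable fun p : ℝ × Space d => deriv χ p.1 * ψ n p.2 :=
      hχ'i.mul_prod (hb.smooth.continuous.integrable_of_hasCompactSupport hc)
    have hi2 : Integrable fun p : ℝ × Space d => K * χ p.1 * w p.2 := (hχi.const_mul K).mul_prod hwi
    refine hk.trans (integral_mono ?_ (hbdd (hi.add hi2)) fun p => ?_)
    · refine integrable_finsetSum _ fun ι _ => ?_
      obtain ⟨M, hM⟩ := exists_bound_square
        (continuous_kruzhkovFlux (contDiff_fluxFn hadm ι).continuous) B
      exact (hφ.diffOp ι).integrable.bdd_mul (c := M)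
        ((continuous_kruzhkovFlux (contDiff_fluxFn hadm ι).continuous).measurable.comp
          (hu.measurable.prodMk hv.measurable)).aestronglyMeasurable
        (Eventually.of_forall fun p => hM _ _ (hu.bound _) (hv.bound _))
    · have hd1 : ∀ i, dx i (fun p : ℝ × Space d => χ p.1 * ψ n p.2) =
          fun p => χ p.1 * dirDeriv (Pi.single i 1) (ψ n) p.2 := fun i =>
        funext (dirDeriv_prod_space hχ hb.smooth _)
      have hd2 : ∀ i j, dx i (dx j (fun p : ℝ × Space d => χ p.1 * ψ n p.2)) p =
          χ p.1 * dirDeriv (Pi.single i 1) (dirDeriv (Pi.single j 1) (ψ n)) p.2 := fun i j => by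
        rw [hd1]
        exact dirDeriv_prod_space hχ (contDiff_dirDeriv _ hb.smooth) _ p
      have hdt : dt (fun p : ℝ × Space d => χ p.1 * ψ n p.2) p = deriv χ p.1 * ψ n p.2 :=
        dirDeriv_prod_time hχ hb.smooth p
      have hT : ∀ ι (y : ℝ), |y| ≤ c * w p.2 →
          kruzhkovFlux (fluxFn f A ι) (u p) (v p) * (χ p.1 * y) ≤ Λ * c * (N p * χ p.1 * w p.2) := by
        intro ι y hy
        have h1 := abs_kruzhkovFlux_le (contDiff_fluxFn hadm ι) (hΛ ι) (hu.bound p) (hv.bound p)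
        refine (le_abs_self _).trans ?_
        rw [abs_mul, abs_mul, abs_of_nonneg (hχ0 _)]
        calc _ ≤ (Λ * N p) * (χ p.1 * (c * w p.2)) :=
              mul_le_mul h1 (mul_le_mul_of_nonneg_left hy (hχ0 _))
                (mul_nonneg (hχ0 _) (abs_nonneg _)) ((abs_nonneg _).trans h1)
          _ = _ := by ring
      simp only [Fintype.sum_sum_type, Fintype.sum_prod_type, diffOp, Sum.elim_inl, Sum.elim_inr,
        Finset.univ_unique, Finset.sum_singleton, hdt, hd2]
      simp only [hd1]
      have s1 : ∑ i, kruzhkovFlux (fluxFn f A (Sum.inr (Sum.inl i))) (u p) (v p) *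
          (χ p.1 * dirDeriv (Pi.single i 1) (ψ n) p.2) ≤ d * (Λ * c * (N p * χ p.1 * w p.2)) := by
        refine (Finset.sum_le_sum fun i _ => hT _ _ (hb.bound_one i p.2)).trans ?_
        simp
      have s2 : ∑ i, ∑ j, kruzhkovFlux (fluxFn f A (Sum.inr (Sum.inr (i, j)))) (u p) (v p) *
          (χ p.1 * dirDeriv (Pi.single i 1) (dirDeriv (Pi.single j 1) (ψ n)) p.2) ≤
          d * (d * (Λ * c * (N p * χ p.1 * w p.2))) := by
        refine (Finset.sum_le_sum fun i _ => Finset.sum_le_sum fun j _ =>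
          hT _ _ (hb.bound_two i j p.2)).trans ?_
        simp
      have e0 : kruzhkovFlux (fluxFn f A (Sum.inl default)) (u p) (v p) = N p := rfl
      rw [e0]
      have e1 : N p * (deriv χ p.1 * ψ n p.2 + K * χ p.1 * w p.2) = N p * (deriv χ p.1 * ψ n p.2) +
          (d * (Λ * c * (N p * χ p.1 * w p.2)) + d * (d * (Λ * c * (N p * χ p.1 * w p.2)))) := by
        rw [hK]; ring
      rw [e1]
      linarith
  have hlim : Tendsto (fun n => ∫ p : ℝ × Space d,
      N p * (deriv χ p.1 * ψ n p.2 + K * χ p.1 * w p.2)) atTop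
      (𝓝 (∫ p : ℝ × Space d, N p * ((deriv χ p.1 + K * χ p.1) * w p.2))) := by
    refine tendsto_integral_of_dominated_convergence
      (fun p => N p * ((|deriv χ p.1| + |K * χ p.1|) * w p.2)) (fun n => ?_) ?_ (fun n => ?_) ?_
    · have hc := (hψ n).1.smooth.continuous
      have hχc' := hχ.continuous
      exact (hNm.mul (Continuous.measurable (by fun_prop))).aestronglyMeasurable
    · exact hbdd ((hχ'i.abs.add (hχi.const_mul K).abs).mul_prod hwi)
    · refine Eventually.of_forall fun p => ?_
      obtain ⟨-, -, h01, -⟩ := hψ n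
      rw [norm_mul, Real.norm_of_nonneg (hN0 p)]
      refine mul_le_mul_of_nonneg_left ((norm_add_le _ _).trans ?_) (hN0 p)
      rw [norm_mul, norm_mul, Real.norm_of_nonneg (h01 p.2).1, Real.norm_of_nonneg (hw0 p.2), add_mul]
      exact add_le_add (mul_le_mul_of_nonneg_left (h01 p.2).2 (abs_nonneg _)) le_rfl
    · refine Eventually.of_forall fun p => ?_
      obtain ⟨n₀, hn₀⟩ := exists_nat_ge ‖p.2‖
      refine tendsto_const_nhds.congr' ?_
      filter_upwards [eventually_ge_atTop n₀] with n hn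
      rw [(hψ n).2.2.2 p.2 (hn₀.trans (by exact_mod_cast hn)), add_mul]
  exact ge_of_tendsto' hlim step

/-- A monotone cutoff in time. -/
lemma exists_time_cutoff {ρ : ℝ → ℝ} (hρ : ContDiff ℝ ∞ ρ) (hρ0 : ∀ x, 0 ≤ ρ x) {r : ℝ}
    (hr : ∀ x, r < |x| → ρ x = 0) {s t : ℝ} (hst : s ≤ t) (hs : r < s) :
    ∃ ζ : ℝ → ℝ, ContDiff ℝ ∞ ζ ∧ HasCompactSupport ζ ∧ tsupport ζ ⊆ Ioi 0 ∧ (∀ x, 0 ≤ ζ x) ∧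
      ∀ x, deriv ζ x = ρ (x - s) - ρ (x - t) := by
  have hc := hρ.continuous
  have hi : ∀ a b, IntervalIntegrable ρ volume a b := fun a b => hc.intervalIntegrable a b
  have hd : ∀ x, HasDerivAt (fun x => (∫ y in (0 : ℝ)..(x - s), ρ y) - ∫ y in (0 : ℝ)..(x - t), ρ y)
      (ρ (x - s) - ρ (x - t)) x := by
    intro x
    have h1 : ∀ a : ℝ, HasDerivAt (fun x => ∫ y in (0 : ℝ)..(x - a), ρ y) (ρ (x - a)) x := fun a =>
      HasDerivAt.comp_sub_const x a (intervalIntegral.integral_hasDerivAt_right (hi 0 (x - a))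
        (hc.stronglyMeasurableAtFilter _ _) hc.continuousAt)
    exact (h1 s).fun_sub (h1 t)
  -- The function is a smoothed indicator of `[s, t]`: it integrates `ρ` over the window `[x - t, x
  -- - s]`, so it lives on `[s - r, t + r]`, inside `t > 0` because `r < s`.
  have hsub : ∀ x, (∫ y in (0 : ℝ)..(x - s), ρ y) - ∫ y in (0 : ℝ)..(x - t), ρ y =
      ∫ y in (x - t)..(x - s), ρ y := fun x =>
    intervalIntegral.integral_interval_sub_left (hi _ _) (hi _ _)
  have hder : deriv (fun x => (∫ y in (0 : ℝ)..(x - s), ρ y) - ∫ y in (0 : ℝ)..(x - t), ρ y) =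
      fun x => ρ (x - s) - ρ (x - t) := funext fun x => (hd x).deriv
  have hzero : ∀ x, x ∉ Icc (s - r) (t + r) →
      (∫ y in (0 : ℝ)..(x - s), ρ y) - ∫ y in (0 : ℝ)..(x - t), ρ y = 0 := by
    intro x hx
    rw [hsub, intervalIntegral.integral_congr (g := fun _ => (0 : ℝ))]
    · simp
    · intro y hy
      rw [uIcc_of_le (by linarith)] at hy
      rw [mem_Icc, not_and_or, not_le, not_le] at hx
      refine hr y ?_
      rcases hx with hx | hx
      · exact lt_abs.2 (Or.inr (by linarith [hy.2]))
      · exact lt_abs.2 (Or.inl (by linarith [hy.1]))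
  refine ⟨_, ?_, HasCompactSupport.intro isCompact_Icc hzero, ?_, fun x => ?_, fun x => (hd x).deriv⟩
  · rw [contDiff_infty_iff_deriv, hder]
    exact ⟨fun x => (hd x).differentiableAt, by fun_prop⟩
  · refine (closure_minimal (fun x hx => ?_) isClosed_Icc).trans
      (fun x (hx : x ∈ Icc (s - r) (t + r)) => ?_)
    · by_contra hne
      exact hx (hzero x hne)
    · exact lt_of_lt_of_le (by linarith) hx.1
  · rw [hsub]
    exact intervalIntegral.integral_nonneg (by linarith) fun y _ => hρ0 y

/-- A locally integrable function whose distributional derivative is nonpositive on `(0, ∞)` is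
nonincreasing on a set of full measure. -/
lemma exists_antitoneOn_of_distrib {m : ℝ → ℝ} (hm : LocallyIntegrable m)
    (h : ∀ ζ : ℝ → ℝ, ContDiff ℝ ∞ ζ → HasCompactSupport ζ → tsupport ζ ⊆ Ioi 0 → (∀ x, 0 ≤ ζ x) →
      0 ≤ ∫ t, deriv ζ t * m t) :
    ∃ G : Set ℝ, (∀ᵐ t, t ∈ G) ∧ ∀ s ∈ G, ∀ t ∈ G, 0 < s → s ≤ t → m t ≤ m s := by
  let b : ℕ → ContDiffBump (0 : ℝ) := fun n =>
    ⟨1 / ((n : ℝ) + 1) / 2, 1 / ((n : ℝ) + 1), by positivity, half_lt_self (by positivity)⟩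
  have hb : Tendsto (fun n => (b n).rOut) atTop (𝓝 0) := tendsto_one_div_add_atTop_nhds_zero_nat
  -- Lebesgue differentiation along bumps whose outer radius is at most twice the inner one. The
  -- good set consists of the times where these mollifications converge; each mollification is
  -- ordered by the test function with derivative `ρ(· - s) - ρ(· - t)`.
  have hae := ContDiffBump.ae_convolution_tendsto_right_of_locallyIntegrable (μ := volume)
    (K := 2) hb (Eventually.of_forall fun n => by
      change 1 / ((n : ℝ) + 1) ≤ 2 * (1 / ((n : ℝ) + 1) / 2)
      linarith) hm
  refine ⟨_, hae, fun s hs t ht hs0 hst => le_of_tendsto_of_tendsto ht hs ?_⟩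
  filter_upwards [hb.eventually (gt_mem_nhds hs0)] with n hn
  set ρ := (b n).normed volume with hρ
  have hρs : ContDiff ℝ ∞ ρ := (b n).contDiff_normed
  have hρc : HasCompactSupport ρ := (b n).hasCompactSupport_normed
  obtain ⟨ζ, h1, h2, h3, h4, h5⟩ := exists_time_cutoff hρs (b n).nonneg_normed (r := (b n).rOut)
    (fun x hx => by
      have : x ∉ Function.support ρ := by
        rw [hρ, (b n).support_normed_eq, mem_ball_zero_iff, not_lt]
        exact hx.le
      simpa using this) hst hn
  have hconv : ∀ x, (convolution ρ m (ContinuousLinearMap.lsmul ℝ ℝ) volume) x = ∫ y, ρ (y - x) * m y := by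
    intro x
    rw [convolution_eq_swap]
    refine integral_congr_ae (Eventually.of_forall fun y => ?_)
    simp only [ContinuousLinearMap.lsmul_apply, smul_eq_mul]
    rw [← neg_sub, hρ, (b n).normed_neg]
  have hint : ∀ x, Integrable fun y => ρ (y - x) * m y := by
    intro x
    have := hm.integrable_smul_left_of_hasCompactSupport (g := fun y => ρ (y - x))
      (hρs.continuous.comp (continuous_id.sub continuous_const))
      (hρc.comp_homeomorph (Homeomorph.subRight x))
    simpa using this
  have := h ζ h1 h2 h3 h4
  simp only [h5, sub_mul] at this
  rw [integral_sub (hint s) (hint t), ← hconv, ← hconv] at this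
  exact sub_nonneg.1 this

/-- The weighted contraction property of entropy solutions. -/
theorem weighted_contraction (hadm : IsAdmissible f A σ) (B : ℝ) :
    ∃ C : ℝ, 0 < C ∧ ∀ (u v : ℝ × Space d → ℝ) (g h : Fin d → ℝ × Space d → ℝ),
      IsEntropyPair f A σ B u g → IsEntropyPair f A σ B v h → ∀ L : ℝ, 1 ≤ L → ∀ z : Space d,
      ∃ G : Set ℝ, (∀ᵐ t, t ∈ G) ∧ ∀ s ∈ G, ∀ t ∈ G, 0 < s → s ≤ t →
        ∫ x, (max (u (t, x)) (v (t, x)) - v (t, x)) * weight L z x ≤ Real.exp (C * (t - s)) *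
          ∫ x, (max (u (s, x)) (v (s, x)) - v (s, x)) * weight L z x := by
  obtain ⟨Λ, hΛ0, hΛ⟩ := exists_uniform_bound_Icc (fun ι => continuous_deriv_fluxFn hadm ι) B
  obtain ⟨c, hc0, hc⟩ := exists_cutoff_weight d
  -- The added 1 makes `C` positive; the surplus term it creates has a favorable sign.
  refine ⟨Λ * c * (d + d * d) + 1, by positivity, fun u v g h hu hv L hL z => ?_⟩
  set C := Λ * c * (d + d * d) + 1 with hC
  obtain ⟨ψ, hψ⟩ := hc L hL z
  set w := weight L z with hw
  have hwi : Integrable w := integrable_weight (by linarith) z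
  have hw0 : ∀ x, 0 ≤ w x := fun x => (weight_pos L z x).le
  have hwc : Continuous w := (contDiff_weight L z).continuous
  set N : ℝ × Space d → ℝ := fun p => max (u p) (v p) - v p with hN
  have hN0 : ∀ p, 0 ≤ N p := fun p => (max_sub_bounds (hu.bound p) (hv.bound p)).1
  have hNB : ∀ p, N p ≤ 2 * B := fun p => (max_sub_bounds (hu.bound p) (hv.bound p)).2
  have hNm : Measurable N := hu.measurable_posPart hv
  set D : ℝ → ℝ := fun t => ∫ x, N (t, x) * w x with hD
  have hDm : StronglyMeasurable D :=
    StronglyMeasurable.integral_prod_right (f := fun t x => N (t, x) * w x)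
      (hNm.mul (hwc.measurable.comp measurable_snd)).stronglyMeasurable
  have hNw : ∀ t, Integrable fun x => N (t, x) * w x := fun t =>
    hwi.bdd_mul (c := 2 * B) (hNm.comp measurable_prodMk_left).aestronglyMeasurable
      (Eventually.of_forall fun x => by
        rw [Real.norm_of_nonneg (hN0 _)]; exact hNB _)
  have hD0 : ∀ t, 0 ≤ D t := fun t => integral_nonneg fun x => mul_nonneg (hN0 _) (hw0 _)
  have hDB : ∀ t, D t ≤ 2 * B * ∫ x, w x := fun t => by
    rw [← integral_const_mul]
    exact integral_mono (hNw t) (hwi.const_mul _) fun x =>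
      mul_le_mul_of_nonneg_right (hNB _) (hw0 _)
  have hexp : Continuous fun t : ℝ => Real.exp (-C * t) := by fun_prop
  have hmloc : LocallyIntegrable fun t => Real.exp (-C * t) * D t := by
    have hmaj : LocallyIntegrable fun t => Real.exp (-C * t) * (2 * B * ∫ x, w x) :=
      (hexp.mul continuous_const).locallyIntegrable
    refine hmaj.mono
      (hexp.aestronglyMeasurable.mul hDm.aestronglyMeasurable) (Eventually.of_forall fun t => ?_)
    have := (hD0 t).trans (hDB t)
    rw [Real.norm_of_nonneg (mul_nonneg (Real.exp_pos _).le (hD0 t)),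
      Real.norm_of_nonneg (mul_nonneg (Real.exp_pos _).le this)]
    exact mul_le_mul_of_nonneg_left (hDB t) (Real.exp_pos _).le
  -- The integrating factor `e^{-Ct}` in the test function absorbs the zeroth order term, so
  -- `e^{-Ct} D(t)` is nonincreasing in the sense of distributions.
  obtain ⟨G, hG, hGm⟩ := exists_antitoneOn_of_distrib hmloc fun ζ h1 h2 h3 h4 => by
    have hes : ContDiff ℝ ∞ fun t : ℝ => Real.exp (-C * t) := by fun_prop
    have hχd : ∀ t, deriv (fun t => Real.exp (-C * t) * ζ t) t =
        -C * (Real.exp (-C * t) * ζ t) + Real.exp (-C * t) * deriv ζ t := by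
      intro t
      have he : HasDerivAt (fun t : ℝ => Real.exp (-C * t)) (Real.exp (-C * t) * (-C)) t := by
        simpa using ((hasDerivAt_id t).const_mul (-C)).exp
      have := (he.mul (h1.differentiable (by simp) t).hasDerivAt).deriv
      refine Eq.trans this ?_
      ring
    have key := kato_weighted hadm hΛ hu hv hwc hw0 hwi hψ (χ := fun t => Real.exp (-C * t) * ζ t)
      (hes.mul h1) h2.mul_left (tsupport_mul_subset_right.trans h3)
      (fun t => mul_nonneg (Real.exp_pos _).le (h4 t))
    have hζ'c : Continuous (deriv ζ) := h1.continuous_deriv (by simp)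
    have hζi : Integrable fun t => Real.exp (-C * t) * ζ t :=
      (hexp.mul h1.continuous).integrable_of_hasCompactSupport h2.mul_left
    have hζ'i : Integrable fun t => Real.exp (-C * t) * deriv ζ t :=
      (hexp.mul hζ'c).integrable_of_hasCompactSupport h2.deriv.mul_left
    have hbdd : ∀ {F : ℝ × Space d → ℝ}, Integrable F → Integrable fun p => N p * F p := fun hF =>
      hF.bdd_mul (c := 2 * B) hNm.aestronglyMeasurable (Eventually.of_forall fun p => by
        rw [Real.norm_of_nonneg (hN0 p)]; exact hNB p)
    have hI1 : Integrable fun p : ℝ × Space d => N p * (Real.exp (-C * p.1) * deriv ζ p.1 * w p.2) :=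
      hbdd (hζ'i.mul_prod hwi)
    have hI2 : Integrable fun p : ℝ × Space d => N p * (Real.exp (-C * p.1) * ζ p.1 * w p.2) :=
      hbdd (hζi.mul_prod hwi)
    have e1 : ∫ t, deriv ζ t * (Real.exp (-C * t) * D t) =
        ∫ p : ℝ × Space d, N p * (Real.exp (-C * p.1) * deriv ζ p.1 * w p.2) := by
      erw [integral_prod _ hI1]
      refine integral_congr_ae (Eventually.of_forall fun t => ?_)
      have : deriv ζ t * (Real.exp (-C * t) * D t) =
          ∫ x, N (t, x) * (Real.exp (-C * t) * deriv ζ t * w x) := by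
        rw [hD, ← mul_assoc, ← integral_const_mul]
        congr 1; ext x; ring
      exact this
    rw [e1]
    have e4 : ∀ p : ℝ × Space d, N p * ((deriv (fun t => Real.exp (-C * t) * ζ t) p.1 +
        Λ * c * (d + d * d) * (Real.exp (-C * p.1) * ζ p.1)) * w p.2) =
        N p * (Real.exp (-C * p.1) * deriv ζ p.1 * w p.2) -
          N p * (Real.exp (-C * p.1) * ζ p.1 * w p.2) := fun p => by
      rw [hχd, hC]; ring
    refine key.trans (integral_mono ?_ hI1 fun p => ?_)
    · exact (hI1.sub hI2).congr (Eventually.of_forall fun p => (e4 p).symm)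
    · refine (e4 p).le.trans (sub_le_self _ ?_)
      exact mul_nonneg (hN0 p) (mul_nonneg (mul_nonneg (Real.exp_pos _).le (h4 _)) (hw0 _))
  refine ⟨G, hG, fun s hs t ht hs0 hst => ?_⟩
  have := hGm s hs t ht hs0 hst
  have e2 : Real.exp (C * (t - s)) = Real.exp (C * t) * Real.exp (-C * s) := by
    rw [← Real.exp_add]; congr 1; ring
  have e3 : D t = Real.exp (C * t) * (Real.exp (-C * t) * D t) := by
    rw [← mul_assoc, ← Real.exp_add]; simp
  change D t ≤ Real.exp (C * (t - s)) * D s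
  rw [e2, e3, mul_assoc]
  exact mul_le_mul_of_nonneg_left this (Real.exp_pos _).le

end

/-! ### The weighted `L¹` seminorm and traces -/

section
variable {d : ℕ}

/-- The weighted `L¹` seminorm. -/
def weightedNorm (L : ℝ) (z : Space d) (g : Space d → ℝ) : ℝ≥0∞ :=
  ∫⁻ x, ENNReal.ofReal (weight L z x) * ‖g x‖ₑ

variable {L : ℝ} {z : Space d}

lemma measurable_ofReal_weight (L : ℝ) (z : Space d) :
    Measurable fun x => ENNReal.ofReal (weight L z x) :=
  (contDiff_weight L z).continuous.measurable.ennreal_ofReal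

lemma weightedNorm_mono {a b : Space d → ℝ} (h : ∀ᵐ x, ‖a x‖ₑ ≤ ‖b x‖ₑ) :
    weightedNorm L z a ≤ weightedNorm L z b :=
  lintegral_mono_ae (h.mono fun x hx => by gcongr)

lemma weightedNorm_sub_le {a b c : Space d → ℝ} (ha : AEMeasurable a) (hb : AEMeasurable b) :
    weightedNorm L z (fun x => a x - c x) ≤
      weightedNorm L z (fun x => a x - b x) + weightedNorm L z (fun x => b x - c x) := by
  unfold weightedNorm
  have hm : AEMeasurable fun x => ENNReal.ofReal (weight L z x) * ‖a x - b x‖ₑ :=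
    (measurable_ofReal_weight L z).aemeasurable.mul (ha.sub hb).enorm
  rw [← lintegral_add_left' hm]
  refine lintegral_mono fun x => ?_
  rw [← mul_add]
  gcongr
  change ‖a x - c x‖ₑ ≤ _
  rw [← sub_add_sub_cancel (a x) (b x) (c x)]
  exact enorm_add_le _ _

lemma weightedNorm_sub_comm (a b : Space d → ℝ) :
    weightedNorm L z (fun x => a x - b x) = weightedNorm L z (fun x => b x - a x) := by
  unfold weightedNorm
  simp only [enorm_sub_rev]

lemma weightedNorm_translate (g : Space d → ℝ) (τ : Space d) :
    weightedNorm L z (fun x => g (x + τ)) = weightedNorm L (z + τ) g := by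
  unfold weightedNorm
  rw [← lintegral_add_right_eq_self (fun x => ENNReal.ofReal (weight L (z + τ) x) * ‖g x‖ₑ) τ]
  refine lintegral_congr fun x => ?_
  rw [← weight_sub, add_sub_cancel_right]

/-- Lets continuity in time, proved for the single weight `weight 1 0`, be used with every other
weight. -/
lemma exists_weightedNorm_le (hL : L ≠ 0) (z : Space d) :
    ∃ c : ℝ≥0∞, c ≠ ⊤ ∧ ∀ g : Space d → ℝ, weightedNorm L z g ≤ c * weightedNorm 1 0 g := by
  obtain ⟨C, hC, h⟩ := exists_weight_le hL z
  refine ⟨ENNReal.ofReal C, ENNReal.ofReal_ne_top, fun g => ?_⟩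
  unfold weightedNorm
  rw [← lintegral_const_mul' _ _ ENNReal.ofReal_ne_top]
  refine lintegral_mono fun x => ?_
  rw [← mul_assoc, ← ENNReal.ofReal_mul hC.le]
  gcongr
  exact h x

lemma exists_setLIntegral_cube_le (R : ℝ) :
    ∃ c : ℝ≥0∞, c ≠ ⊤ ∧ ∀ g : Space d → ℝ,
      ∫⁻ x in cube R 0, ‖g x‖ₑ ≤ c * weightedNorm 1 0 g := by
  set m := (1 + (d : ℝ) * (R / 2) ^ 2)⁻¹ ^ (d + 1) with hm
  have hm0 : 0 < m := by positivity
  refine ⟨ENNReal.ofReal m⁻¹, ENNReal.ofReal_ne_top, fun g => ?_⟩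
  unfold weightedNorm
  rw [← lintegral_const_mul' _ _ ENNReal.ofReal_ne_top]
  refine (setLIntegral_mono' (measurableSet_cube R 0) fun x hx => ?_).trans
    (setLIntegral_le_lintegral (cube R 0) _)
  have h1 : m ≤ weight 1 0 x := le_weight 0 x (by simpa [cube] using hx)
  rw [← mul_assoc, ← ENNReal.ofReal_mul (by positivity)]
  refine le_mul_of_one_le_left zero_le ?_
  rw [ENNReal.one_le_ofReal, ← div_eq_inv_mul]
  exact (one_le_div hm0).2 h1

lemma lintegral_weight_ne_top (hL : 0 < L) (z : Space d) :
    ∫⁻ x, ENNReal.ofReal (weight L z x) ≠ ⊤ :=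
  (integrable_weight hL z).lintegral_lt_top.ne

lemma weightedNorm_ne_top (hL : 0 < L) {B : ℝ} {g : Space d → ℝ} (hg : ∀ᵐ x, |g x| ≤ B) :
    weightedNorm L z g ≠ ⊤ := by
  refine ne_top_of_le_ne_top (b := (∫⁻ x, ENNReal.ofReal (weight L z x)) * ENNReal.ofReal B)
    (ENNReal.mul_ne_top (lintegral_weight_ne_top hL z) ENNReal.ofReal_ne_top) ?_
  unfold weightedNorm
  rw [← lintegral_mul_const' _ _ ENNReal.ofReal_ne_top]
  refine lintegral_mono_ae (hg.mono fun x hx => ?_)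
  gcongr
  rw [← ofReal_norm]
  exact ENNReal.ofReal_le_ofReal hx

lemma weightedNorm_eq_ofReal_integral (hL : 0 < L) {B : ℝ} {g : Space d → ℝ}
    (hgm : AEMeasurable g) (hg : ∀ᵐ x, |g x| ≤ B) :
    weightedNorm L z g = ENNReal.ofReal (∫ x, |g x| * weight L z x) := by
  rw [ofReal_integral_eq_lintegral_ofReal]
  · refine lintegral_congr fun x => ?_
    rw [mul_comm, ENNReal.ofReal_mul (abs_nonneg _), ← Real.norm_eq_abs, ofReal_norm]
  · exact (integrable_weight hL z).bdd_mul (c := B) hgm.abs.aestronglyMeasurable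
      (hg.mono fun x hx => by simpa using hx)
  · exact Eventually.of_forall fun x => mul_nonneg (abs_nonneg _) (weight_pos L z x).le

/-- Bounded families that converge to zero in `L¹` on cubes converge to zero in weighted norm. -/
lemma tendsto_weightedNorm {ι : Type*} {l : Filter ι} {F : ι → Space d → ℝ} {B : ℝ} (hL : 0 < L)
    (hB : ∀ᶠ i in l, ∀ᵐ x, |F i x| ≤ B)
    (h : ∀ R : ℝ, 0 < R → Tendsto (fun i => ∫⁻ x in cube R 0, ‖F i x‖ₑ) l (𝓝 0)) (z : Space d) :
    Tendsto (fun i => weightedNorm L z (F i)) l (𝓝 0) := by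
  -- The weight has finite mass, so the complement of a large cube carries little of it and the
  -- uniform bound `B` suffices there; inside the cube the L¹ convergence is used.
  set μ : Measure (Space d) := volume.withDensity fun x => ENNReal.ofReal (weight L z x) with hμ
  have : IsFiniteMeasure μ := isFiniteMeasure_withDensity (lintegral_weight_ne_top hL z)
  have htail : Tendsto (fun n : ℕ => μ (cube n (0 : Space d))ᶜ) atTop (𝓝 0) := by
    have := tendsto_measure_iInter_atTop (μ := μ) (s := fun n : ℕ => (cube n (0 : Space d))ᶜ)
      (fun n => (measurableSet_cube _ _).compl.nullMeasurableSet)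
      (fun n m hnm => compl_subset_compl.2 (Metric.closedBall_subset_closedBall (by gcongr)))
      ⟨0, measure_ne_top _ _⟩
    have hE : ⋂ n : ℕ, (cube n (0 : Space d))ᶜ = ∅ := by
      rw [← compl_iUnion, compl_empty_iff, eq_univ_iff_forall]
      intro x
      obtain ⟨n, hn⟩ := exists_nat_ge (‖x‖ * 2)
      refine mem_iUnion.2 ⟨n, mem_closedBall_zero_iff.2 ?_⟩
      linarith
    rwa [hE, measure_empty] at this
  rw [ENNReal.tendsto_nhds_zero]
  intro ε hε
  have hε2 : 0 < ε / 2 := ENNReal.half_pos hε.ne'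
  have ht2 : Tendsto (fun n : ℕ => ENNReal.ofReal B * μ (cube n (0 : Space d))ᶜ) atTop (𝓝 0) := by
    simpa using ENNReal.Tendsto.const_mul htail (Or.inr ENNReal.ofReal_ne_top)
  obtain ⟨n, hn, hn1⟩ := ((ENNReal.tendsto_nhds_zero.1 ht2 _ hε2).and (eventually_ge_atTop 1)).exists
  have hn0 : (0 : ℝ) < n := by exact_mod_cast hn1
  filter_upwards [hB, ENNReal.tendsto_nhds_zero.1 (h n hn0) _ hε2] with i hi1 hi2
  unfold weightedNorm
  rw [← lintegral_add_compl _ (measurableSet_cube (n : ℝ) (0 : Space d)), ← ENNReal.add_halves ε]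
  refine add_le_add (le_trans (lintegral_mono fun x => ?_) hi2) (le_trans ?_ hn)
  · refine mul_le_of_le_one_left zero_le (ENNReal.ofReal_le_one.2 (weight_le_one _ _ _))
  · rw [hμ, withDensity_apply _ (measurableSet_cube _ _).compl,
      ← lintegral_const_mul' _ _ ENNReal.ofReal_ne_top]
    refine lintegral_mono_ae ((ae_restrict_of_ae hi1).mono fun x hx => ?_)
    rw [mul_comm]
    gcongr
    rw [← ofReal_norm]
    exact ENNReal.ofReal_le_ofReal hx

/-- Essential convergence to the data as `t → 0+`, in all weighted norms. -/
def HasTrace (u : ℝ × Space d → ℝ) (u₀ : Space d → ℝ) : Prop :=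
  ∀ L : ℝ, 1 ≤ L → ∀ z : Space d,
    Tendsto (fun s => weightedNorm L z (fun x => u (s, x) - u₀ x)) (𝓝[>] 0 ⊓ ae volume) (𝓝 0)

/-- A right neighborhood contains an interval of positive measure. Essential limits are therefore
unique, and properties holding eventually along this filter have witnesses. -/
lemma neBot_nhdsGT_inf_ae (a : ℝ) : (𝓝[>] a ⊓ ae volume).NeBot := by
  rw [inf_neBot_iff]
  intro s hs t ht
  obtain ⟨b, hb, hsb⟩ := mem_nhdsGT_iff_exists_Ioo_subset.1 hs
  by_contra hne
  rw [not_nonempty_iff_eq_empty] at hne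
  have h1 : Ioo a b ⊆ tᶜ := fun x hx hxt => by
    have : x ∈ s ∩ t := ⟨hsb hx, hxt⟩
    simp [hne] at this
  have := measure_mono_null h1 (mem_ae_iff.1 ht)
  simp at this
  exact absurd hb (not_lt.2 this)

lemma eventually_nhdsGT_inf_ae {a : ℝ} {P : ℝ → Prop} (h : ∀ᵐ t, a < t → P t) :
    ∀ᶠ t in 𝓝[>] a ⊓ ae volume, P t := by
  have h1 : ∀ᶠ t in 𝓝[>] a ⊓ ae volume, t ∈ Ioi a :=
    (inf_le_left : 𝓝[>] a ⊓ ae volume ≤ _) self_mem_nhdsWithin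
  have h2 : ∀ᶠ t in 𝓝[>] a ⊓ ae volume, a < t → P t :=
    (inf_le_right : 𝓝[>] a ⊓ ae volume ≤ _) h
  filter_upwards [h1, h2] with t a b using b a

lemma eventually_nhdsGT_inf_ae_Ioo {a b : ℝ} (hab : a < b) :
    ∀ᶠ t in 𝓝[>] a ⊓ ae volume, t ∈ Ioo a b :=
  (inf_le_left : 𝓝[>] a ⊓ ae volume ≤ _) (Ioo_mem_nhdsGT hab)

lemma exists_of_eventually_nhdsGT_inf_ae {a : ℝ} {P : ℝ → Prop}
    (h : ∀ᶠ t in 𝓝[>] a ⊓ ae volume, P t) : ∃ b, a < b ∧ ∀ᵐ t, t ∈ Ioo a b → P t := by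
  obtain ⟨s, hs, t, ht, hst⟩ := mem_inf_iff_superset.1 h
  obtain ⟨b, hb, hsb⟩ := mem_nhdsGT_iff_exists_Ioo_subset.1 hs
  exact ⟨b, hb, mem_of_superset ht fun x hx hx2 => hst ⟨hsb hx2, hx⟩⟩

lemma ae_domain {P : ℝ × Space d → Prop} (h : ∀ᵐ p ∂(volume.restrict (domain d)), P p) :
    ∀ᵐ t : ℝ, 0 < t → ∀ᵐ x, P (t, x) := by
  rw [ae_restrict_iff' measurableSet_domain] at h
  filter_upwards [Measure.ae_ae_of_ae_prod h] with t ht h0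
  filter_upwards [ht] with x hx using hx ⟨h0, mem_univ _⟩

lemma HasTrace.const (c : ℝ) : HasTrace (fun _ : ℝ × Space d => c) fun _ => c := by
  intro L hL z
  simpa [weightedNorm] using tendsto_const_nhds

lemma HasTrace.shift {u : ℝ × Space d → ℝ} {u₀ : Space d → ℝ} (h : HasTrace u u₀) (τ : Space d) :
    HasTrace (fun p => u (p + (0, τ))) fun x => u₀ (x + τ) := by
  intro L hL z
  refine (h L hL (z + τ)).congr fun s => ?_
  rw [← weightedNorm_translate]
  simp

/-- Boundedness upgrades the initial condition from cubes to the weighted norms. -/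
lemma IsEntropySolution.hasTrace {f : Fin d → ℝ → ℝ} {A σ : Fin d → Fin d → ℝ → ℝ}
    {u₀ : Space d → ℝ} {u : ℝ → Space d → ℝ} (h : IsEntropySolution f A σ u₀ u) {B M : ℝ}
    (hu₀ : ∀ᵐ x, |u₀ x| ≤ M) {v : ℝ × Space d → ℝ} (hvB : ∀ p, |v p| ≤ B)
    (hv : ∀ᵐ p ∂(volume.restrict (domain d)), v p = u p.1 p.2) : HasTrace v u₀ := by
  intro L hL z
  have hae := eventually_nhdsGT_inf_ae (ae_domain hv)
  refine tendsto_weightedNorm (B := B + M) (by linarith) (Eventually.of_forall fun s => ?_)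
    (fun R hR => ?_) z
  · filter_upwards [hu₀] with x hx
    exact (abs_sub _ _).trans (add_le_add (hvB _) hx)
  · refine (h.2.2 R hR).congr' ?_
    filter_upwards [hae] with s hs
    refine lintegral_congr_ae ((ae_restrict_of_ae hs).mono fun x hx => ?_)
    simp only [hx]

variable {f : Fin d → ℝ → ℝ} {A σ : Fin d → Fin d → ℝ → ℝ} {B : ℝ}
  {u v : ℝ × Space d → ℝ} {g h : Fin d → ℝ × Space d → ℝ}

lemma IsEntropyPair.measurable_slice (hu : IsEntropyPair f A σ B u g) (t : ℝ) :
    Measurable fun x => u (t, x) := hu.measurable.comp measurable_prodMk_left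

/-- Contraction in the weighted norms, between positive times. -/
theorem weightedNorm_contraction (hadm : IsAdmissible f A σ) (B : ℝ) :
    ∃ C : ℝ, 0 < C ∧ ∀ (u v : ℝ × Space d → ℝ) (g h : Fin d → ℝ × Space d → ℝ),
      IsEntropyPair f A σ B u g → IsEntropyPair f A σ B v h → ∀ L : ℝ, 1 ≤ L → ∀ z : Space d,
      ∃ G : Set ℝ, (∀ᵐ t, t ∈ G) ∧ ∀ s ∈ G, ∀ t ∈ G, 0 < s → s ≤ t →
        weightedNorm L z (fun x => u (t, x) - v (t, x)) ≤ ENNReal.ofReal (Real.exp (C * (t - s))) *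
          weightedNorm L z (fun x => u (s, x) - v (s, x)) := by
  obtain ⟨C, hC, h⟩ := weighted_contraction hadm B
  refine ⟨C, hC, fun u v g k hu hv L hL z => ?_⟩
  obtain ⟨G, hG, hG'⟩ := h u v g k hu hv L hL z
  obtain ⟨G₂, hG₂, hG₂'⟩ := h v u k g hv hu L hL z
  refine ⟨G ∩ G₂, hG.and hG₂, fun s hs t ht hs0 hst => ?_⟩
  have hL0 : 0 < L := by linarith
  have hB : ∀ t x, |u (t, x) - v (t, x)| ≤ B + B := fun t x =>
    (abs_sub _ _).trans (add_le_add (hu.bound _) (hv.bound _))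
  -- `|a - b| = (a - b)⁺ + (b - a)⁺`: the one-sided contraction is used for both orders of the two
  -- solutions.
  have key : ∀ t, weightedNorm L z (fun x => u (t, x) - v (t, x)) =
      ENNReal.ofReal ((∫ x, (max (u (t, x)) (v (t, x)) - v (t, x)) * weight L z x) +
        ∫ x, (max (v (t, x)) (u (t, x)) - u (t, x)) * weight L z x) := by
    intro t
    rw [weightedNorm_eq_ofReal_integral hL0 (g := fun x => u (t, x) - v (t, x))
      ((hu.measurable_slice t).sub (hv.measurable_slice t)).aemeasurable
      (Eventually.of_forall (hB t)), ← integral_add]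
    · congr 1
      refine integral_congr_ae (Eventually.of_forall fun x => ?_)
      simp only
      rw [max_comm (v (t, x)), ← add_mul, ← max_sub_min_eq_abs']
      congr 1
      linarith [max_add_min (u (t, x)) (v (t, x))]
    · exact (integrable_weight hL0 z).bdd_mul (c := 2 * B)
        ((hu.measurable_posPart hv).comp measurable_prodMk_left).aestronglyMeasurable
        (Eventually.of_forall fun x => by
          have := max_sub_bounds (hu.bound (t, x)) (hv.bound (t, x))
          simpa [abs_of_nonneg this.1] using this.2)
    · exact (integrable_weight hL0 z).bdd_mul (c := 2 * B)
        ((hv.measurable_posPart hu).comp measurable_prodMk_left).aestronglyMeasurable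
        (Eventually.of_forall fun x => by
          have := max_sub_bounds (hv.bound (t, x)) (hu.bound (t, x))
          simpa [abs_of_nonneg this.1] using this.2)
  rw [key, key, ← ENNReal.ofReal_mul (Real.exp_pos _).le, mul_add]
  exact ENNReal.ofReal_le_ofReal (add_le_add (hG' s hs.1 t ht.1 hs0 hst) (hG₂' s hs.2 t ht.2 hs0 hst))

end

/-! ### Comparison with the data -/

section
variable {d : ℕ} {f : Fin d → ℝ → ℝ} {A σ : Fin d → Fin d → ℝ → ℝ} {B C : ℝ}
  {u v : ℝ × Space d → ℝ} {g h : Fin d → ℝ × Space d → ℝ} {u₀ v₀ : Space d → ℝ}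

/-- The entropy pairs bounded by `B` contract in all weighted norms, up to the factor `e^{Ct}`. -/
def IsContractionRate (f : Fin d → ℝ → ℝ) (A σ : Fin d → Fin d → ℝ → ℝ) (B C : ℝ) : Prop :=
  ∀ (u v : ℝ × Space d → ℝ) (g h : Fin d → ℝ × Space d → ℝ),
    IsEntropyPair f A σ B u g → IsEntropyPair f A σ B v h → ∀ L : ℝ, 1 ≤ L → ∀ z : Space d,
    ∃ G : Set ℝ, (∀ᵐ t, t ∈ G) ∧ ∀ s ∈ G, ∀ t ∈ G, 0 < s → s ≤ t →
      weightedNorm L z (fun x => u (t, x) - v (t, x)) ≤ ENNReal.ofReal (Real.exp (C * (t - s))) *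
        weightedNorm L z (fun x => u (s, x) - v (s, x))

/-- Start the contraction at a good time `s`, pass to the data by the triangle inequality, and let
`s → 0` along the essential filter. Only the final time is subject to an exceptional null set. -/
lemma IsContractionRate.le_data (hC : IsContractionRate f A σ B C) (hC0 : 0 < C)
    (hu : IsEntropyPair f A σ B u g) (hv : IsEntropyPair f A σ B v h) (hu₀m : AEMeasurable u₀)
    (hv₀m : AEMeasurable v₀) (hu₀ : HasTrace u u₀) (hv₀ : HasTrace v v₀) {L : ℝ} (hL : 1 ≤ L)
    (z : Space d) : ∀ᵐ t, 0 < t →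
      weightedNorm L z (fun x => u (t, x) - v (t, x)) ≤
        ENNReal.ofReal (Real.exp (C * t)) * weightedNorm L z (fun x => u₀ x - v₀ x) := by
  obtain ⟨G, hG, hG'⟩ := hC u v g h hu hv L hL z
  filter_upwards [hG] with t ht ht0
  have := neBot_nhdsGT_inf_ae 0
  have hlim : Tendsto (fun s => ENNReal.ofReal (Real.exp (C * t)) *
      (weightedNorm L z (fun x => u (s, x) - u₀ x) + (weightedNorm L z (fun x => u₀ x - v₀ x) +
        weightedNorm L z (fun x => v (s, x) - v₀ x)))) (𝓝[>] 0 ⊓ ae volume)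
      (𝓝 (ENNReal.ofReal (Real.exp (C * t)) *
        (0 + (weightedNorm L z (fun x => u₀ x - v₀ x) + 0)))) :=
    ENNReal.Tendsto.const_mul ((hu₀ L hL z).add (tendsto_const_nhds.add (hv₀ L hL z)))
      (Or.inr ENNReal.ofReal_ne_top)
  rw [zero_add, add_zero] at hlim
  refine ge_of_tendsto hlim ?_
  filter_upwards [eventually_nhdsGT_inf_ae (hG.mono fun s hs (_ : (0 : ℝ) < s) => hs),
    eventually_nhdsGT_inf_ae_Ioo ht0] with s hs hs0
  refine (hG' s hs t ht hs0.1 hs0.2.le).trans ?_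
  gcongr
  · linarith [hs0.1]
  · refine (weightedNorm_sub_le (hu.measurable_slice s).aemeasurable hu₀m).trans ?_
    gcongr
    refine (weightedNorm_sub_le hu₀m hv₀m).trans ?_
    rw [weightedNorm_sub_comm v₀]

/-- The comparison principle. -/
lemma IsEntropyPair.comparison (hadm : IsAdmissible f A σ) (hu : IsEntropyPair f A σ B u g)
    (hv : IsEntropyPair f A σ B v h) (hu₀m : AEMeasurable u₀) (hu₀ : HasTrace u u₀)
    (hv₀ : HasTrace v v₀) (hle : ∀ᵐ x, u₀ x ≤ v₀ x) :
    ∀ᵐ t, 0 < t → ∀ᵐ x, u (t, x) ≤ v (t, x) := by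
  obtain ⟨C, hC, hcon⟩ := weighted_contraction hadm B
  obtain ⟨G, hG, hG'⟩ := hcon u v g h hu hv 1 le_rfl 0
  filter_upwards [hG] with t ht ht0
  have := neBot_nhdsGT_inf_ae 0
  have hwi : Integrable (weight 1 (0 : Space d)) := integrable_weight one_pos 0
  set m : ℝ → Space d → ℝ := fun s x => max (u (s, x)) (v (s, x)) - v (s, x) with hm
  have hb : ∀ s x, 0 ≤ m s x ∧ m s x ≤ 2 * B := fun s x => max_sub_bounds (hu.bound _) (hv.bound _)
  have hI : ∀ s, Integrable fun x => m s x * weight 1 0 x := fun s =>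
    hwi.bdd_mul (c := 2 * B) ((hu.measurable_posPart hv).comp measurable_prodMk_left).aestronglyMeasurable
      (Eventually.of_forall fun x => by
        rw [Real.norm_of_nonneg (hb s x).1]; exact (hb s x).2)
  have h0 : ∀ s x, 0 ≤ m s x * weight 1 0 x := fun s x =>
    mul_nonneg (hb s x).1 (weight_pos _ _ _).le
  -- Where `u₀ ≤ v₀`, the positive part of `u - v` is at most `|u - u₀| + |v - v₀|`, so it has zero
  -- trace at `t = 0`.
  have hs : ∀ s, ENNReal.ofReal (∫ x, m s x * weight 1 0 x) ≤
      weightedNorm 1 0 (fun x => u (s, x) - u₀ x) + weightedNorm 1 0 (fun x => v (s, x) - v₀ x) := by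
    intro s
    have hmeas : AEMeasurable fun x : Space d =>
        ENNReal.ofReal (weight 1 0 x) * ‖u (s, x) - u₀ x‖ₑ :=
      (measurable_ofReal_weight 1 0).aemeasurable.mul
        ((hu.measurable_slice s).aemeasurable.sub hu₀m).enorm
    unfold weightedNorm
    rw [ofReal_integral_eq_lintegral_ofReal (hI s) (Eventually.of_forall (h0 s)),
      ← lintegral_add_left' hmeas]
    refine lintegral_mono_ae (hle.mono fun x hx => ?_)
    simp only
    rw [← mul_add, mul_comm (m s x), ENNReal.ofReal_mul (weight_pos _ _ _).le]
    gcongr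
    rw [← ofReal_norm, ← ofReal_norm, ← ENNReal.ofReal_add (norm_nonneg _) (norm_nonneg _)]
    refine ENNReal.ofReal_le_ofReal ?_
    simp only [Real.norm_eq_abs, hm]
    have h1 := le_abs_self (u (s, x) - u₀ x)
    have h2 := neg_abs_le (v (s, x) - v₀ x)
    have h3 := abs_nonneg (u (s, x) - u₀ x)
    have h4 := abs_nonneg (v (s, x) - v₀ x)
    rcases max_choice (u (s, x)) (v (s, x)) with h | h <;> rw [h] <;> linarith
  have hlim : Tendsto (fun s => ENNReal.ofReal (Real.exp (C * t)) *
      (weightedNorm 1 0 (fun x => u (s, x) - u₀ x) + weightedNorm 1 0 (fun x => v (s, x) - v₀ x)))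
      (𝓝[>] 0 ⊓ ae volume) (𝓝 (ENNReal.ofReal (Real.exp (C * t)) * (0 + 0))) :=
    ENNReal.Tendsto.const_mul ((hu₀ 1 le_rfl 0).add (hv₀ 1 le_rfl 0)) (Or.inr ENNReal.ofReal_ne_top)
  rw [add_zero, mul_zero] at hlim
  have hle0 : ENNReal.ofReal (∫ x, m t x * weight 1 0 x) ≤ 0 := by
    refine ge_of_tendsto hlim ?_
    filter_upwards [eventually_nhdsGT_inf_ae (hG.mono fun s hs (_ : (0 : ℝ) < s) => hs),
      eventually_nhdsGT_inf_ae_Ioo ht0] with s hsG hs0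
    refine (ENNReal.ofReal_le_ofReal (hG' s hsG t ht hs0.1 hs0.2.le)).trans ?_
    rw [ENNReal.ofReal_mul (Real.exp_pos _).le]
    gcongr
    · linarith [hs0.1]
    · exact hs s
  have hz : ∫ x, m t x * weight 1 0 x = 0 :=
    le_antisymm (ENNReal.ofReal_eq_zero.1 (le_zero_iff.1 hle0)) (integral_nonneg (h0 t))
  filter_upwards [(integral_eq_zero_iff_of_nonneg (h0 t) (hI t)).1 hz] with x hx
  have h1 : m t x = 0 := (mul_eq_zero.1 hx).resolve_right (weight_pos _ _ _).ne'
  exact (le_max_left _ _).trans (sub_eq_zero.1 h1).le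

/-- The maximum principle: an entropy solution obeys the bound of its data, and has a representative
with the same bound. -/
lemma IsEntropySolution.exists_pair_of_data {u : ℝ → Space d → ℝ} (hadm : IsAdmissible f A σ)
    (h : IsEntropySolution f A σ u₀ u) (hu₀m : AEMeasurable u₀) {M : ℝ} (hM : ∀ᵐ x, |u₀ x| ≤ M) :
    ∃ (v : ℝ × Space d → ℝ) (g : Fin d → ℝ × Space d → ℝ), IsEntropyPair f A σ M v g ∧
      (∀ᵐ p ∂(volume.restrict (domain d)), v p = u p.1 p.2) ∧ HasTrace v u₀ := by
  have hM0 : 0 ≤ M := by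
    obtain ⟨x, hx⟩ := hM.exists
    exact (abs_nonneg _).trans hx
  obtain ⟨b, hb⟩ : ∃ b : ℝ, ∀ᵐ p ∂(volume.restrict (domain d)), |u p.1 p.2| ≤ b := by
    refine ⟨(eLpNorm (fun p : ℝ × Space d => u p.1 p.2) ⊤ (volume.restrict (domain d))).toReal, ?_⟩
    filter_upwards [ae_le_eLpNormEssSup (f := fun p : ℝ × Space d => u p.1 p.2)
      (μ := volume.restrict (domain d))] with p hp
    rw [← Real.norm_eq_abs, ← toReal_enorm]
    exact ENNReal.toReal_mono h.1.2.ne (by rwa [eLpNorm_exponent_top])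
  -- A provisional bound that covers the solution and the constants ±M. After the comparison it is
  -- replaced by `M`, so that the contraction rate depends on the data alone.
  set B := max b M
  obtain ⟨v, g, hv, hvu⟩ := h.exists_pair hadm (B := B) (hM0.trans (le_max_right _ _))
    (hb.mono fun p hp => hp.trans (le_max_left _ _))
  have htr : HasTrace v u₀ := h.hasTrace hM hv.bound hvu
  have hMB : |M| ≤ B := by rw [abs_of_nonneg hM0]; exact le_max_right _ _
  have hup := hv.comparison hadm (IsEntropyPair.const hMB) hu₀m htr (HasTrace.const M)
    (hM.mono fun x hx => (abs_le.1 hx).2)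
  have hlow := IsEntropyPair.comparison hadm (IsEntropyPair.const (c := -M) (by rwa [abs_neg])) hv
    aemeasurable_const (HasTrace.const (-M)) htr (hM.mono fun x hx => (abs_le.1 hx).1)
  have hvM : ∀ᵐ p ∂(volume.restrict (domain d)), |u p.1 p.2| ≤ M := by
    have : ∀ᵐ p : ℝ × Space d, p ∈ domain d → |v p| ≤ M := by
      refine (Measure.ae_prod_iff_ae_ae ?_).2 ?_
      · have := measurableSet_le hv.measurable.abs (measurable_const (a := M))
        have h2 : {p : ℝ × Space d | p ∈ domain d → |v p| ≤ M} = (domain d)ᶜ ∪ {p | |v p| ≤ M} := by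
          ext p; simp [imp_iff_not_or]
        rw [h2]
        exact measurableSet_domain.compl.union this
      · filter_upwards [hup, hlow] with t h1 h2
        by_cases ht : 0 < t
        · filter_upwards [h1 ht, h2 ht] with x hx1 hx2 _
          exact abs_le.2 ⟨hx2, hx1⟩
        · exact Eventually.of_forall fun x hx => absurd hx.1 ht
    filter_upwards [(ae_restrict_iff' measurableSet_domain).2 this, hvu] with p h1 h2
    rwa [← h2]
  obtain ⟨v', g', hv', hvu'⟩ := h.exists_pair hadm hM0 hvM
  exact ⟨v', g', hv', hvu', h.hasTrace hM hv'.bound hvu'⟩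

end

/-! ### Continuity in time -/

/-- Extension of a locally uniformly continuous function from a dense subset of `[0, ∞)`. -/
lemma exists_continuousOn_extension {E : Type*} [MetricSpace E] [CompleteSpace E] {U : ℝ → E}
    {A : Set ℝ} (hA : Ici 0 ⊆ closure A)
    (hU : ∀ (T : ℝ) (ε : ℝ≥0∞), 0 < ε → ∃ δ > 0, ∀ s ∈ A, ∀ t ∈ A, s ≤ T → t ≤ T → |s - t| < δ →
      edist (U s) (U t) ≤ ε) :
    ∃ Φ : ℝ → E, ContinuousOn Φ (Ici 0) ∧ ∀ t ∈ A, Φ t = U t := by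
  have hcauchy : ∀ t ∈ Ici (0 : ℝ), ∃ y, Tendsto U (𝓝[A] t) (𝓝 y) := by
    intro t ht
    have : (𝓝[A] t).NeBot := mem_closure_iff_nhdsWithin_neBot.1 (hA ht)
    rw [← cauchy_map_iff_exists_tendsto, EMetric.cauchy_iff]
    refine ⟨(Filter.map_neBot (f := 𝓝[A] t)).ne, fun ε hε => ?_⟩
    obtain ⟨ε', hε', hεε'⟩ := exists_between hε
    obtain ⟨δ, hδ, h⟩ := hU (t + 1) ε' hε'
    refine ⟨U '' (A ∩ Ioo (t - min (δ / 2) 1) (t + min (δ / 2) 1)), image_mem_map ?_, ?_⟩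
    · have : 0 < min (δ / 2) 1 := by positivity
      exact inter_mem self_mem_nhdsWithin (mem_nhdsWithin_of_mem_nhds
        (Ioo_mem_nhds (by linarith) (by linarith)))
    · rintro _ ⟨s, ⟨hs, hs1⟩, rfl⟩ _ ⟨r, ⟨hr, hr1⟩, rfl⟩
      have h1 := min_le_left (δ / 2) 1
      have h2 := min_le_right (δ / 2) 1
      refine (h s hs r hr (by linarith [hs1.2]) (by linarith [hr1.2]) ?_).trans_lt hεε'
      rw [abs_lt]
      constructor <;> linarith [hs1.1, hs1.2, hr1.1, hr1.2]
  refine ⟨extendFrom A U, continuousOn_extendFrom hA hcauchy, fun t ht => ?_⟩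
  refine extendFrom_eq (subset_closure ht) ?_
  rw [EMetric.tendsto_nhds]
  intro ε hε
  obtain ⟨ε', hε', hεε'⟩ := exists_between hε
  obtain ⟨δ, hδ, h⟩ := hU (t + 1) ε' hε'
  have : 0 < min δ 1 := by positivity
  filter_upwards [self_mem_nhdsWithin, mem_nhdsWithin_of_mem_nhds
    (Ioo_mem_nhds (a := t - min δ 1) (b := t + min δ 1) (by linarith) (by linarith))] with s hs hs1
  have h1 := min_le_left δ 1
  have h2 := min_le_right δ 1
  refine (h s hs t ht (by linarith [hs1.2]) (by linarith) ?_).trans_lt hεε'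
  rw [abs_lt]
  constructor <;> linarith [hs1.1, hs1.2]

section
variable {d : ℕ} {f : Fin d → ℝ → ℝ} {A σ : Fin d → Fin d → ℝ → ℝ} {B C : ℝ}
  {u : ℝ × Space d → ℝ} {g : Fin d → ℝ × Space d → ℝ} {u₀ : Space d → ℝ}

lemma ae_comp_add {P : ℝ → Prop} (h : ∀ᵐ t, P t) (a : ℝ) : ∀ᵐ t, P (t + a) :=
  (measurePreserving_add_right volume a).quasiMeasurePreserving.ae h

/-- Equicontinuity in time, for a fixed time shift. -/
lemma IsContractionRate.time_shift (hC : IsContractionRate f A σ B C) (hC0 : 0 < C)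
    (hu : IsEntropyPair f A σ B u g) (hu₀m : AEMeasurable u₀) (hu₀ : HasTrace u u₀) {ε : ℝ≥0∞}
    (hε : 0 < ε) : ∃ δ > 0,
      (∀ᵐ s, s ∈ Ioo 0 δ → weightedNorm 1 0 (fun x => u (s, x) - u₀ x) ≤ ε) ∧
      ∀ h, 0 ≤ h → h < δ → ∀ᵐ t, 0 < t →
        weightedNorm 1 0 (fun x => u (t, x) - u (t + h, x)) ≤ ENNReal.ofReal (Real.exp (C * t)) * ε := by
  have hε2 : 0 < ε / 2 := ENNReal.half_pos hε.ne'
  obtain ⟨b, hb, hb'⟩ := exists_of_eventually_nhdsGT_inf_ae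
    (ENNReal.tendsto_nhds_zero.1 (hu₀ 1 le_rfl 0) _ hε2)
  -- The solution is compared with its own forward shift by `h`. With `s` and `h` below `b / 2`,
  -- both `s` and `s + h` lie in `(0, b)`, where the solution is within `ε / 2` of `u₀` at almost
  -- every time.
  refine ⟨b / 2, half_pos hb, hb'.mono fun s hs hs0 =>
    (hs ⟨hs0.1, hs0.2.trans (half_lt_self hb)⟩).trans ENNReal.half_le_self, fun h h0 hhb => ?_⟩
  obtain ⟨G, hG, hG'⟩ := hC u _ g _ hu (hu.shift (a := (h, 0)) h0) 1 le_rfl 0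
  filter_upwards [hG] with t ht ht0
  have := neBot_nhdsGT_inf_ae 0
  obtain ⟨s, hsG, hs1, hs2, hst, hsb⟩ := ((eventually_nhdsGT_inf_ae
    (hG.mono fun s hs (_ : (0 : ℝ) < s) => hs)).and
    ((eventually_nhdsGT_inf_ae (hb'.mono fun s hs (_ : (0 : ℝ) < s) => hs)).and
    ((eventually_nhdsGT_inf_ae ((ae_comp_add hb' h).mono fun s hs (_ : (0 : ℝ) < s) => hs)).and
    ((eventually_nhdsGT_inf_ae_Ioo ht0).and (eventually_nhdsGT_inf_ae_Ioo (half_pos hb)))))).exists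
  have key := hG' s hsG t ht hst.1 hst.2.le
  simp only [Prod.mk_add_mk, add_zero] at key
  refine key.trans ?_
  gcongr
  · linarith [hst.1]
  · refine (weightedNorm_sub_le (hu.measurable_slice s).aemeasurable hu₀m).trans ?_
    rw [← ENNReal.add_halves ε, weightedNorm_sub_comm u₀]
    exact add_le_add (hs1 ⟨hst.1, by linarith [hsb.2]⟩)
      (hs2 ⟨by linarith [hst.1], by linarith [hsb.2]⟩)

/-- An entropy pair with a trace is locally uniformly continuous, in weighted norm, on a set of times
of full measure. -/
lemma IsContractionRate.exists_uniformContinuous (hC : IsContractionRate f A σ B C) (hC0 : 0 < C)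
    (hu : IsEntropyPair f A σ B u g) (hu₀m : AEMeasurable u₀) (hu₀ : HasTrace u u₀) :
    ∃ G : Set ℝ, (∀ t ∈ G, 0 < t) ∧ (∀ᵐ t, 0 < t → t ∈ G) ∧ ∀ ε : ℝ≥0∞, 0 < ε → ∃ δ > 0,
      (∀ s ∈ G, ∀ t ∈ G, s ≤ t → t < s + δ → weightedNorm 1 0 (fun x => u (s, x) - u (t, x)) ≤
        ENNReal.ofReal (Real.exp (C * t)) * ε) ∧
      ∀ t ∈ G, t < δ → weightedNorm 1 0 (fun x => u₀ x - u (t, x)) ≤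
        ENNReal.ofReal (Real.exp (C * t)) * ε := by
  -- A countable family of tolerances `1 / k`; at `k = 0` the tolerance is `⊤` and the condition is
  -- void.
  have hpos : ∀ k : ℕ, 0 < ((k : ℝ≥0∞))⁻¹ := fun k => ENNReal.inv_pos.2 (ENNReal.natCast_ne_top k)
  choose δ hδ htr hsh using fun k => hC.time_shift hC0 hu hu₀m hu₀ (hpos k)
  refine ⟨{t | 0 < t ∧ ∀ k, ∀ᵐ h, 0 < h → h < δ k →
    weightedNorm 1 0 (fun x => u (t, x) - u (t + h, x)) ≤
      ENNReal.ofReal (Real.exp (C * t)) * ((k : ℝ≥0∞))⁻¹}, fun t ht => ht.1, ?_, fun ε hε => ?_⟩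
  · have h1 : ∀ k, ∀ᵐ t, 0 < t → ∀ᵐ h, 0 < h → h < δ k →
        weightedNorm 1 0 (fun x => u (t, x) - u (t + h, x)) ≤
          ENNReal.ofReal (Real.exp (C * t)) * ((k : ℝ≥0∞))⁻¹ := by
      intro k
      have hm : MeasurableSet {q : ℝ × ℝ | weightedNorm 1 0 (fun x => u (q.1, x) - u (q.1 + q.2, x)) ≤
          ENNReal.ofReal (Real.exp (C * q.1)) * ((k : ℝ≥0∞))⁻¹} := by
        refine measurableSet_le ?_ ?_
        · refine Measurable.lintegral_prod_right' (f := fun q : (ℝ × ℝ) × Space d =>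
            ENNReal.ofReal (weight 1 0 q.2) * ‖u (q.1.1, q.2) - u (q.1.1 + q.1.2, q.2)‖ₑ) ?_
          refine ((measurable_ofReal_weight 1 0).comp measurable_snd).mul (Measurable.enorm ?_)
          exact (hu.measurable.comp (by fun_prop)).sub (hu.measurable.comp (by fun_prop))
        · exact Measurable.mul_const (Measurable.ennreal_ofReal (Continuous.measurable (by fun_prop))) _
      have hm2 : MeasurableSet {q : ℝ × ℝ | 0 < q.1 → 0 < q.2 → q.2 < δ k →
          weightedNorm 1 0 (fun x => u (q.1, x) - u (q.1 + q.2, x)) ≤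
          ENNReal.ofReal (Real.exp (C * q.1)) * ((k : ℝ≥0∞))⁻¹} := by
        refine (measurableSet_lt measurable_const measurable_fst).imp
          ((measurableSet_lt measurable_const measurable_snd).imp
          ((measurableSet_lt measurable_snd measurable_const).imp hm))
      -- In `time_shift` the exceptional set of times depends on the shift `h`. Exchanging the order
      -- of the almost everywhere quantifiers gives one null set of times outside which almost all
      -- shifts are allowed.
      have := (Measure.ae_ae_comm (μ := volume) (ν := volume) (p := fun t h : ℝ => 0 < t → 0 < h → h < δ k →
          weightedNorm 1 0 (fun x => u (t, x) - u (t + h, x)) ≤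
          ENNReal.ofReal (Real.exp (C * t)) * ((k : ℝ≥0∞))⁻¹) hm2).2 (Eventually.of_forall fun h => by
        by_cases hh : 0 < h ∧ h < δ k
        · exact (hsh k h hh.1.le hh.2).mono fun t ht ht0 _ _ => ht ht0
        · exact Eventually.of_forall fun t _ h1 h2 => absurd ⟨h1, h2⟩ hh)
      filter_upwards [this] with t ht ht0
      exact ht.mono fun h hh => hh ht0
    filter_upwards [ae_all_iff.2 h1] with t ht ht0 using ⟨ht0, fun k => ht k ht0⟩
  · obtain ⟨k, hk⟩ := ENNReal.exists_inv_nat_lt (ENNReal.half_pos hε.ne').ne'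
    have := neBot_nhdsGT_inf_ae 0
    refine ⟨δ k, hδ k, fun s hs t ht hst htδ => ?_, fun t ht htδ => ?_⟩
    -- The particular shift `t - s` may be exceptional, so the two times are compared through `t +
    -- h` for a generic small `h`: it is reached from `s` by the shift `h + (t - s)` and from `t` by
    -- `h`, both below `δ k`.
    · have h1 := ae_comp_add (hs.2 k) (t - s)
      obtain ⟨h, ha, hb, hh⟩ := ((eventually_nhdsGT_inf_ae (h1.mono fun s hs (_ : (0 : ℝ) < s) => hs)).and
        ((eventually_nhdsGT_inf_ae ((ht.2 k).mono fun s hs (_ : (0 : ℝ) < s) => hs)).and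
        (eventually_nhdsGT_inf_ae_Ioo (sub_pos.2 htδ)))).exists
      have e : s + (h + (t - s)) = t + h := by ring
      rw [e] at ha
      refine (weightedNorm_sub_le (b := fun x => u (t + h, x)) (hu.measurable_slice s).aemeasurable
        (hu.measurable_slice _).aemeasurable).trans ?_
      rw [weightedNorm_sub_comm (fun x => u (t + h, x)), ← ENNReal.add_halves ε, mul_add]
      refine add_le_add ((ha (by linarith [hh.1]) (by linarith [hh.2])).trans ?_)
        ((hb hh.1 (by linarith [hh.2])).trans ?_)
      · gcongr
      · gcongr
    · have h1 := ae_comp_add (htr k) t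
      obtain ⟨h, ha, hb, hh⟩ := ((eventually_nhdsGT_inf_ae (h1.mono fun s hs (_ : (0 : ℝ) < s) => hs)).and
        ((eventually_nhdsGT_inf_ae ((ht.2 k).mono fun s hs (_ : (0 : ℝ) < s) => hs)).and
        (eventually_nhdsGT_inf_ae_Ioo (sub_pos.2 htδ)))).exists
      rw [add_comm h t] at ha
      refine (weightedNorm_sub_le (b := fun x => u (t + h, x)) hu₀m
        (hu.measurable_slice _).aemeasurable).trans ?_
      rw [weightedNorm_sub_comm (fun x => u (t + h, x)), weightedNorm_sub_comm u₀,
        ← ENNReal.add_halves ε, mul_add]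
      have ht0 := ht.1
      refine add_le_add ((ha ⟨by linarith [hh.1], by linarith [hh.2]⟩).trans (hk.le.trans ?_))
        ((hb hh.1 (by linarith [hh.2])).trans ?_)
      · refine le_mul_of_one_le_left zero_le (ENNReal.one_le_ofReal.2 ?_)
        exact Real.one_le_exp (by positivity)
      · gcongr

end

/-! ### The continuous representative -/

section
variable {d : ℕ} {f : Fin d → ℝ → ℝ} {A σ : Fin d → Fin d → ℝ → ℝ} {B C : ℝ}
  {u : ℝ × Space d → ℝ} {g : Fin d → ℝ × Space d → ℝ} {u₀ : Space d → ℝ}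

/-- The finite measure whose `L¹` norm is the weighted norm. -/
def weightMeasure (d : ℕ) : Measure (Space d) :=
  volume.withDensity fun x => ENNReal.ofReal (weight 1 0 x)

lemma volume_ac_weightMeasure : (volume : Measure (Space d)) ≪ weightMeasure d :=
  withDensity_absolutelyContinuous' (measurable_ofReal_weight 1 0).aemeasurable
    (Eventually.of_forall fun x => (ENNReal.ofReal_pos.2 (weight_pos 1 0 x)).ne')

lemma weightMeasure_ac_volume : weightMeasure d ≪ (volume : Measure (Space d)) :=
  withDensity_absolutelyContinuous _ _

lemma eLpNorm_weightMeasure (g : Space d → ℝ) : eLpNorm g 1 (weightMeasure d) = weightedNorm 1 0 g := by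
  rw [eLpNorm_one_eq_lintegral_enorm, weightMeasure,
    lintegral_withDensity_eq_lintegral_mul_non_measurable _ (measurable_ofReal_weight 1 0)
      (Eventually.of_forall fun x => ENNReal.ofReal_lt_top)]
  rfl

lemma memLp_weightMeasure {g : Space d → ℝ} (hg : AEMeasurable g) (hB : ∀ᵐ x, |g x| ≤ B) :
    MemLp g 1 (weightMeasure d) :=
  ⟨(hg.mono_ac weightMeasure_ac_volume).aestronglyMeasurable, by
    rw [eLpNorm_weightMeasure]
    exact (weightedNorm_ne_top one_pos hB).lt_top⟩

/-- A weighted `L¹` limit of functions bounded by `B` is bounded by `B`. -/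
lemma ae_abs_le_of_tendsto {ι : Type*} {l : Filter ι} [l.NeBot] {F : ι → Space d → ℝ}
    {w : Space d → ℝ} (hw : AEMeasurable w) (hF : ∀ᶠ i in l, ∀ᵐ x, |F i x| ≤ B)
    (h : Tendsto (fun i => weightedNorm 1 0 (fun x => F i x - w x)) l (𝓝 0)) :
    ∀ᵐ x, |w x| ≤ B := by
  -- The excess `(|w| - B)⁺` is at most `|F i - w|` for every `F i` bounded by `B`, hence has norm
  -- zero in the limit.
  have h0 : weightedNorm 1 0 (fun x => max (|w x| - B) 0) = 0 := by
    refine le_antisymm (ge_of_tendsto h ?_) zero_le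
    filter_upwards [hF] with i hi
    refine weightedNorm_mono (hi.mono fun x hx => ?_)
    rw [← ofReal_norm, ← ofReal_norm]
    refine ENNReal.ofReal_le_ofReal ?_
    rw [Real.norm_eq_abs, Real.norm_eq_abs, abs_of_nonneg (le_max_right _ _)]
    refine max_le ?_ (abs_nonneg _)
    have := abs_sub_abs_le_abs_sub (w x) (F i x)
    rw [abs_sub_comm] at this
    linarith
  unfold weightedNorm at h0
  have hm : AEMeasurable fun x => ENNReal.ofReal (weight 1 0 x) * ‖max (|w x| - B) 0‖ₑ :=
    (measurable_ofReal_weight 1 0).aemeasurable.mul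
      ((hw.abs.sub_const B).max aemeasurable_const).enorm
  rw [lintegral_eq_zero_iff' hm] at h0
  filter_upwards [h0] with x hx
  have h1 := (mul_eq_zero.1 hx).resolve_left (ENNReal.ofReal_pos.2 (weight_pos 1 0 x)).ne'
  rw [enorm_eq_zero] at h1
  have := le_max_left (|w x| - B) 0
  linarith

/-- The representative that is continuous in time, with values in `L¹_loc`. -/
theorem IsContractionRate.exists_version (hC : IsContractionRate f A σ B C) (hC0 : 0 < C)
    (hu : IsEntropyPair f A σ B u g) (hu₀m : AEMeasurable u₀) (hu₀B : ∀ᵐ x, |u₀ x| ≤ B)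
    (hu₀ : HasTrace u u₀) :
    ∃ w : ℝ → Space d → ℝ, w 0 = u₀ ∧ (∀ᵐ t, 0 < t → w t = fun x => u (t, x)) ∧
      (∀ t, 0 ≤ t → AEMeasurable (w t) ∧ ∀ᵐ x, |w t x| ≤ B) ∧
      ∀ t, 0 ≤ t → Tendsto (fun s => weightedNorm 1 0 (fun x => w s x - w t x)) (𝓝[Ici 0] t) (𝓝 0) := by
  obtain ⟨G, hG0, hG, hGu⟩ := hC.exists_uniformContinuous hC0 hu hu₀m hu₀
  set V : ℝ → Space d → ℝ := fun t => if t = 0 then u₀ else fun x => u (t, x) with hV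
  have hV0 : V 0 = u₀ := if_pos rfl
  have hVG : ∀ t ∈ G, V t = fun x => u (t, x) := fun t ht => if_neg (hG0 t ht).ne'
  have hVm : ∀ t, AEMeasurable (V t) := fun t => by
    by_cases ht : t = 0
    · rw [ht, hV0]; exact hu₀m
    · simp only [hV, if_neg ht]; exact (hu.measurable_slice t).aemeasurable
  have hVB : ∀ t, ∀ᵐ x, |V t x| ≤ B := fun t => by
    by_cases ht : t = 0
    · rw [ht, hV0]; exact hu₀B
    · simp only [hV, if_neg ht]; exact Eventually.of_forall fun x => hu.bound _
  have hVL : ∀ t, MemLp (V t) 1 (weightMeasure d) := fun t => memLp_weightMeasure (hVm t) (hVB t)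
  set S : Set ℝ := insert 0 G with hS
  have hSpos : ∀ t ∈ S, 0 ≤ t := by
    rintro t (rfl | ht)
    exacts [le_rfl, (hG0 t ht).le]
  have hdense : Ici 0 ⊆ closure S := by
    intro t ht
    rw [mem_closure_iff_frequently]
    have hne := neBot_nhdsGT_inf_ae t
    have h1 : ∀ᶠ s in 𝓝[>] t ⊓ ae volume, s ∈ S :=
      eventually_nhdsGT_inf_ae (hG.mono fun s hs hts => Or.inr (hs (lt_of_le_of_lt ht hts)))
    exact h1.frequently.filter_mono (inf_le_left.trans nhdsWithin_le_nhds)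
  have hunif : ∀ (T : ℝ) (ε : ℝ≥0∞), 0 < ε → ∃ δ > 0, ∀ s ∈ S, ∀ t ∈ S, s ≤ T → t ≤ T →
      |s - t| < δ → edist ((hVL s).toLp (V s)) ((hVL t).toLp (V t)) ≤ ε := by
    intro T ε hε
    have he : 0 < ENNReal.ofReal (Real.exp (C * T)) := ENNReal.ofReal_pos.2 (Real.exp_pos _)
    obtain ⟨δ, hδ, h1, h2⟩ := hGu (ε / ENNReal.ofReal (Real.exp (C * T)))
      (ENNReal.div_pos hε.ne' ENNReal.ofReal_ne_top)
    have hle : ∀ t ≤ T, ENNReal.ofReal (Real.exp (C * t)) * (ε / ENNReal.ofReal (Real.exp (C * T))) ≤ ε := by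
      intro t ht
      calc _ ≤ ENNReal.ofReal (Real.exp (C * T)) * (ε / ENNReal.ofReal (Real.exp (C * T))) := by
            gcongr
        _ ≤ ε := ENNReal.mul_div_le
    have main : ∀ s ∈ S, ∀ t ∈ S, s ≤ t → t ≤ T → |s - t| < δ →
        edist ((hVL s).toLp (V s)) ((hVL t).toLp (V t)) ≤ ε := by
      intro s hs t ht hst htT hd
      rw [Lp.edist_toLp_toLp, eLpNorm_weightMeasure]
      rw [abs_lt] at hd
      rcases ht with rfl | ht
      · have hs0 := le_antisymm hst (hSpos s hs)
        subst hs0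
        simp [weightedNorm]
      · refine le_trans ?_ (hle t htT)
        rcases hs with rfl | hs
        · have := h2 t ht (by linarith)
          rwa [hV0, hVG t ht]
        · have := h1 s hs t ht hst (by linarith)
          rwa [hVG s hs, hVG t ht]
    refine ⟨δ, hδ, fun s hs t ht hsT htT hd => ?_⟩
    rcases le_total s t with hst | hst
    · exact main s hs t ht hst htT hd
    · rw [edist_comm]
      exact main t ht s hs hst hsT (by rwa [abs_sub_comm])
  obtain ⟨Φ, hΦc, hΦ⟩ := exists_continuousOn_extension hdense hunif
  classical
  -- On `S` the original functions are kept instead of representatives of L¹ classes, so that `w 0 =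
  -- u₀` and `w t = u(t, ·)` are genuine equalities; elsewhere the limit in the complete space L¹ of
  -- the weight is used.
  set w : ℝ → Space d → ℝ := fun t => if t ∈ S then V t else Φ t with hw
  have hwS : ∀ t ∈ S, w t = V t := fun t ht => if_pos ht
  have hwΦ : ∀ t, w t =ᵐ[weightMeasure d] Φ t := by
    intro t
    by_cases ht : t ∈ S
    · rw [hwS t ht, hΦ t ht]
      exact (hVL t).coeFn_toLp.symm
    · simp only [hw, if_neg ht]
      exact EventuallyEq.rfl
  have hdist : ∀ s t, weightedNorm 1 0 (fun x => w s x - w t x) = edist (Φ s) (Φ t) := by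
    intro s t
    rw [Lp.edist_def, ← eLpNorm_weightMeasure]
    exact eLpNorm_congr_ae ((hwΦ s).sub (hwΦ t))
  have hlim : ∀ t, 0 ≤ t →
      Tendsto (fun s => weightedNorm 1 0 (fun x => w s x - w t x)) (𝓝[Ici 0] t) (𝓝 0) := by
    intro t ht
    simp only [hdist]
    exact tendsto_iff_edist_tendsto_0.1 (hΦc t ht)
  have hwm : ∀ t, AEMeasurable (w t) := fun t =>
    ((Lp.aestronglyMeasurable (Φ t)).aemeasurable.congr (hwΦ t).symm).mono_ac volume_ac_weightMeasure
  refine ⟨w, by rw [hwS 0 (mem_insert _ _), hV0], ?_, fun t ht => ⟨hwm t, ?_⟩, hlim⟩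
  · filter_upwards [hG] with t ht ht0
    rw [hwS t (Or.inr (ht ht0)), hVG t (ht ht0)]
  · have : (𝓝[S] t).NeBot := mem_closure_iff_nhdsWithin_neBot.1 (hdense ht)
    refine ae_abs_le_of_tendsto (l := 𝓝[S] t) (F := w) (hwm t) ?_
      ((hlim t ht).mono_left (nhdsWithin_mono t hSpos))
    filter_upwards [self_mem_nhdsWithin] with s hs
    rw [hwS s hs]
    exact hVB s

/-- Entropy solutions with bounded data: continuous representative, and continuity of spatial
translations. -/
theorem exists_continuousVersion (hadm : IsAdmissible f A σ) (M : ℝ) :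
    ∃ C : ℝ, 0 < C ∧ ∀ (u₀ : Space d → ℝ) (u : ℝ → Space d → ℝ), AEMeasurable u₀ →
      (∀ᵐ x, |u₀ x| ≤ M) → IsEntropySolution f A σ u₀ u → ∃ w : ℝ → Space d → ℝ,
        IsContinuousVersion u₀ u w ∧ (∀ t, 0 ≤ t → AEMeasurable (w t) ∧ ∀ᵐ x, |w t x| ≤ M) ∧
        ∀ t, 0 ≤ t → ∀ (τ : Space d) (L : ℝ), 1 ≤ L → ∀ z : Space d,
          weightedNorm L z (fun x => w t (x + τ) - w t x) ≤
            ENNReal.ofReal (Real.exp (C * t)) * weightedNorm L z (fun x => u₀ (x + τ) - u₀ x) := by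
  obtain ⟨C, hC0, hC⟩ := weightedNorm_contraction hadm M
  refine ⟨C, hC0, fun u₀ u hm hM h => ?_⟩
  obtain ⟨v, g, hv, hvu, htr⟩ := h.exists_pair_of_data hadm hm hM
  obtain ⟨w, hw0, hwv, hwB, hwc⟩ := IsContractionRate.exists_version hC hC0 hv hm hM htr
  refine ⟨w, ⟨?_, hw0, fun t ht => ?_, fun R hR t ht => ?_⟩, hwB, fun t ht τ L hL z => ?_⟩
  · have h1 : ∀ᵐ p : ℝ × Space d, 0 < p.1 → w p.1 = fun x => v (p.1, x) :=
      Measure.quasiMeasurePreserving_fst.ae hwv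
    filter_upwards [hvu, ae_restrict_of_ae h1, ae_restrict_mem measurableSet_domain] with p a b c
    rw [b c.1, ← a]
  · rw [locallyIntegrable_iff]
    intro K hK
    exact Measure.integrableOn_of_bounded hK.measure_lt_top.ne (hwB t ht).1.aestronglyMeasurable
      (ae_restrict_of_ae (hwB t ht).2)
  · obtain ⟨c, hc, hcR⟩ := exists_setLIntegral_cube_le (d := d) R
    have := ENNReal.Tendsto.const_mul (a := c) (hwc t ht) (Or.inr hc)
    rw [mul_zero] at this
    exact tendsto_of_tendsto_of_tendsto_of_le_of_le tendsto_const_nhds this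
      (fun _ => zero_le) fun s => hcR _
  -- A spatial translate is again a solution, with translated data. The estimate holds at almost
  -- every time; it extends to `t` by letting good times `s` decrease to `t`, using continuity in
  -- the norm of `weight 1 0`, which dominates the weights centered at `z` and `z + τ`.
  · have hshift := IsContractionRate.le_data hC hC0 (hv.shift (a := (0, τ)) le_rfl) hv
      (hm.comp_quasiMeasurePreserving (measurePreserving_add_right volume τ).quasiMeasurePreserving)
      hm (htr.shift τ) htr hL z
    obtain ⟨c, hc, hcL⟩ := exists_weightedNorm_le (L := L) (by linarith) z
    obtain ⟨c', hc', hcL'⟩ := exists_weightedNorm_le (L := L) (by linarith) (z + τ)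
    have hne := neBot_nhdsGT_inf_ae t
    have hl : 𝓝[>] t ⊓ ae volume ≤ 𝓝[Ici 0] t :=
      inf_le_left.trans (nhdsWithin_mono t fun s hs => ht.trans (le_of_lt hs))
    have hws : Tendsto (fun s => weightedNorm 1 0 (fun x => w s x - w t x)) (𝓝[>] t ⊓ ae volume) (𝓝 0) :=
      (hwc t ht).mono_left hl
    have hexp : Tendsto (fun s => ENNReal.ofReal (Real.exp (C * s))) (𝓝[>] t ⊓ ae volume)
        (𝓝 (ENNReal.ofReal (Real.exp (C * t)))) :=
      (ENNReal.continuous_ofReal.comp (by fun_prop : Continuous fun s => Real.exp (C * s))).continuousAt.tendsto.mono_left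
        (inf_le_left.trans nhdsWithin_le_nhds)
    have hD : weightedNorm L z (fun x => u₀ (x + τ) - u₀ x) ≠ ⊤ := by
      refine weightedNorm_ne_top (B := M + M) (by linarith) ?_
      filter_upwards [hM, (measurePreserving_add_right volume τ).quasiMeasurePreserving.ae hM] with x h1 h2
      exact (abs_sub _ _).trans (add_le_add h2 h1)
    have hlim : Tendsto (fun s => c' * weightedNorm 1 0 (fun x => w s x - w t x) +
        (ENNReal.ofReal (Real.exp (C * s)) * weightedNorm L z (fun x => u₀ (x + τ) - u₀ x) +
          c * weightedNorm 1 0 (fun x => w s x - w t x))) (𝓝[>] t ⊓ ae volume)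
        (𝓝 (c' * 0 + (ENNReal.ofReal (Real.exp (C * t)) *
          weightedNorm L z (fun x => u₀ (x + τ) - u₀ x) + c * 0))) :=
      (ENNReal.Tendsto.const_mul hws (Or.inr hc')).add
        ((ENNReal.Tendsto.mul_const hexp (Or.inr hD)).add (ENNReal.Tendsto.const_mul hws (Or.inr hc)))
    rw [mul_zero, mul_zero, zero_add, add_zero] at hlim
    refine ge_of_tendsto hlim ?_
    have e1 : ∀ᵐ s : ℝ, t < s → 0 < s → _ := hshift.mono fun s hs _ => hs
    filter_upwards [eventually_nhdsGT_inf_ae e1,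
      eventually_nhdsGT_inf_ae (hwv.mono fun s hs (_ : t < s) => hs),
      eventually_nhdsGT_inf_ae (Eventually.of_forall fun s (hs : t < s) => lt_of_le_of_lt ht hs)]
      with s h1 h2 h3
    have h1 := h1 h3
    have h2 := h2 h3
    have hq := (measurePreserving_add_right volume τ).quasiMeasurePreserving
    have mt : AEMeasurable fun x => w t (x + τ) := (hwB t ht).1.comp_quasiMeasurePreserving hq
    have ms : AEMeasurable fun x => w s (x + τ) := (hwB s h3.le).1.comp_quasiMeasurePreserving hq
    refine (weightedNorm_sub_le mt ms).trans (add_le_add ?_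
      ((weightedNorm_sub_le ms (hwB s h3.le).1).trans (add_le_add ?_ (hcL _))))
    · rw [weightedNorm_sub_comm (fun x => w t (x + τ))]
      exact (weightedNorm_translate (fun x => w s x - w t x) τ).le.trans (hcL' _)
    · simpa [h2] using h1

end

/-! ### Trigonometric polynomials -/

section
variable {d : ℕ}

/-- The character `x ↦ e^{2πi l·x}`. -/
def expChar (l x : Space d) : ℂ :=
  Complex.exp (2 * Real.pi * Complex.I * ((∑ i, l i * x i : ℝ) : ℂ))

lemma expChar_add (l x y : Space d) : expChar l (x + y) = expChar l x * expChar l y := by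
  unfold expChar
  rw [← Complex.exp_add, ← mul_add, ← Complex.ofReal_add, ← Finset.sum_add_distrib]
  simp [mul_add]

lemma expChar_add_left (l m x : Space d) : expChar (l + m) x = expChar l x * expChar m x := by
  unfold expChar
  rw [← Complex.exp_add, ← mul_add, ← Complex.ofReal_add, ← Finset.sum_add_distrib]
  simp [add_mul]

lemma expChar_zero_left (x : Space d) : expChar 0 x = 1 := by simp [expChar]

lemma expChar_zero (l : Space d) : expChar l 0 = 1 := by simp [expChar]

lemma norm_expChar (l x : Space d) : ‖expChar l x‖ = 1 := by
  unfold expChar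
  have : 2 * Real.pi * Complex.I * ((∑ i, l i * x i : ℝ) : ℂ) =
      ((2 * Real.pi * ∑ i, l i * x i : ℝ) : ℂ) * Complex.I := by push_cast; ring
  rw [this, Complex.norm_exp_ofReal_mul_I]

lemma expChar_neg_mul (l x : Space d) : expChar (-l) x * expChar l x = 1 := by
  rw [← expChar_add_left, neg_add_cancel, expChar_zero_left]

lemma expChar_neg (l x : Space d) : expChar (-l) x = starRingEnd ℂ (expChar l x) := by
  have h := norm_expChar l x
  have h2 : starRingEnd ℂ (expChar l x) * expChar l x = 1 := by
    rw [mul_comm, Complex.mul_conj, Complex.normSq_eq_norm_sq, h]; simp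
  exact mul_right_cancel₀ (by rw [← norm_ne_zero_iff, h]; exact one_ne_zero)
    ((expChar_neg_mul l x).trans h2.symm)

lemma continuous_expChar (l : Space d) : Continuous (expChar l) := by
  unfold expChar
  fun_prop

/-- The space of trigonometric polynomials. -/
def trigPolys (d : ℕ) : Submodule ℂ (Space d → ℂ) := Submodule.span ℂ (range expChar)

lemma expChar_mem_trigPolys (l : Space d) : expChar l ∈ trigPolys d :=
  Submodule.subset_span (mem_range_self l)

lemma isTrigPoly_iff {P : Space d → ℂ} : IsTrigPoly P ↔ P ∈ trigPolys d := by
  constructor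
  · rintro ⟨Λ, a, h⟩
    have : P = ∑ l ∈ Λ, a l • expChar l := by
      ext x
      rw [h, Finset.sum_apply]
      rfl
    rw [this]
    exact Submodule.sum_mem _ fun l _ => Submodule.smul_mem _ _ (expChar_mem_trigPolys l)
  · intro h
    obtain ⟨c, rfl⟩ := Finsupp.mem_span_range_iff_exists_finsupp.1 h
    refine ⟨c.support, c, fun x => ?_⟩
    rw [Finsupp.sum, Finset.sum_apply]
    rfl

lemma one_mem_trigPolys : (fun _ => 1 : Space d → ℂ) ∈ trigPolys d := by
  convert expChar_mem_trigPolys (0 : Space d) using 1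
  ext x
  rw [expChar_zero_left]

lemma mul_mem_trigPolys {P Q : Space d → ℂ} (hP : P ∈ trigPolys d) (hQ : Q ∈ trigPolys d) :
    P * Q ∈ trigPolys d := by
  refine Submodule.span_induction₂ (p := fun P Q _ _ => P * Q ∈ trigPolys d) ?_ ?_ ?_ ?_ ?_ ?_ ?_ hP hQ
  · rintro _ _ ⟨l, rfl⟩ ⟨m, rfl⟩
    have : expChar l * expChar m = expChar (l + m) := by
      ext x; rw [expChar_add_left]; rfl
    rw [this]
    exact expChar_mem_trigPolys _
  · intro y _; rw [zero_mul]; exact Submodule.zero_mem _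
  · intro y _; rw [mul_zero]; exact Submodule.zero_mem _
  · intro x y z _ _ _ h1 h2; rw [add_mul]; exact Submodule.add_mem _ h1 h2
  · intro x y z _ _ _ h1 h2; rw [mul_add]; exact Submodule.add_mem _ h1 h2
  · intro r x y _ _ h; rw [smul_mul_assoc]; exact Submodule.smul_mem _ _ h
  · intro r x y _ _ h; rw [mul_smul_comm]; exact Submodule.smul_mem _ _ h

lemma pow_mem_trigPolys {P : Space d → ℂ} (hP : P ∈ trigPolys d) (n : ℕ) : P ^ n ∈ trigPolys d := by
  induction n with
  | zero => rw [pow_zero]; exact one_mem_trigPolys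
  | succ n ih => rw [pow_succ]; exact mul_mem_trigPolys ih hP

lemma prod_mem_trigPolys {ι : Type*} (s : Finset ι) {P : ι → Space d → ℂ}
    (hP : ∀ i ∈ s, P i ∈ trigPolys d) : ∏ i ∈ s, P i ∈ trigPolys d := by
  classical
  induction s using Finset.induction_on with
  | empty => rw [Finset.prod_empty]; exact one_mem_trigPolys
  | insert i s hi ih =>
    rw [Finset.prod_insert hi]
    exact mul_mem_trigPolys (hP i (Finset.mem_insert_self _ _))
      (ih fun j hj => hP j (Finset.mem_insert_of_mem hj))

/-- The translation modulus of a trigonometric polynomial is controlled by its frequencies. -/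
lemma IsTrigPoly.exists_modulus {P : Space d → ℂ} (hP : IsTrigPoly P) :
    Continuous P ∧ (∃ b, 0 ≤ b ∧ ∀ x, ‖P x‖ ≤ b) ∧ ∃ (Λ : Finset (Space d)) (a : Space d → ℝ),
      (∀ l, 0 ≤ a l) ∧ ∀ x τ, ‖P (x + τ) - P x‖ ≤ ∑ l ∈ Λ, a l * ‖expChar l τ - 1‖ := by
  obtain ⟨Λ, a, h⟩ := hP
  have hP : P = fun x => ∑ l ∈ Λ, a l * expChar l x := funext h
  refine ⟨?_, ⟨∑ l ∈ Λ, ‖a l‖, by positivity, fun x => ?_⟩, Λ, fun l => ‖a l‖,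
    fun l => norm_nonneg _, fun x τ => ?_⟩
  · rw [hP]
    exact continuous_finsetSum _ fun l _ => continuous_const.mul (continuous_expChar l)
  · rw [hP]
    refine (norm_sum_le _ _).trans (Finset.sum_le_sum fun l _ => ?_)
    rw [norm_mul, norm_expChar, mul_one]
  · rw [hP]
    simp only [expChar_add]
    rw [← Finset.sum_sub_distrib]
    refine (norm_sum_le _ _).trans (Finset.sum_le_sum fun l _ => ?_)
    have : a l * (expChar l x * expChar l τ) - a l * expChar l x =
        a l * expChar l x * (expChar l τ - 1) := by ring
    rw [this, norm_mul, norm_mul, norm_expChar, mul_one]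

/-- Common almost periods of finitely many characters: finitely many translates of the set of almost
periods cover the space. -/
lemma exists_finset_translates (Λ : Finset (Space d)) {η : ℝ} (hη : 0 < η) :
    ∃ T : Finset (Space d), ∀ x, ∃ s ∈ T, ∀ l ∈ Λ, ‖expChar l (x - s) - 1‖ ≤ η := by
  -- Finitely many characters map the space into a bounded subset of a finite-dimensional space, so
  -- a finite net of image points exists. Multiplicativity gives `|e(x - s) - 1| = |e(x) - e(s)|`.
  set Θ : Space d → (Λ → ℂ) := fun x l => expChar (l : Space d) x with hΘ
  have hb : range Θ ⊆ Metric.closedBall 0 1 := by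
    rintro _ ⟨x, rfl⟩
    rw [mem_closedBall_zero_iff, pi_norm_le_iff_of_nonneg zero_le_one]
    exact fun l => (norm_expChar _ _).le
  have htb : TotallyBounded (range Θ) :=
    (isCompact_closedBall (0 : Λ → ℂ) 1).totallyBounded.subset hb
  obtain ⟨S, hSr, hSf, hS⟩ := totallyBounded_iff_subset.1 htb _ (Metric.dist_mem_uniformity hη)
  choose! y hy using fun z (hz : z ∈ S) => hSr hz
  classical
  refine ⟨hSf.toFinset.image y, fun x => ?_⟩
  obtain ⟨z, hz, hxz⟩ := mem_iUnion₂.1 (hS (mem_range_self x))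
  refine ⟨y z, Finset.mem_image_of_mem _ (hSf.mem_toFinset.2 hz), fun l hl => ?_⟩
  have h1 : dist (Θ x) (Θ (y z)) < η := by rw [hy z hz]; exact hxz
  have h2 := (dist_le_pi_dist (Θ x) (Θ (y z)) ⟨l, hl⟩).trans h1.le
  rw [dist_eq_norm] at h2
  have e : expChar l (x - y z) - 1 = expChar l (-(y z)) * (expChar l x - expChar l (y z)) := by
    rw [mul_sub, ← expChar_add, ← expChar_add, neg_add_cancel, expChar_zero, neg_add_eq_sub]
  rw [e, norm_mul, norm_expChar, one_mul]
  exact h2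

/-- Every point is at bounded distance from a common almost period. -/
lemma exists_relativelyDense (Λ : Finset (Space d)) {η : ℝ} (hη : 0 < η) :
    ∃ r : ℝ, 0 < r ∧ ∀ x, ∃ τ, ‖τ - x‖ ≤ r ∧ ∀ l ∈ Λ, ‖expChar l τ - 1‖ ≤ η := by
  obtain ⟨T, hT⟩ := exists_finset_translates Λ hη
  refine ⟨1 + ∑ s ∈ T, ‖s‖, by positivity, fun x => ?_⟩
  obtain ⟨s, hs, h⟩ := hT x
  refine ⟨x - s, ?_, h⟩
  rw [sub_sub_cancel_left, norm_neg]
  have := Finset.single_le_sum (f := fun s => ‖s‖) (fun i _ => norm_nonneg _) hs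
  linarith

end

/-! ### Kernels concentrated at common almost periods -/

section
variable {d : ℕ}

/-- On the unit circle `|z - 1|² = 2 - 2 Re z`. The factors of the kernel thus measure the distance
from an almost period. -/
lemma norm_expChar_sub_one_sq (l τ : Space d) :
    (1 + (expChar l τ).re) / 2 = 1 - ‖expChar l τ - 1‖ ^ 2 / 4 := by
  have h1 : Complex.normSq (expChar l τ) = 1 := by rw [Complex.normSq_eq_norm_sq, norm_expChar]; simp
  rw [← Complex.normSq_eq_norm_sq]
  rw [Complex.normSq_apply] at h1 ⊢
  simp only [Complex.sub_re, Complex.sub_im, Complex.one_re, Complex.one_im]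
  nlinarith

/-- The nonnegative trigonometric polynomial `∏_λ ((1 + cos(2π λ·τ)) / 2)`. -/
def cosKernel (Λ : Finset (Space d)) (τ : Space d) : ℝ := ∏ l ∈ Λ, (1 + (expChar l τ).re) / 2

variable {Λ : Finset (Space d)}

lemma cosFactor_mem (l τ : Space d) : 0 ≤ (1 + (expChar l τ).re) / 2 ∧ (1 + (expChar l τ).re) / 2 ≤ 1 := by
  have h := Complex.abs_re_le_norm (expChar l τ)
  rw [norm_expChar, abs_le] at h
  constructor <;> linarith [h.1, h.2]

lemma cosKernel_nonneg (Λ : Finset (Space d)) (τ : Space d) : 0 ≤ cosKernel Λ τ :=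
  Finset.prod_nonneg fun l _ => (cosFactor_mem l τ).1

lemma cosKernel_le_one (Λ : Finset (Space d)) (τ : Space d) : cosKernel Λ τ ≤ 1 :=
  Finset.prod_le_one (fun l _ => (cosFactor_mem l τ).1) fun l _ => (cosFactor_mem l τ).2

/-- All factors lie in `[0, 1]`, so the product is at most any one of them: a single bad frequency
keeps the kernel away from 1. -/
lemma cosKernel_le {l : Space d} (hl : l ∈ Λ) (τ : Space d) :
    cosKernel Λ τ ≤ 1 - ‖expChar l τ - 1‖ ^ 2 / 4 := by
  classical
  rw [← norm_expChar_sub_one_sq, cosKernel, ← Finset.mul_prod_erase Λ _ hl]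
  exact mul_le_of_le_one_right (cosFactor_mem l τ).1
    (Finset.prod_le_one (fun l _ => (cosFactor_mem l τ).1) fun l _ => (cosFactor_mem l τ).2)

lemma continuous_cosKernel (Λ : Finset (Space d)) : Continuous (cosKernel Λ) :=
  continuous_finsetProd _ fun l _ =>
    (continuous_const.add (Complex.continuous_re.comp (continuous_expChar l))).div_const 2

/-- Each factor is `1/2 + (e_l + e_{-l})/4`, and trigonometric polynomials form an algebra. This is
what makes the averages of translates trigonometric polynomials in the limit. -/
lemma cosKernel_pow_mem_trigPolys (Λ : Finset (Space d)) (N : ℕ) :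
    (fun τ => ((cosKernel Λ τ ^ N : ℝ) : ℂ)) ∈ trigPolys d := by
  have h : ∀ l : Space d, (fun τ => (((1 + (expChar l τ).re) / 2 : ℝ) : ℂ)) ∈ trigPolys d := by
    intro l
    have : (fun τ => (((1 + (expChar l τ).re) / 2 : ℝ) : ℂ)) =
        (1 / 2 : ℂ) • (fun _ => 1 : Space d → ℂ) + (1 / 4 : ℂ) • (expChar l + expChar (-l)) := by
      ext τ
      simp only [Pi.add_apply, Pi.smul_apply, smul_eq_mul, expChar_neg, Complex.add_conj]
      push_cast
      ring
    rw [this]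
    exact Submodule.add_mem _ (Submodule.smul_mem _ _ one_mem_trigPolys) (Submodule.smul_mem _ _
      (Submodule.add_mem _ (expChar_mem_trigPolys _) (expChar_mem_trigPolys _)))
  have h2 := pow_mem_trigPolys (prod_mem_trigPolys Λ fun l _ => h l) N
  convert h2 using 1
  ext τ
  simp [cosKernel, Finset.prod_apply]

/-- The kernel is close to one at common almost periods. -/
lemma exists_le_cosKernel (Λ : Finset (Space d)) {η : ℝ} (hη : 0 < η) :
    ∃ η' > 0, ∀ τ, (∀ l ∈ Λ, ‖expChar l τ - 1‖ ≤ η') → 1 - η ≤ cosKernel Λ τ := by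
  refine ⟨min 1 (η / (Λ.card + 1)), by positivity, fun τ hτ => ?_⟩
  set η' := min 1 (η / ((Λ.card : ℝ) + 1)) with hη'
  have h1 : η' ≤ 1 := min_le_left _ _
  have h0 : 0 < η' := by positivity
  have h2 : η' * (Λ.card + 1) ≤ η := by
    rw [← le_div_iff₀ (by positivity)]
    exact min_le_right _ _
  have h3 : (1 - η' ^ 2 / 4) ^ Λ.card ≤ cosKernel Λ τ := by
    rw [cosKernel, ← Finset.prod_const]
    refine Finset.prod_le_prod (fun l _ => by nlinarith) fun l hl => ?_
    rw [norm_expChar_sub_one_sq]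
    have := pow_le_pow_left₀ (norm_nonneg _) (hτ l hl) 2
    linarith
  have h4 := one_add_mul_le_pow (a := -(η' ^ 2 / 4)) (by nlinarith) Λ.card
  have h5 : (Λ.card : ℝ) * (η' ^ 2 / 4) ≤ η := by
    have : (0 : ℝ) ≤ Λ.card := Nat.cast_nonneg _
    have : η' ^ 2 / 4 ≤ η' := by nlinarith
    nlinarith
  rw [← sub_eq_add_neg] at h4
  linarith

/-- Common almost periods have positive lower density. -/
lemma exists_density (Λ : Finset (Space d)) {η : ℝ} (hη : 0 < η) :
    ∃ β > 0, ∃ R₀ > 0, ∀ R ≥ R₀, β * R ^ d ≤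
      volume.real ({τ | ∀ l ∈ Λ, ‖expChar l τ - 1‖ ≤ η} ∩ cube R (0 : Space d)) := by
  obtain ⟨T, hT⟩ := exists_finset_translates Λ hη
  set P : Set (Space d) := {τ | ∀ l ∈ Λ, ‖expChar l τ - 1‖ ≤ η} with hP
  set r : ℝ := 1 + 2 * ∑ s ∈ T, ‖s‖ with hr
  have hr0 : 0 < r := by positivity
  -- The translates of the almost periods in `I_R` by the points of `T` cover `I_{R - r}`, and `R -
  -- r ≥ R / 2`; the `+ 1` avoids a zero denominator.
  refine ⟨(1 / 2) ^ d / (T.card + 1), by positivity, 2 * r, by positivity, fun R hR => ?_⟩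
  have hR0 : 0 < R := by linarith
  have hfin : volume (P ∩ cube R (0 : Space d)) ≠ ⊤ :=
    measure_ne_top_of_subset inter_subset_right (by
      rw [volume_cube hR0.le]; exact ENNReal.ofReal_ne_top)
  have hcov : cube (R - r) (0 : Space d) ⊆ ⋃ s ∈ T, (fun x => x + -s) ⁻¹' (P ∩ cube R 0) := by
    intro x hx
    obtain ⟨s, hs, h⟩ := hT x
    refine mem_iUnion₂.2 ⟨s, hs, ?_, ?_⟩
    · simpa [hP, sub_eq_add_neg] using h
    · rw [cube, mem_closedBall_zero_iff] at hx ⊢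
      have h1 := Finset.single_le_sum (f := fun s => ‖s‖) (fun i _ => norm_nonneg _) hs
      have h2 := norm_add_le x (-s)
      rw [norm_neg] at h2
      change ‖x + -s‖ ≤ R / 2
      linarith
  have h1 : volume (cube (R - r) (0 : Space d)) ≤ T.card * volume (P ∩ cube R (0 : Space d)) := by
    refine (measure_mono hcov).trans ((measure_biUnion_finset_le _ _).trans ?_)
    simp only [measure_preimage_add_right]
    rw [Finset.sum_const, nsmul_eq_mul]
  rw [volume_cube (by linarith)] at h1
  have h2 := ENNReal.toReal_mono (ENNReal.mul_ne_top (ENNReal.natCast_ne_top _) hfin) h1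
  rw [ENNReal.toReal_ofReal (pow_nonneg (by linarith) _), ENNReal.toReal_mul,
    ENNReal.toReal_natCast] at h2
  have h3 : (1 / 2) ^ d * R ^ d ≤ (R - r) ^ d := by
    rw [← mul_pow]
    exact pow_le_pow_left₀ (by positivity) (by linarith) d
  rw [div_mul_eq_mul_div, div_le_iff₀ (by positivity)]
  have h4 : (0 : ℝ) ≤ volume.real (P ∩ cube R (0 : Space d)) := measureReal_nonneg
  change (R - r) ^ d ≤ (T.card : ℝ) * volume.real (P ∩ cube R (0 : Space d)) at h2
  linarith

lemma integrableOn_cube {h : Space d → ℝ} (hh : Continuous h) (R : ℝ) (x : Space d) :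
    IntegrableOn h (cube R x) :=
  hh.continuousOn.integrableOn_compact (isCompact_closedBall x _)

lemma volumeReal_cube {R : ℝ} (hR : 0 ≤ R) (x : Space d) : volume.real (cube R x) = R ^ d := by
  rw [Measure.real, volume_cube hR, ENNReal.toReal_ofReal (by positivity)]

/-- High powers of the kernel concentrate at common almost periods, in the mean. -/
lemma exists_kernel_power (Λ : Finset (Space d)) {δ : ℝ} (hδ : 0 < δ) :
    ∃ N : ℕ, ∃ κ > 0, ∃ R₀ > 0, ∀ R ≥ R₀,
      κ * R ^ d ≤ ∫ τ in cube R 0, cosKernel Λ τ ^ N ∧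
      ∀ l ∈ Λ, ∫ τ in cube R 0, cosKernel Λ τ ^ N * ‖expChar l τ - 1‖ ≤
        δ * ∫ τ in cube R 0, cosKernel Λ τ ^ N := by
  -- Where `|e - 1| ≤ θ` the integrand is at most `θ k^N`. Elsewhere `k ≤ 1 - θ²/4`, whereas `k ≥ 1
  -- - θ²/8` on a set of density `β`. A large `N` makes the ratio of the N-th powers smaller than `θ
  -- β / 2`, so the bad part costs another `θ ∫ k^N`, and `2 θ ≤ δ`.
  set θ : ℝ := min δ 1 / 2 with hθ
  have hθ0 : 0 < θ := by positivity
  have hθδ : 2 * θ ≤ δ := by rw [hθ]; linarith [min_le_left δ 1]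
  have hθ1 : θ ≤ 1 / 2 := by rw [hθ]; linarith [min_le_right δ 1]
  have ha0 : 0 < 1 - θ ^ 2 / 4 := by nlinarith
  have hb0 : 0 < 1 - θ ^ 2 / 8 := by nlinarith
  obtain ⟨η', hη', hk⟩ := exists_le_cosKernel Λ (η := θ ^ 2 / 8) (by positivity)
  obtain ⟨β, hβ, R₀, hR₀, hdens⟩ := exists_density Λ hη'
  have hρ : (1 - θ ^ 2 / 4) / (1 - θ ^ 2 / 8) < 1 := by
    rw [div_lt_one hb0]
    have : 0 < θ ^ 2 := by positivity
    linarith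
  obtain ⟨N, hN⟩ := exists_pow_lt_of_lt_one (x := θ * β / 2) (by positivity) hρ
  rw [div_pow, div_lt_iff₀ (by positivity)] at hN
  have hkc : Continuous fun τ => cosKernel Λ τ ^ N := (continuous_cosKernel Λ).pow N
  have hlow : ∀ R ≥ R₀, (1 - θ ^ 2 / 8) ^ N * β * R ^ d ≤ ∫ τ in cube R 0, cosKernel Λ τ ^ N := by
    intro R hR
    set P : Set (Space d) := {τ | ∀ l ∈ Λ, ‖expChar l τ - 1‖ ≤ η'} with hP
    have hPm : MeasurableSet P := by
      have : P = ⋂ l ∈ Λ, {τ | ‖expChar l τ - 1‖ ≤ η'} := by ext; simp [hP]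
      rw [this]
      exact Λ.measurableSet_biInter fun l _ =>
        (isClosed_le ((continuous_expChar l).sub continuous_const).norm continuous_const).measurableSet
    have h1 : ∫ τ in P ∩ cube R 0, cosKernel Λ τ ^ N ≤ ∫ τ in cube R 0, cosKernel Λ τ ^ N :=
      setIntegral_mono_set (integrableOn_cube hkc R 0)
        (Eventually.of_forall fun τ => pow_nonneg (cosKernel_nonneg Λ τ) N)
        (Eventually.of_forall fun τ hτ => hτ.2)
    refine le_trans ?_ h1
    have h2 : ∫ τ in P ∩ cube R (0 : Space d), (1 - θ ^ 2 / 8) ^ N ≤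
        ∫ τ in P ∩ cube R 0, cosKernel Λ τ ^ N := by
      refine setIntegral_mono_on ?_ ((integrableOn_cube hkc R 0).mono_set inter_subset_right)
        (hPm.inter (measurableSet_cube R 0)) fun τ hτ => ?_
      · exact (integrableOn_cube continuous_const R 0).mono_set inter_subset_right
      · exact pow_le_pow_left₀ hb0.le (hk τ hτ.1) N
    refine le_trans ?_ h2
    rw [setIntegral_const, smul_eq_mul, mul_assoc, mul_comm]
    exact mul_le_mul_of_nonneg_right (hdens R hR) (by positivity)
  refine ⟨N, (1 - θ ^ 2 / 8) ^ N * β, by positivity, R₀, hR₀, fun R hR => ⟨hlow R hR, fun l hl => ?_⟩⟩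
  have hR0 : 0 ≤ R := hR₀.le.trans hR
  have hpt : ∀ τ, cosKernel Λ τ ^ N * ‖expChar l τ - 1‖ ≤
      θ * cosKernel Λ τ ^ N + 2 * (1 - θ ^ 2 / 4) ^ N := by
    intro τ
    have hk0 : 0 ≤ cosKernel Λ τ ^ N := pow_nonneg (cosKernel_nonneg Λ τ) N
    rcases le_or_gt ‖expChar l τ - 1‖ θ with h | h
    · have := mul_le_mul_of_nonneg_left h hk0
      have : 0 < (1 - θ ^ 2 / 4) ^ N := by positivity
      linarith
    · have h1 : cosKernel Λ τ ^ N ≤ (1 - θ ^ 2 / 4) ^ N := by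
        refine pow_le_pow_left₀ (cosKernel_nonneg Λ τ) ((cosKernel_le hl τ).trans ?_) N
        have := pow_le_pow_left₀ hθ0.le h.le 2
        linarith
      have h2 : ‖expChar l τ - 1‖ ≤ 2 := by
        refine (norm_sub_le _ _).trans ?_
        rw [norm_expChar, norm_one]; norm_num
      have h3 := mul_le_mul h1 h2 (norm_nonneg _) (by positivity)
      have : 0 ≤ θ * cosKernel Λ τ ^ N := by positivity
      linarith
  have hi : IntegrableOn (fun τ => θ * cosKernel Λ τ ^ N + 2 * (1 - θ ^ 2 / 4) ^ N) (cube R 0) :=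
    integrableOn_cube ((continuous_const.mul hkc).add continuous_const) R 0
  have h1 := setIntegral_mono (integrableOn_cube
    (hkc.mul ((continuous_expChar l).sub continuous_const).norm) R 0) hi hpt
  rw [integral_add ((integrableOn_cube hkc R 0).const_mul θ) (integrableOn_cube continuous_const R 0),
    integral_const_mul, setIntegral_const, volumeReal_cube hR0, smul_eq_mul] at h1
  have h2 := hlow R hR
  have h3 : R ^ d * (2 * (1 - θ ^ 2 / 4) ^ N) ≤ θ * ∫ τ in cube R 0, cosKernel Λ τ ^ N := by
    have hRd : 0 ≤ R ^ d := by positivity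
    calc R ^ d * (2 * (1 - θ ^ 2 / 4) ^ N) ≤
        R ^ d * (2 * (θ * β / 2 * (1 - θ ^ 2 / 8) ^ N)) := by gcongr
      _ = θ * ((1 - θ ^ 2 / 8) ^ N * β * R ^ d) := by ring
      _ ≤ _ := by gcongr
  have h4 : 0 ≤ ∫ τ in cube R 0, cosKernel Λ τ ^ N :=
    integral_nonneg fun τ => pow_nonneg (cosKernel_nonneg Λ τ) N
  calc _ ≤ _ := h1
    _ ≤ 2 * θ * ∫ τ in cube R 0, cosKernel Λ τ ^ N := by linarith
    _ ≤ _ := by gcongr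

end

/-! ### Averaging measures -/

section
variable {d : ℕ}

lemma setIntegral_cube_add {E : Type*} [NormedAddCommGroup E] [NormedSpace ℝ E] (h : Space d → E)
    (R : ℝ) (x : Space d) : ∫ τ in cube R 0, h (x + τ) = ∫ y in cube R x, h y := by
  have hpre : (fun τ => x + τ) ⁻¹' cube R x = cube R 0 := by
    ext τ; simp [cube, dist_eq_norm]
  rw [← hpre]
  exact (measurePreserving_add_left volume x).setIntegral_preimage_emb
    (Homeomorph.addLeft x).measurableEmbedding h _

lemma cube_subset_cube_zero {R S : ℝ} {x : Space d} (h : R + 2 * ‖x‖ ≤ S) : cube R x ⊆ cube S 0 := by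
  intro y hy
  rw [cube, mem_closedBall_zero_iff]
  rw [cube, mem_closedBall_iff_norm] at hy
  have := norm_add_le (y - x) x
  rw [sub_add_cancel] at this
  linarith

/-- Averages of a bounded function over large cubes do not depend on the center. -/
lemma norm_setIntegral_cube_sub_le {h : Space d → ℂ} (hm : AEStronglyMeasurable h) {M : ℝ}
    (hM : ∀ᵐ x, ‖h x‖ ≤ M) {R : ℝ} (hR : 0 ≤ R) (x : Space d) :
    ‖(∫ y in cube R x, h y) - ∫ y in cube R 0, h y‖ ≤ 2 * M * ((R + 2 * ‖x‖) ^ d - R ^ d) := by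
  -- The cube `I_S` contains both cubes; each integral is compared with the one over `I_S`, and the
  -- two shells account for the factor 2.
  set S := R + 2 * ‖x‖ with hS
  have hS0 : 0 ≤ S := by positivity
  have hint : ∀ (r : ℝ) (z : Space d), 0 ≤ r → IntegrableOn h (cube r z) := fun r z hr =>
    Measure.integrableOn_of_bounded (by rw [volume_cube hr]; exact ENNReal.ofReal_ne_top) hm
      (ae_restrict_of_ae hM)
  have key : ∀ z : Space d, cube R z ⊆ cube S 0 →
      ‖(∫ y in cube S 0, h y) - ∫ y in cube R z, h y‖ ≤ M * (S ^ d - R ^ d) := by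
    intro z hz
    rw [← setIntegral_sdiff (measurableSet_cube R z) (hint S 0 hS0) hz]
    have hfin : volume (cube S (0 : Space d) \ cube R z) < ⊤ :=
      (measure_mono sdiff_subset).trans_lt (by rw [volume_cube hS0]; exact ENNReal.ofReal_lt_top)
    refine (norm_setIntegral_le_of_norm_le_const_ae' hfin (hM.mono fun y hy _ => hy)).trans (le_of_eq ?_)
    rw [measureReal_sdiff hz (measurableSet_cube R z)
      (by rw [volume_cube hS0]; exact ENNReal.ofReal_ne_top), volumeReal_cube hS0, volumeReal_cube hR]
  have h1 := key x (cube_subset_cube_zero le_rfl)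
  have h2 := key 0 (cube_subset_cube_zero (by simp [hS]))
  have h3 := norm_sub_le ((∫ y in cube S 0, h y) - ∫ y in cube R 0, h y)
    ((∫ y in cube S 0, h y) - ∫ y in cube R x, h y)
  rw [sub_sub_sub_cancel_left] at h3
  linarith

/-- The probability measure on the cube `I_R` with density proportional to `k`. -/
def averagingMeasure (k : Space d → ℝ) (R : ℝ) : Measure (Space d) :=
  ENNReal.ofReal (∫ τ in cube R 0, k τ)⁻¹ •
    (volume.restrict (cube R 0)).withDensity fun τ => ENNReal.ofReal (k τ)

variable {k : Space d → ℝ} {R : ℝ}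

lemma isProbabilityMeasure_averagingMeasure (hk : Continuous k) (hk0 : ∀ τ, 0 ≤ k τ)
    (hI : 0 < ∫ τ in cube R 0, k τ) : IsProbabilityMeasure (averagingMeasure k R) := by
  constructor
  rw [averagingMeasure, Measure.smul_apply, withDensity_apply _ MeasurableSet.univ,
    Measure.restrict_univ, ← ofReal_integral_eq_lintegral_ofReal (integrableOn_cube hk R 0)
      (Eventually.of_forall hk0), smul_eq_mul, ← ENNReal.ofReal_mul (inv_nonneg.2 hI.le),
    inv_mul_cancel₀ hI.ne', ENNReal.ofReal_one]

lemma lintegral_averagingMeasure (hk : Continuous k) (F : Space d → ℝ≥0∞) :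
    ∫⁻ τ, F τ ∂averagingMeasure k R = ENNReal.ofReal (∫ τ in cube R 0, k τ)⁻¹ *
      ∫⁻ τ in cube R 0, ENNReal.ofReal (k τ) * F τ := by
  rw [averagingMeasure, lintegral_smul_measure, smul_eq_mul,
    lintegral_withDensity_eq_lintegral_mul_non_measurable _ hk.measurable.ennreal_ofReal
      (Eventually.of_forall fun x => ENNReal.ofReal_lt_top)]
  rfl

lemma integral_averagingMeasure (hk : Continuous k) (hk0 : ∀ τ, 0 ≤ k τ) (F : Space d → ℂ) :
    ∫ τ, F τ ∂averagingMeasure k R = ((∫ τ in cube R 0, k τ)⁻¹ : ℝ) *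
      ∫ τ in cube R 0, (k τ : ℂ) * F τ := by
  rw [averagingMeasure, integral_smul_measure,
    integral_withDensity_eq_integral_toReal_smul hk.measurable.ennreal_ofReal
      (Eventually.of_forall fun x => ENNReal.ofReal_lt_top),
    ENNReal.toReal_ofReal (inv_nonneg.2 (integral_nonneg hk0)), Complex.real_smul]
  congr 1
  refine integral_congr_ae (Eventually.of_forall fun τ => ?_)
  simp only
  rw [ENNReal.toReal_ofReal (hk0 τ), Complex.real_smul]

lemma averagingMeasure_ac (k : Space d → ℝ) (R : ℝ) : averagingMeasure k R ≪ volume :=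
  ((withDensity_absolutelyContinuous _ _).trans
    Measure.restrict_le_self.absolutelyContinuous).smul_left _

/-- Relative to the cube, a shell of fixed thickness has vanishing volume; the center of an
averaging cube is therefore irrelevant in the limit. -/
lemma tendsto_shell (s : ℝ) {r : ℕ → ℝ} (hr : Tendsto r atTop atTop) :
    Tendsto (fun n => (r n ^ d)⁻¹ * ((r n + s) ^ d - r n ^ d)) atTop (𝓝 0) := by
  have h1 : Tendsto (fun n => (1 + s * (r n)⁻¹) ^ d - 1) atTop (𝓝 ((1 + s * 0) ^ d - 1)) :=
    (((tendsto_inv_atTop_zero.comp hr).const_mul s).const_add 1).pow d |>.sub_const 1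
  rw [mul_zero, add_zero, one_pow, sub_self] at h1
  refine h1.congr' ?_
  filter_upwards [hr.eventually_gt_atTop 0] with n hn
  rw [mul_sub, inv_mul_cancel₀ (pow_pos hn d).ne', ← inv_pow, ← mul_pow, mul_add,
    inv_mul_cancel₀ hn.ne', mul_comm s]

/-- Averages of translates against a nonnegative trigonometric polynomial converge, along a
subsequence, to a trigonometric polynomial. -/
lemma exists_limit_average (hk : Continuous k) (hk0 : ∀ τ, 0 ≤ k τ)
    (hkt : (fun τ => (k τ : ℂ)) ∈ trigPolys d) {κ : ℝ} (hκ : 0 < κ) {r : ℕ → ℝ}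
    (hr0 : ∀ n, 0 < r n) (hr : Tendsto r atTop atTop)
    (hκr : ∀ n, κ * r n ^ d ≤ ∫ τ in cube (r n) 0, k τ) {w : Space d → ℝ} (hw : AEMeasurable w)
    {M : ℝ} (hM : ∀ᵐ x, |w x| ≤ M) :
    ∃ Q : Space d → ℂ, IsTrigPoly Q ∧ ∃ φ : ℕ → ℕ, StrictMono φ ∧ ∀ x,
      Tendsto (fun n => ∫ τ, (w (x + τ) : ℂ) ∂averagingMeasure k (r (φ n))) atTop (𝓝 (Q x)) := by
  obtain ⟨S, b, hkS⟩ := isTrigPoly_iff.2 hkt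
  change ∀ x, (k x : ℂ) = ∑ l ∈ S, b l * expChar l x at hkS
  set c : ℕ → ℝ := fun n => ∫ τ in cube (r n) 0, k τ with hc
  have hc0 : ∀ n, 0 < c n := fun n => lt_of_lt_of_le (by have := hr0 n; positivity) (hκr n)
  have hcinv : ∀ n, (c n)⁻¹ ≤ κ⁻¹ * (r n ^ d)⁻¹ := fun n => by
    rw [← mul_inv]
    exact inv_anti₀ (by have := hr0 n; positivity) (hκr n)
  have hM0 : 0 ≤ M := by
    obtain ⟨x, hx⟩ := hM.exists
    exact (abs_nonneg _).trans hx
  set h : Space d → Space d → ℂ := fun l y => expChar l y * w y with hh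
  have hhm : ∀ l, AEStronglyMeasurable (h l) := fun l =>
    (continuous_expChar l).aestronglyMeasurable.mul
      (Complex.continuous_ofReal.comp_aestronglyMeasurable hw.aestronglyMeasurable)
  have hhM : ∀ l, ∀ᵐ x, ‖h l x‖ ≤ M := fun l => hM.mono fun x hx => by
    rw [hh, norm_mul, norm_expChar, one_mul, Complex.norm_real]
    exact hx
  -- Expanding `k` in characters, the average of `w(x + τ)` becomes `∑ b_l e_{-l}(x)` times the
  -- normalized integrals of `e_l w` over the cube centered at `x`. Recentered at 0 these are the
  -- bounded coefficients `a n`, and compactness in finite dimension yields a convergent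
  -- subsequence; no mean value of `w` is assumed to exist.
  set a : ℕ → S → ℂ := fun n l => ((c n)⁻¹ : ℝ) * ∫ y in cube (r n) 0, h l y with ha
  have hab : ∀ n, a n ∈ Metric.closedBall (0 : S → ℂ) (κ⁻¹ * M) := by
    intro n
    rw [mem_closedBall_zero_iff, pi_norm_le_iff_of_nonneg (by positivity)]
    intro l
    have h1 : ‖∫ y in cube (r n) 0, h l y‖ ≤ M * r n ^ d := by
      rw [← volumeReal_cube (hr0 n).le (0 : Space d)]
      exact norm_setIntegral_le_of_norm_le_const_ae'
        (by rw [volume_cube (hr0 n).le]; exact ENNReal.ofReal_lt_top)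
        ((hhM l).mono fun y hy _ => hy)
    rw [ha, norm_mul, Complex.norm_real, Real.norm_of_nonneg (inv_nonneg.2 (hc0 n).le)]
    have hrd : 0 < r n ^ d := pow_pos (hr0 n) d
    calc _ ≤ (κ⁻¹ * (r n ^ d)⁻¹) * (M * r n ^ d) :=
          mul_le_mul (hcinv n) h1 (norm_nonneg _) (by positivity)
      _ = κ⁻¹ * M := by field_simp
  obtain ⟨α, -, φ, hφ, hα⟩ := tendsto_subseq_of_bounded Metric.isBounded_closedBall hab
  refine ⟨fun x => ∑ l : S, b l * expChar (-(l : Space d)) x * α l, ?_, φ, hφ, fun x => ?_⟩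
  · rw [isTrigPoly_iff]
    have : (fun x => ∑ l : S, b l * expChar (-(l : Space d)) x * α l) =
        ∑ l : S, (b l * α l) • expChar (-(l : Space d)) := by
      ext x
      rw [Finset.sum_apply]
      exact Finset.sum_congr rfl fun l _ => by
        simp only [Pi.smul_apply, smul_eq_mul]; ring
    rw [this]
    exact Submodule.sum_mem _ fun l _ => Submodule.smul_mem _ _ (expChar_mem_trigPolys _)
  · set e : ℕ → S → ℂ := fun n l =>
      ((c n)⁻¹ : ℝ) * ((∫ y in cube (r n) x, h l y) - ∫ y in cube (r n) 0, h l y) with he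
    have hform : ∀ n, ∫ τ, (w (x + τ) : ℂ) ∂averagingMeasure k (r n) =
        ∑ l : S, b l * expChar (-(l : Space d)) x * (a n l + e n l) := by
      intro n
      rw [integral_averagingMeasure hk hk0]
      have h1 : ∀ τ, (k τ : ℂ) * w (x + τ) = ∑ l : S, b l * expChar (-(l : Space d)) x * h l (x + τ) := by
        intro τ
        rw [hkS, Finset.sum_mul, ← Finset.sum_coe_sort S]
        refine Finset.sum_congr rfl fun l _ => ?_
        rw [hh]
        simp only
        rw [expChar_add]
        calc _ = b l * (expChar (-l : Space d) x * expChar (l : Space d) x) * expChar l τ * w (x + τ) := by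
              rw [expChar_neg_mul, mul_one]
          _ = _ := by ring
      simp only [h1]
      rw [integral_finsetSum, Finset.mul_sum]
      · refine Finset.sum_congr rfl fun l _ => ?_
        rw [integral_const_mul, setIntegral_cube_add, ha, he]
        ring
      · intro l _
        refine Integrable.const_mul ?_ _
        refine Measure.integrableOn_of_bounded (M := M)
          (by rw [volume_cube (hr0 n).le]; exact ENNReal.ofReal_ne_top)
          ((hhm l).comp_quasiMeasurePreserving
            (measurePreserving_add_left volume x).quasiMeasurePreserving)
          (ae_restrict_of_ae
            ((measurePreserving_add_left volume x).quasiMeasurePreserving.ae (hhM l)))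
    have hez : ∀ l, Tendsto (fun n => e n l) atTop (𝓝 0) := by
      intro l
      have h1 := (tendsto_shell (d := d) (2 * ‖x‖) hr).const_mul (κ⁻¹ * (2 * M))
      rw [mul_zero] at h1
      refine squeeze_zero_norm (fun n => ?_) h1
      rw [he, norm_mul, Complex.norm_real, Real.norm_of_nonneg (inv_nonneg.2 (hc0 n).le)]
      have hrd : 0 < r n ^ d := pow_pos (hr0 n) d
      calc _ ≤ (κ⁻¹ * (r n ^ d)⁻¹) * (2 * M * ((r n + 2 * ‖x‖) ^ d - r n ^ d)) :=
            mul_le_mul (hcinv n) (norm_setIntegral_cube_sub_le (hhm l) (hhM l) (hr0 n).le x)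
              (norm_nonneg _) (by positivity)
        _ = _ := by ring
    simp only [hform]
    refine tendsto_finsetSum _ fun l _ => Tendsto.const_mul _ ?_
    have h1 : Tendsto (fun n => a (φ n) l) atTop (𝓝 (α l)) := (tendsto_pi_nhds.1 hα) l
    simpa using h1.add ((hez l).comp hφ.tendsto_atTop)

end

/-! ### Approximation by trigonometric polynomials -/

section
variable {d : ℕ}

/-- As `ν n` has mass 1, `w x - Q x` is the limit of the averages of `w x - w(x + τ)`. Fatou's lemma
in `x` and Tonelli's theorem then show that `Q` is as close to `w` as the typical translates of `w`
are. -/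
lemma lintegral_norm_sub_limit_le {w : Space d → ℝ} (hw : Measurable w) {M : ℝ}
    (hM : ∀ᵐ x, |w x| ≤ M) {ν : ℕ → Measure (Space d)} (hν : ∀ n, IsProbabilityMeasure (ν n))
    (hac : ∀ n, ν n ≪ volume) {Q : Space d → ℂ}
    (hQ : ∀ x, Tendsto (fun n => ∫ τ, (w (x + τ) : ℂ) ∂ν n) atTop (𝓝 (Q x)))
    {ρ : Space d → ℝ≥0∞} (hρ : Measurable ρ) (hρ' : ∀ x, ρ x ≠ ⊤) :
    ∫⁻ x, ρ x * ‖(w x : ℂ) - Q x‖ₑ ≤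
      liminf (fun n => ∫⁻ τ, (∫⁻ x, ρ x * ‖w (x + τ) - w x‖ₑ) ∂ν n) atTop := by
  have hmeas : Measurable fun q : Space d × Space d => ρ q.1 * ‖w (q.1 + q.2) - w q.1‖ₑ :=
    (hρ.comp measurable_fst).mul
      ((hw.comp (measurable_fst.add measurable_snd)).sub (hw.comp measurable_fst)).enorm
  have hswap : ∀ n, ∫⁻ τ, (∫⁻ x, ρ x * ‖w (x + τ) - w x‖ₑ) ∂ν n =
      ∫⁻ x, ∫⁻ τ, ρ x * ‖w (x + τ) - w x‖ₑ ∂ν n := fun n => by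
    have := hν n
    exact (lintegral_lintegral_swap (f := fun x τ => ρ x * ‖w (x + τ) - w x‖ₑ)
      hmeas.aemeasurable).symm
  simp only [hswap]
  refine le_trans (lintegral_mono fun x => ?_) (lintegral_liminf_le fun n => ?_)
  · have hlim : Tendsto (fun n => ρ x * ‖(w x : ℂ) - ∫ τ, (w (x + τ) : ℂ) ∂ν n‖ₑ) atTop
        (𝓝 (ρ x * ‖(w x : ℂ) - Q x‖ₑ)) :=
      ENNReal.Tendsto.const_mul (tendsto_const_nhds.sub (hQ x)).enorm (Or.inr (hρ' x))
    rw [← hlim.liminf_eq]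
    refine liminf_le_liminf (Eventually.of_forall fun n => ?_)
    have := hν n
    have hwi : Integrable (fun τ => (w (x + τ) : ℂ)) (ν n) := by
      refine Integrable.of_bound (C := M)
        (Complex.measurable_ofReal.comp (hw.comp (measurable_const_add x))).aestronglyMeasurable ?_
      refine (hac n).ae_le ?_
      filter_upwards [(measurePreserving_add_left volume x).quasiMeasurePreserving.ae hM] with τ hτ
      rwa [Complex.norm_real, Real.norm_eq_abs]
    rw [lintegral_const_mul _ (by
      exact ((hw.comp (measurable_const_add x)).sub measurable_const).enorm)]
    gcongr
    have h1 : (w x : ℂ) - ∫ τ, (w (x + τ) : ℂ) ∂ν n = ∫ τ, ((w x : ℂ) - w (x + τ)) ∂ν n := by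
      rw [integral_sub (integrable_const _) hwi, integral_const]
      simp
    rw [h1]
    refine (enorm_integral_le_lintegral_enorm _).trans (lintegral_mono fun τ => ?_)
    rw [← Complex.ofReal_sub, ← ofReal_norm, ← ofReal_norm, Complex.norm_real, norm_sub_rev]
  · have := hν n
    exact hmeas.lintegral_prod_right'

/-- Averaging measures concentrated near the common almost periods of finitely many characters. -/
theorem exists_averaging (Λ : Finset (Space d)) {δ : ℝ} (hδ : 0 < δ) :
    ∃ (κ : ℝ≥0∞) (r : ℕ → ℝ) (ν : ℕ → Measure (Space d)), κ ≠ ⊤ ∧ Tendsto r atTop atTop ∧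
      (∀ n, 0 < r n) ∧ (∀ n, IsProbabilityMeasure (ν n)) ∧
      (∀ n (F : Space d → ℝ≥0∞), ∫⁻ τ, F τ ∂ν n ≤ κ * ((ENNReal.ofReal (r n ^ d))⁻¹ * ∫⁻ τ in cube (r n) 0, F τ)) ∧
      (∀ n, ∀ l ∈ Λ, ∫⁻ τ, ‖expChar l τ - 1‖ₑ ∂ν n ≤ ENNReal.ofReal δ) ∧
      ∀ (w : Space d → ℝ) (M : ℝ), AEMeasurable w → (∀ᵐ x, |w x| ≤ M) →
        ∃ Q : Space d → ℂ, IsTrigPoly Q ∧ ∃ φ : ℕ → ℕ, StrictMono φ ∧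
          ∀ ρ : Space d → ℝ≥0∞, Measurable ρ → (∀ x, ρ x ≠ ⊤) →
            ∫⁻ x, ρ x * ‖(w x : ℂ) - Q x‖ₑ ≤
              liminf (fun n => ∫⁻ τ, (∫⁻ x, ρ x * ‖w (x + τ) - w x‖ₑ) ∂ν (φ n)) atTop := by
  obtain ⟨N, κ, hκ, R₀, hR₀, hN⟩ := exists_kernel_power Λ hδ
  set k : Space d → ℝ := fun τ => cosKernel Λ τ ^ N with hk
  have hkc : Continuous k := (continuous_cosKernel Λ).pow N
  have hk0 : ∀ τ, 0 ≤ k τ := fun τ => pow_nonneg (cosKernel_nonneg Λ τ) N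
  have hk1 : ∀ τ, k τ ≤ 1 := fun τ => pow_le_one₀ (cosKernel_nonneg Λ τ) (cosKernel_le_one Λ τ)
  set r : ℕ → ℝ := fun n => n + R₀ with hr
  have hrR : ∀ n, R₀ ≤ r n := fun n => le_add_of_nonneg_left (Nat.cast_nonneg n)
  have hr0 : ∀ n, 0 < r n := fun n => hR₀.trans_le (hrR n)
  have hrt : Tendsto r atTop atTop := tendsto_atTop_add_const_right _ _ tendsto_natCast_atTop_atTop
  have hκr : ∀ n, κ * r n ^ d ≤ ∫ τ in cube (r n) 0, k τ := fun n => (hN _ (hrR n)).1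
  have hpos : ∀ n, 0 < ∫ τ in cube (r n) 0, k τ := fun n =>
    lt_of_lt_of_le (mul_pos hκ (pow_pos (hr0 n) d)) (hκr n)
  have hprob := fun n => isProbabilityMeasure_averagingMeasure hkc hk0 (hpos n)
  -- From `k ≤ 1` and `∫ k ≥ κ r^d`, the normalized density is at most `κ⁻¹ r^{-d}`.
  refine ⟨ENNReal.ofReal κ⁻¹, r, fun n => averagingMeasure k (r n), ENNReal.ofReal_ne_top, hrt, hr0,
    hprob, fun n F => ?_, fun n l hl => ?_, fun w M hw hM => ?_⟩
  · rw [lintegral_averagingMeasure hkc, ← mul_assoc,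
      ← ENNReal.ofReal_inv_of_pos (pow_pos (hr0 n) d), ← ENNReal.ofReal_mul (inv_nonneg.2 hκ.le),
      ← mul_inv]
    gcongr
    · exact hκr n
    · exact mul_le_of_le_one_left zero_le (ENNReal.ofReal_le_one.2 (hk1 _))
  · rw [lintegral_averagingMeasure hkc]
    have h1 : ∀ τ, ENNReal.ofReal (k τ) * ‖expChar l τ - 1‖ₑ =
        ENNReal.ofReal (k τ * ‖expChar l τ - 1‖) := fun τ => by
      rw [ENNReal.ofReal_mul (hk0 τ), ofReal_norm]
    simp only [h1]
    rw [← ofReal_integral_eq_lintegral_ofReal (f := fun τ => k τ * ‖expChar l τ - 1‖)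
        (integrableOn_cube (hkc.mul ((continuous_expChar l).sub continuous_const).norm) _ _)
        (Eventually.of_forall fun τ => mul_nonneg (hk0 τ) (norm_nonneg _)),
      ← ENNReal.ofReal_mul (inv_nonneg.2 (hpos n).le)]
    refine ENNReal.ofReal_le_ofReal ?_
    rw [inv_mul_le_iff₀ (hpos n), mul_comm]
    exact (hN _ (hrR n)).2 l hl
  · obtain ⟨w', hw', hww'⟩ := hw
    have hM' : ∀ᵐ x, |w' x| ≤ M := by
      filter_upwards [hM, hww'] with x h1 h2
      rwa [← h2]
    obtain ⟨Q, hQ, φ, hφ, hlim⟩ := exists_limit_average hkc hk0 (cosKernel_pow_mem_trigPolys Λ N) hκ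
      hr0 hrt hκr hw'.aemeasurable hM'
    refine ⟨Q, hQ, φ, hφ, fun ρ hρ hρ' => ?_⟩
    have h1 := lintegral_norm_sub_limit_le hw' hM' (fun n => hprob (φ n))
      (fun n => averagingMeasure_ac k (r (φ n))) hlim hρ hρ'
    have h2 : ∫⁻ x, ρ x * ‖(w x : ℂ) - Q x‖ₑ = ∫⁻ x, ρ x * ‖(w' x : ℂ) - Q x‖ₑ :=
      lintegral_congr_ae (hww'.mono fun x hx => by simp only [hx])
    have h3 : ∀ τ, ∫⁻ x, ρ x * ‖w (x + τ) - w x‖ₑ = ∫⁻ x, ρ x * ‖w' (x + τ) - w' x‖ₑ := by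
      intro τ
      refine lintegral_congr_ae ?_
      filter_upwards [hww', (measurePreserving_add_right volume τ).quasiMeasurePreserving.ae hww']
        with x hx hx2
      simp only [hx, hx2]
    simp only [h2, h3]
    exact h1

/-- The mean of a translation modulus against measures concentrated near almost periods. -/
lemma lintegral_modulus_le {Λ : Finset (Space d)} {a : Space d → ℝ} (ha : ∀ l, 0 ≤ a l) {δ : ℝ}
    (hδ : 0 ≤ δ) {ν : Measure (Space d)}
    (h : ∀ l ∈ Λ, ∫⁻ τ, ‖expChar l τ - 1‖ₑ ∂ν ≤ ENNReal.ofReal δ) :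
    ∫⁻ τ, ENNReal.ofReal (∑ l ∈ Λ, a l * ‖expChar l τ - 1‖) ∂ν ≤
      ENNReal.ofReal ((∑ l ∈ Λ, a l) * δ) := by
  have h1 : ∀ τ, ENNReal.ofReal (∑ l ∈ Λ, a l * ‖expChar l τ - 1‖) =
      ∑ l ∈ Λ, ENNReal.ofReal (a l) * ‖expChar l τ - 1‖ₑ := by
    intro τ
    rw [ENNReal.ofReal_sum_of_nonneg fun l _ => mul_nonneg (ha l) (norm_nonneg _)]
    exact Finset.sum_congr rfl fun l _ => by rw [ENNReal.ofReal_mul (ha l), ofReal_norm]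
  simp only [h1]
  have hm : ∀ l : Space d, Measurable fun τ => ‖expChar l τ - 1‖ₑ := fun l =>
    (((continuous_expChar l).sub continuous_const).measurable).enorm
  rw [lintegral_finsetSum _ fun l _ => (hm l).const_mul _, Finset.sum_mul,
    ENNReal.ofReal_sum_of_nonneg fun l _ => mul_nonneg (ha l) hδ]
  refine Finset.sum_le_sum fun l hl => ?_
  rw [lintegral_const_mul _ (hm l), ENNReal.ofReal_mul (ha l)]
  gcongr
  exact h l hl

end

/-! ### Stepanoff norms -/

section
variable {d : ℕ}

/-- The reciprocal of a lower bound of the weight `weight L z` on the cube `I_L(z)`. -/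
def cubeConst (d : ℕ) : ℝ := (1 + d * (1 / 2) ^ 2) ^ (d + 1)

lemma cubeConst_pos (d : ℕ) : 0 < cubeConst d := by unfold cubeConst; positivity

/-- On `I_L(z)` the rescaled distance is at most 1/2, so the weight has a lower bound that does not
depend on `L`. -/
lemma setLIntegral_cube_le_weight {L : ℝ} (hL : 0 < L) (z : Space d) (g : Space d → ℝ≥0∞) :
    ∫⁻ x in cube L z, g x ≤
      ENNReal.ofReal (cubeConst d) * ∫⁻ x, ENNReal.ofReal (weight L z x) * g x := by
  rw [← lintegral_const_mul' _ _ ENNReal.ofReal_ne_top]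
  refine (setLIntegral_mono' (measurableSet_cube L z) fun x hx => ?_).trans
    (setLIntegral_le_lintegral (cube L z) _)
  rw [← mul_assoc, ← ENNReal.ofReal_mul (cubeConst_pos d).le]
  refine le_mul_of_one_le_left zero_le (ENNReal.one_le_ofReal.2 ?_)
  have h1 : ‖L⁻¹ • (x - z)‖ ≤ 1 / 2 := by
    rw [norm_smul, norm_inv, Real.norm_of_nonneg hL.le, inv_mul_le_iff₀ hL]
    rw [cube, mem_closedBall_iff_norm] at hx
    linarith
  have h2 := le_weight z x h1
  have h3 : 1 = cubeConst d * (1 + d * (1 / 2 : ℝ) ^ 2)⁻¹ ^ (d + 1) := by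
    rw [cubeConst, ← mul_pow, mul_inv_cancel₀ (by positivity), one_pow]
  rw [h3]
  exact mul_le_mul_of_nonneg_left h2 (cubeConst_pos d).le

/-- Integrals over large cubes are controlled by integrals over unit cubes. -/
lemma setLIntegral_cube_le_stepanoffNorm {g : Space d → ℂ} (hg : AEMeasurable g) {R : ℝ} (hR : 0 ≤ R)
    (z : Space d) :
    ∫⁻ x in cube R z, ‖g x‖ₑ ≤ ENNReal.ofReal ((R + 1) ^ d) * stepanoffNorm g := by
  set E : Set (Space d × Space d) := {q | dist q.1 q.2 ≤ 1 / 2} with hE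
  have hEm : MeasurableSet E := (isClosed_le continuous_dist continuous_const).measurableSet
  have hcube : ∀ x : Space d, cube 1 x = {y | dist x y ≤ 1 / 2} := fun x => by
    ext y; rw [cube, Metric.mem_closedBall, dist_comm]; rfl
  -- The value at `x` is spread over the unit cube around `x`; by Tonelli the total becomes an
  -- integral, over the cube enlarged to edge `R + 1`, of unit-cube integrals of `g`.
  have h1 : ∀ x ∈ cube R z, ‖g x‖ₑ =
      ∫⁻ y in cube (R + 1) z, E.indicator (fun q => ‖g q.1‖ₑ) (x, y) := by
    intro x hx
    have e : (fun y => E.indicator (fun q : Space d × Space d => ‖g q.1‖ₑ) (x, y)) =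
        (cube 1 x).indicator fun _ => ‖g x‖ₑ := by
      ext y
      rw [hcube]
      rfl
    have hsub : cube 1 x ⊆ cube (R + 1) z := by
      refine Metric.closedBall_subset_closedBall' ?_
      have := Metric.mem_closedBall.1 hx
      linarith
    rw [e, lintegral_indicator (measurableSet_cube 1 x), setLIntegral_const,
      Measure.restrict_apply (measurableSet_cube 1 x), inter_eq_left.2 hsub,
      volume_cube zero_le_one]
    simp
  rw [setLIntegral_congr_fun (measurableSet_cube R z) h1,
    lintegral_lintegral_swap (f := fun x y => E.indicator (fun q => ‖g q.1‖ₑ) (x, y))]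
  · calc _ ≤ ∫⁻ _ in cube (R + 1) z, stepanoffNorm g := by
          refine lintegral_mono fun y => ?_
          refine le_trans ?_ (le_iSup (fun y => ∫⁻ x in cube 1 y, ‖g x‖ₑ) y)
          rw [← lintegral_indicator (measurableSet_cube 1 y)]
          refine (setLIntegral_le_lintegral _ _).trans (lintegral_mono fun x => ?_)
          by_cases hxy : (x, y) ∈ E
          · rw [indicator_of_mem hxy, indicator_of_mem]
            exact hxy
          · rw [indicator_of_notMem hxy]
            exact zero_le
      _ = _ := by rw [setLIntegral_const, volume_cube (by linarith), mul_comm]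
  · refine AEMeasurable.indicator ?_ hEm
    exact (hg.restrict.enorm).comp_quasiMeasurePreserving Measure.quasiMeasurePreserving_fst

lemma stepanoffNorm_le {g : Space d → ℂ} {b : ℝ} (h : ∀ x, ‖g x‖ ≤ b) :
    stepanoffNorm g ≤ ENNReal.ofReal b := by
  refine iSup_le fun z => ?_
  calc _ ≤ ∫⁻ _ in cube 1 z, ENNReal.ofReal b := lintegral_mono fun x => by
        rw [← ofReal_norm]; exact ENNReal.ofReal_le_ofReal (h x)
    _ = _ := by rw [setLIntegral_const, volume_cube zero_le_one]; simp

/-- The constant in the comparison of Stepanoff norms with weighted norms. -/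
def stepanoffConst (d : ℕ) : ℝ := cubeConst d * (weightConst d * 2 ^ d)

lemma stepanoffConst_pos (d : ℕ) : 0 < stepanoffConst d :=
  mul_pos (cubeConst_pos d) (mul_pos (weightConst_pos d) (by positivity))

/-- Weighted estimates, uniform in the center of the weight, are inherited by Stepanoff norms. -/
lemma stepanoffNorm_le_of_weightedNorm_le {a b : Space d → ℝ} (hb : AEMeasurable b) {D : ℝ}
    (hD : 0 ≤ D) (h : ∀ z, weightedNorm 1 z a ≤ ENNReal.ofReal D * weightedNorm 1 z b) :
    stepanoffNorm (fun x => (a x : ℂ)) ≤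
      ENNReal.ofReal (stepanoffConst d * D) * stepanoffNorm (fun x => (b x : ℂ)) := by
  have hn : ∀ y : ℝ, ‖(y : ℂ)‖ₑ = ‖y‖ₑ := fun y => by
    rw [← ofReal_norm, ← ofReal_norm, Complex.norm_real]
  set S := stepanoffNorm (fun x => (b x : ℂ)) with hS
  refine iSup_le fun z => ?_
  -- For `R ≥ 2` one has `(R + 1)^d ≤ 2^d R^d`; this is the factor `2 ^ d` in `stepanoffConst`.
  have h1 : weightedNorm 1 z b ≤ ENNReal.ofReal (weightConst d * 1 ^ d) * (ENNReal.ofReal (2 ^ d) * S) := by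
    refine lintegral_weight_mul_le one_pos z hb.enorm fun R hR => ?_
    have hbc : AEMeasurable fun x => (b x : ℂ) := Complex.measurable_ofReal.comp_aemeasurable hb
    have := setLIntegral_cube_le_stepanoffNorm hbc (R := R) (by linarith) z
    simp only [hn] at this
    refine this.trans ?_
    rw [mul_right_comm, ← ENNReal.ofReal_mul (by positivity), ← mul_pow]
    gcongr
    linarith
  calc ∫⁻ x in cube 1 z, ‖(a x : ℂ)‖ₑ = ∫⁻ x in cube 1 z, ‖a x‖ₑ := by simp only [hn]
    _ ≤ ENNReal.ofReal (cubeConst d) * weightedNorm 1 z a := setLIntegral_cube_le_weight one_pos z _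
    _ ≤ ENNReal.ofReal (cubeConst d) * (ENNReal.ofReal D *
        (ENNReal.ofReal (weightConst d * 1 ^ d) * (ENNReal.ofReal (2 ^ d) * S))) := by
      gcongr
      exact (h z).trans (by gcongr)
    _ = _ := by
      rw [← mul_assoc, ← mul_assoc, ← mul_assoc, ← ENNReal.ofReal_mul (cubeConst_pos d).le,
        ← ENNReal.ofReal_mul (mul_nonneg (cubeConst_pos d).le hD),
        ← ENNReal.ofReal_mul (by have := cubeConst_pos d; have := weightConst_pos d; positivity)]
      congr 2
      unfold stepanoffConst
      ring

/-! ### Trigonometric polynomials as data -/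

lemma stepanoffNorm_translate_sub_le {P : Space d → ℂ} {Λ : Finset (Space d)} {a : Space d → ℝ}
    (h : ∀ x τ, ‖P (x + τ) - P x‖ ≤ ∑ l ∈ Λ, a l * ‖expChar l τ - 1‖) (τ : Space d) :
    stepanoffNorm (fun x => P (x + τ) - P x) ≤
      ENNReal.ofReal (∑ l ∈ Λ, a l * ‖expChar l τ - 1‖) :=
  stepanoffNorm_le fun x => h x τ

/-- Trigonometric polynomials have relatively dense almost periods. -/
lemma IsTrigPoly.exists_period {P : Space d → ℂ} (hP : IsTrigPoly P) {ε : ℝ} (hε : 0 < ε) :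
    ∃ r : ℝ, 0 < r ∧ ∀ z, ∃ τ, ‖τ - z‖ ≤ r ∧ ∀ x, ‖P (x + τ) - P x‖ ≤ ε := by
  obtain ⟨-, -, Λ, a, ha, h⟩ := hP.exists_modulus
  have hs : 0 ≤ ∑ l ∈ Λ, a l := Finset.sum_nonneg fun l _ => ha l
  obtain ⟨r, hr, hd⟩ := exists_relativelyDense Λ (η := ε / (∑ l ∈ Λ, a l + 1)) (by positivity)
  refine ⟨r, hr, fun z => ?_⟩
  obtain ⟨τ, h1, h2⟩ := hd z
  refine ⟨τ, h1, fun x => (h x τ).trans ?_⟩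
  calc _ ≤ ∑ l ∈ Λ, a l * (ε / (∑ l ∈ Λ, a l + 1)) :=
        Finset.sum_le_sum fun l hl => mul_le_mul_of_nonneg_left (h2 l hl) (ha l)
    _ = (∑ l ∈ Λ, a l) * ε / (∑ l ∈ Λ, a l + 1) := by rw [← Finset.sum_mul, mul_div_assoc]
    _ ≤ ε := by
      rw [div_le_iff₀ (by positivity)]
      linarith

lemma IsTrigPoly.exists_inclusionInterval {P : Space d → ℂ} (hP : IsTrigPoly P) {ε : ℝ}
    (hε : 0 < ε) : ∃ l, IsInclusionInterval ε P l := by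
  obtain ⟨r, hr, h⟩ := hP.exists_period hε
  refine ⟨2 * r, by positivity, fun z => ?_⟩
  obtain ⟨τ, h1, h2⟩ := h z
  refine ⟨τ, ?_, stepanoffNorm_le h2⟩
  rw [cube, mem_closedBall_iff_norm]
  linarith

/-- Almost periods are inherited. -/
lemma IsInclusionInterval.of_stepanoffNorm_le {v w : Space d → ℂ} {D : ℝ} (hD : 0 ≤ D)
    (h : ∀ τ, stepanoffNorm (fun x => w (x + τ) - w x) ≤
      ENNReal.ofReal D * stepanoffNorm (fun x => v (x + τ) - v x)) {ε ε' l : ℝ} (hε : D * ε' ≤ ε)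
    (hl : IsInclusionInterval ε' v l) : IsInclusionInterval ε w l := by
  refine ⟨hl.1, fun x => ?_⟩
  obtain ⟨τ, hτ, hp⟩ := hl.2 x
  refine ⟨τ, hτ, (h τ).trans ?_⟩
  calc _ ≤ ENNReal.ofReal D * ENNReal.ofReal ε' := by gcongr; exact hp
    _ = ENNReal.ofReal (D * ε') := (ENNReal.ofReal_mul hD).symm
    _ ≤ _ := ENNReal.ofReal_le_ofReal hε

/-- A bounded function whose translations are controlled by those of a trigonometric polynomial is
Stepanoff almost periodic. -/
lemma isSAP_of_stepanoffNorm_le {v : Space d → ℂ} {w : Space d → ℝ} (hv : IsTrigPoly v)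
    (hw : AEMeasurable w) {M : ℝ} (hM : ∀ᵐ x, |w x| ≤ M) {D : ℝ} (hD : 0 ≤ D)
    (h : ∀ τ, stepanoffNorm (fun x => (w (x + τ) : ℂ) - w x) ≤
      ENNReal.ofReal D * stepanoffNorm (fun x => v (x + τ) - v x)) :
    IsSAP fun x => (w x : ℂ) := by
  constructor
  · rw [locallyIntegrable_iff]
    intro K hK
    exact Measure.integrableOn_of_bounded (M := M) hK.measure_lt_top.ne
      (Complex.measurable_ofReal.comp_aemeasurable hw).aestronglyMeasurable
      (ae_restrict_of_ae (hM.mono fun x hx => by rwa [Complex.norm_real, Real.norm_eq_abs]))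
  intro ε hε
  obtain ⟨-, -, Λ, a, ha, hmod⟩ := hv.exists_modulus
  have hs : 0 ≤ ∑ l ∈ Λ, a l := Finset.sum_nonneg fun l _ => ha l
  -- Chosen so that `D (∑ a_l) δ ≤ ε`.
  set δ := ε / (D * (∑ l ∈ Λ, a l) + 1) with hδ
  have hδ0 : 0 < δ := by positivity
  obtain ⟨κ, r, ν, -, -, -, -, -, hν, hQ⟩ := exists_averaging Λ hδ0
  obtain ⟨Q, hQt, φ, -, hle⟩ := hQ w M hw hM
  refine ⟨Q, hQt, iSup_le fun z => ?_⟩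
  -- The polynomial `Q` was obtained before the test function, so the same `Q` serves all unit cubes
  -- and the bound is uniform in `z`.
  set ρ : Space d → ℝ≥0∞ := (cube 1 z).indicator 1 with hρ
  have hρm : Measurable ρ := measurable_one.indicator (measurableSet_cube 1 z)
  have hρi : ∀ F : Space d → ℝ≥0∞, ∫⁻ x, ρ x * F x = ∫⁻ x in cube 1 z, F x := by
    intro F
    rw [← lintegral_indicator (measurableSet_cube 1 z)]
    refine lintegral_congr fun x => ?_
    by_cases hx : x ∈ cube 1 z <;> simp [hρ, hx]
  have h1 := hle ρ hρm fun x => by by_cases hx : x ∈ cube 1 z <;> simp [hρ, hx]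
  rw [hρi] at h1
  refine h1.trans ((liminf_le_liminf (v := fun _ => ENNReal.ofReal ε)
    (Eventually.of_forall fun n => ?_)).trans (liminf_const _).le)
  have h2 : ∀ τ, ∫⁻ x, ρ x * ‖w (x + τ) - w x‖ₑ ≤
      ENNReal.ofReal D * ENNReal.ofReal (∑ l ∈ Λ, a l * ‖expChar l τ - 1‖) := by
    intro τ
    rw [hρi]
    calc _ = ∫⁻ x in cube 1 z, ‖(w (x + τ) : ℂ) - w x‖ₑ := by
          refine lintegral_congr fun x => ?_
          rw [← Complex.ofReal_sub, ← ofReal_norm, ← ofReal_norm, Complex.norm_real]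
      _ ≤ _ := le_iSup (fun z => ∫⁻ x in cube 1 z, ‖(w (x + τ) : ℂ) - w x‖ₑ) z
      _ ≤ _ := h τ
      _ ≤ _ := by gcongr; exact stepanoffNorm_translate_sub_le hmod τ
  calc _ ≤ ∫⁻ τ, ENNReal.ofReal D * ENNReal.ofReal (∑ l ∈ Λ, a l * ‖expChar l τ - 1‖) ∂ν (φ n) :=
        lintegral_mono h2
    _ ≤ ENNReal.ofReal D * ENNReal.ofReal ((∑ l ∈ Λ, a l) * δ) := by
      rw [lintegral_const_mul' _ _ ENNReal.ofReal_ne_top]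
      gcongr
      exact lintegral_modulus_le ha hδ0.le (hν (φ n))
    _ ≤ ENNReal.ofReal ε := by
      rw [← ENNReal.ofReal_mul hD]
      refine ENNReal.ofReal_le_ofReal ?_
      rw [← mul_assoc, hδ, mul_div_assoc', div_le_iff₀ (by positivity)]
      nlinarith

end

/-! ### Besicovitch almost periodic data -/

section
variable {d : ℕ}

/-- Doubling `θ` makes the bound on the upper limit strict, hence valid for all large cubes. -/
lemma exists_of_besicovitchSeminorm_le {g : Space d → ℂ} {θ : ℝ} (hθ : 0 < θ)
    (h : besicovitchSeminorm g ≤ ENNReal.ofReal θ) :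
    ∃ R₁ > 0, ∀ R ≥ R₁, ∫⁻ x in cube R 0, ‖g x‖ₑ ≤ ENNReal.ofReal (2 * θ) * ENNReal.ofReal (R ^ d) := by
  have h1 : besicovitchSeminorm g < ENNReal.ofReal (2 * θ) :=
    h.trans_lt ((ENNReal.ofReal_lt_ofReal_iff (by linarith)).2 (by linarith))
  obtain ⟨R₁, hR₁⟩ := eventually_atTop.1 (eventually_lt_of_limsup_lt h1)
  refine ⟨max R₁ 1, by positivity, fun R hR => ?_⟩
  have hR0 : 0 < R := lt_of_lt_of_le (by positivity) hR
  have := (hR₁ R ((le_max_left _ _).trans hR)).le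
  rwa [ENNReal.div_le_iff (ENNReal.ofReal_pos.2 (by positivity)).ne' ENNReal.ofReal_ne_top] at this

lemma setLIntegral_cube_add (G : Space d → ℝ≥0∞) (R : ℝ) (x : Space d) :
    ∫⁻ τ in cube R 0, G (x + τ) = ∫⁻ y in cube R x, G y := by
  have hpre : (fun τ => x + τ) ⁻¹' cube R x = cube R 0 := by
    ext τ; simp [cube, dist_eq_norm]
  rw [← hpre]
  exact (measurePreserving_add_left volume x).setLIntegral_comp_preimage_emb
    (Homeomorph.addLeft x).measurableEmbedding G _

lemma quasiMeasurePreserving_add_space (d : ℕ) : Measure.QuasiMeasurePreserving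
    (fun q : Space d × Space d => q.1 + q.2) (volume.prod volume) volume :=
  Measure.quasiMeasurePreserving_snd.comp
    (measurePreserving_prod_add volume volume).quasiMeasurePreserving

/-- Double averages of a function with bounded means over large cubes. -/
lemma lintegral_double_average_le {G : Space d → ℝ≥0∞} (hG : AEMeasurable G) {S : ℝ≥0∞} {R₁ : ℝ}
    (h : ∀ R ≥ R₁, ∫⁻ x in cube R 0, G x ≤ S * ENNReal.ofReal (R ^ d)) {R r : ℝ} (hR : 0 ≤ R)
    (hr : 0 ≤ r) (hr₁ : R₁ ≤ r) :
    ∫⁻ x in cube R 0, ∫⁻ τ in cube r 0, G (x + τ) ≤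
      S * ENNReal.ofReal (2 ^ d * r ^ d) * ENNReal.ofReal (R ^ d) := by
  -- If the center ranges over the smaller cube `I_a`, the translated cubes lie in `I_{2b}`. The
  -- other case follows by exchanging the two integrations.
  have key : ∀ a b : ℝ, 0 ≤ a → a ≤ b → R₁ ≤ b → ∫⁻ x in cube a 0, ∫⁻ τ in cube b 0, G (x + τ) ≤
      S * ENNReal.ofReal (2 ^ d * b ^ d) * ENNReal.ofReal (a ^ d) := by
    intro a b ha hab hb
    calc _ ≤ ∫⁻ _ in cube a (0 : Space d), S * ENNReal.ofReal (2 ^ d * b ^ d) := by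
          refine setLIntegral_mono' (measurableSet_cube a 0) fun x hx => ?_
          rw [cube, mem_closedBall_zero_iff] at hx
          rw [setLIntegral_cube_add]
          refine (lintegral_mono_set (cube_subset_cube_zero (S := 2 * b) (by linarith))).trans ?_
          rw [← mul_pow]
          exact h _ (by linarith)
      _ = _ := by rw [setLIntegral_const, volume_cube ha]
  rcases le_total R r with hle | hle
  · exact key R r hR hle hr₁
  · have hm : AEMeasurable (fun q : Space d × Space d => G (q.1 + q.2))
        ((volume.restrict (cube R 0)).prod (volume.restrict (cube r 0))) := by
      refine AEMeasurable.mono_measure ?_ (Measure.prod_mono Measure.restrict_le_self Measure.restrict_le_self)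
      exact hG.comp_quasiMeasurePreserving (quasiMeasurePreserving_add_space d)
    rw [lintegral_lintegral_swap hm]
    have e : ∀ τ x : Space d, G (x + τ) = G (τ + x) := fun τ x => by rw [add_comm]
    simp only [e]
    refine (key r R hr hle (hr₁.trans hle)).trans (le_of_eq ?_)
    rw [mul_assoc, mul_assoc, ← ENNReal.ofReal_mul (by positivity), ← ENNReal.ofReal_mul (by positivity)]
    congr 2
    ring

/-- The means of a trigonometric polynomial over large cubes are controlled uniformly in the center
of the cube. -/
lemma IsTrigPoly.uniform_mean {p : Space d → ℂ} (hp : IsTrigPoly p) {S R₁ η : ℝ} (hS : 0 ≤ S)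
    (h : ∀ R ≥ R₁, ∫⁻ x in cube R 0, ‖p x‖ₑ ≤ ENNReal.ofReal S * ENNReal.ofReal (R ^ d))
    (hη : 0 < η) : ∃ R₂, ∀ R ≥ R₂, ∀ z,
      ∫⁻ x in cube R z, ‖p x‖ₑ ≤ ENNReal.ofReal (2 ^ d * S + η) * ENNReal.ofReal (R ^ d) := by
  -- A uniform almost period within `r` of `z` carries the cube to one inside `I_{2R}`: the volume
  -- ratio costs `2^d`, the translation error `η`.
  obtain ⟨r, hr, hper⟩ := hp.exists_period hη
  refine ⟨max R₁ (2 * r), fun R hR z => ?_⟩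
  have hRr : 2 * r ≤ R := (le_max_right _ _).trans hR
  have hR0 : 0 ≤ R := by linarith
  obtain ⟨τ, hτ, hp'⟩ := hper z
  have h1 : ∫⁻ x in cube R z, ‖p x‖ₑ = ∫⁻ y in cube R (z - τ), ‖p (y + τ)‖ₑ := by
    rw [← setLIntegral_cube_add (fun x => ‖p x‖ₑ), ← setLIntegral_cube_add (fun y => ‖p (y + τ)‖ₑ)]
    simp only [add_right_comm _ _ τ, sub_add_cancel]
  rw [h1]
  calc _ ≤ ∫⁻ y in cube R (z - τ), (‖p y‖ₑ + ENNReal.ofReal η) := by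
        refine lintegral_mono fun y => ?_
        have h2 : p (y + τ) = p y + (p (y + τ) - p y) := by ring
        rw [h2]
        refine (enorm_add_le _ _).trans ?_
        gcongr
        rw [← ofReal_norm]
        exact ENNReal.ofReal_le_ofReal (hp' y)
    _ = (∫⁻ y in cube R (z - τ), ‖p y‖ₑ) + ENNReal.ofReal η * ENNReal.ofReal (R ^ d) := by
      rw [lintegral_add_right _ measurable_const, setLIntegral_const, volume_cube hR0]
    _ ≤ ENNReal.ofReal S * ENNReal.ofReal ((2 * R) ^ d) + ENNReal.ofReal η * ENNReal.ofReal (R ^ d) := by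
      gcongr
      refine (lintegral_mono_set (cube_subset_cube_zero (S := 2 * R) ?_)).trans
        (h _ (by linarith [(le_max_left R₁ (2 * r)).trans hR]))
      rw [norm_sub_rev]
      linarith
    _ = _ := by
      rw [ENNReal.ofReal_add (by positivity) hη.le, add_mul, mul_pow, ENNReal.ofReal_mul (by positivity),
        mul_comm (2 ^ d) S, ENNReal.ofReal_mul hS]
      ring

variable {L : ℝ}

lemma lintegral_weight_translate (L : ℝ) (g : Space d → ℝ≥0∞) (τ : Space d) :
    ∫⁻ x, ENNReal.ofReal (weight L 0 x) * g (x + τ) = ∫⁻ x, ENNReal.ofReal (weight L τ x) * g x := by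
  rw [← lintegral_add_right_eq_self (fun x => ENNReal.ofReal (weight L τ x) * g x) τ]
  refine lintegral_congr fun x => ?_
  have := weight_sub L 0 τ (x + τ)
  rw [add_sub_cancel_right, zero_add] at this
  rw [this]

/-- Weighted translation estimate for functions close, in the mean, to trigonometric polynomials. -/
lemma lintegral_weight_translate_sub_le {u P P' : Space d → ℂ} (hu : AEMeasurable u)
    (hP : Continuous P) (hP' : Continuous P') (hL : 0 < L) {S₂ S₃ : ℝ≥0∞} {τ : Space d} {m : ℝ≥0∞}
    (hm : ∀ x, ‖P (x + τ) - P x‖ₑ ≤ m)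
    (h2 : ∀ R, 2 * L ≤ R → ∫⁻ x in cube R 0, ‖u x - P x‖ₑ ≤ S₂ * ENNReal.ofReal (R ^ d))
    (h3 : ∀ R, 2 * L ≤ R → ∀ z, ∫⁻ x in cube R z, ‖P' x - P x‖ₑ ≤ S₃ * ENNReal.ofReal (R ^ d)) :
    ∫⁻ x, ENNReal.ofReal (weight L 0 x) * ‖u (x + τ) - u x‖ₑ ≤
      ENNReal.ofReal (weightConst d * L ^ d) * m +
        ENNReal.ofReal (weightConst d * L ^ d) * (S₂ + S₃) +
        ∫⁻ x, ENNReal.ofReal (weight L 0 x) * ‖u (x + τ) - P' (x + τ)‖ₑ := by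
  have hw := measurable_ofReal_weight (d := d) L 0
  have hPm := hP.measurable
  have hPm' := hP'.measurable
  have hsh : Measurable fun x : Space d => x + τ := measurable_add_const τ
  have m1 : Measurable fun x => ENNReal.ofReal (weight L 0 x) * ‖P (x + τ) - P x‖ₑ :=
    hw.mul ((hPm.comp hsh).sub hPm).enorm
  have m2 : AEMeasurable fun x => ENNReal.ofReal (weight L 0 x) * ‖u x - P x‖ₑ :=
    hw.aemeasurable.mul (hu.sub hPm.aemeasurable).enorm
  have m3 : Measurable fun x => ENNReal.ofReal (weight L 0 x) * ‖P' (x + τ) - P (x + τ)‖ₑ :=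
    hw.mul ((hPm'.comp hsh).sub (hPm.comp hsh)).enorm
  have hone := lintegral_weight_mul_le (d := d) hL 0 (g := fun _ => 1) aemeasurable_const (S := 1)
    fun R hR => by rw [setLIntegral_const, volume_cube (by linarith)]
  simp only [mul_one] at hone
  calc _ ≤ ∫⁻ x, (ENNReal.ofReal (weight L 0 x) * ‖P (x + τ) - P x‖ₑ +
        (ENNReal.ofReal (weight L 0 x) * ‖u x - P x‖ₑ +
        (ENNReal.ofReal (weight L 0 x) * ‖P' (x + τ) - P (x + τ)‖ₑ +
        ENNReal.ofReal (weight L 0 x) * ‖u (x + τ) - P' (x + τ)‖ₑ))) := by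
        refine lintegral_mono fun x => ?_
        simp only [← mul_add]
        gcongr
        -- After translation the weight is centered at `τ`. There `P' - P`, being a trigonometric
        -- polynomial, has means controlled uniformly in `τ`; the remainder `u - P'` does not, so it
        -- is kept and averaged over `τ` later.
        have e : u (x + τ) - u x = (P (x + τ) - P x) + (-(u x - P x) +
            ((P' (x + τ) - P (x + τ)) + (u (x + τ) - P' (x + τ)))) := by ring
        rw [e]
        refine (enorm_add_le _ _).trans (add_le_add le_rfl ((enorm_add_le _ _).trans
          (add_le_add (enorm_neg _).le (enorm_add_le _ _))))
    _ = (∫⁻ x, ENNReal.ofReal (weight L 0 x) * ‖P (x + τ) - P x‖ₑ) +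
        ((∫⁻ x, ENNReal.ofReal (weight L 0 x) * ‖u x - P x‖ₑ) +
        ((∫⁻ x, ENNReal.ofReal (weight L 0 x) * ‖P' (x + τ) - P (x + τ)‖ₑ) +
        ∫⁻ x, ENNReal.ofReal (weight L 0 x) * ‖u (x + τ) - P' (x + τ)‖ₑ)) := by
      rw [lintegral_add_left m1, lintegral_add_left' m2, lintegral_add_left m3]
    _ ≤ ENNReal.ofReal (weightConst d * L ^ d) * m + (ENNReal.ofReal (weightConst d * L ^ d) * S₂ +
        (ENNReal.ofReal (weightConst d * L ^ d) * S₃ +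
        ∫⁻ x, ENNReal.ofReal (weight L 0 x) * ‖u (x + τ) - P' (x + τ)‖ₑ)) := by
      refine add_le_add ?_ (add_le_add ?_ (add_le_add ?_ le_rfl))
      · calc _ ≤ ∫⁻ x, ENNReal.ofReal (weight L 0 x) * m := lintegral_mono fun x => by
              gcongr
              exact hm x
          _ = (∫⁻ x, ENNReal.ofReal (weight L 0 x)) * m := lintegral_mul_const _ hw
          _ ≤ _ := by gcongr
      · exact lintegral_weight_mul_le hL 0 (hu.sub hPm.aemeasurable).enorm h2
      · rw [lintegral_weight_translate L (fun y => ‖P' y - P y‖ₑ) τ]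
        exact lintegral_weight_mul_le hL τ (hPm'.sub hPm).enorm.aemeasurable fun R hR => h3 R hR τ
    _ = _ := by ring

/-- A bounded function whose translations are controlled, in weighted norms, by those of a Besicovitch
almost periodic function is Besicovitch almost periodic. -/
theorem isBAP_of_weightedNorm_le {u₀ w : Space d → ℝ} (hu₀ : IsBAP fun x => (u₀ x : ℂ))
    (hm : AEMeasurable u₀) (hw : AEMeasurable w) {M : ℝ} (hM : ∀ᵐ x, |w x| ≤ M) {D : ℝ} (hD : 0 ≤ D)
    (h : ∀ (τ : Space d) (L : ℝ), 1 ≤ L → weightedNorm L 0 (fun x => w (x + τ) - w x) ≤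
      ENNReal.ofReal D * weightedNorm L 0 (fun x => u₀ (x + τ) - u₀ x)) :
    IsBAP fun x => (w x : ℂ) := by
  have hn : ∀ y : ℝ, ‖(y : ℂ)‖ₑ = ‖y‖ₑ := fun y => by
    rw [← ofReal_norm, ← ofReal_norm, Complex.norm_real]
  have hmc : AEMeasurable fun x => (u₀ x : ℂ) := Complex.measurable_ofReal.comp_aemeasurable hm
  constructor
  · rw [locallyIntegrable_iff]
    intro K hK
    exact Measure.integrableOn_of_bounded (M := M) hK.measure_lt_top.ne
      (Complex.measurable_ofReal.comp_aemeasurable hw).aestronglyMeasurable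
      (ae_restrict_of_ae (hM.mono fun x hx => by rwa [Complex.norm_real, Real.norm_eq_abs]))
  intro ε hε
  have hc := cubeConst_pos d
  have hwc := weightConst_pos d
  -- Sum of the errors: `θ` from the almost periods, `2 θ` from `u₀ - P`, `2^d 4θ + θ` from `P' -
  -- P`, and `2 · 2^d θ` from the averaged `u₀ - P'`.
  set E : ℝ := 4 + 6 * 2 ^ d with hE
  set θ := ε / (cubeConst d * D * weightConst d * E + 1) with hθ
  have hθ0 : 0 < θ := by positivity
  obtain ⟨P, hP, hPN⟩ := hu₀.2 θ hθ0
  obtain ⟨hPc, -, Λ, a, ha, hmod⟩ := hP.exists_modulus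
  have hs : 0 ≤ ∑ l ∈ Λ, a l := Finset.sum_nonneg fun l _ => ha l
  set δ := θ / (∑ l ∈ Λ, a l + 1) with hδ
  have hδ0 : 0 < δ := by positivity
  have hsδ : (∑ l ∈ Λ, a l) * δ ≤ θ := by
    rw [hδ, mul_div_assoc', div_le_iff₀ (by positivity)]
    nlinarith
  obtain ⟨κ, r, ν, hκ, hrt, hr0, hprob, hνκ, hν, hQ⟩ := exists_averaging Λ hδ0
  -- The density bound `κ` depends on the kernel, hence on `P`. A second, finer approximant chosen
  -- now makes the loss harmless: `κ θ' ≤ θ`.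
  set θ' := θ / (κ.toReal + 1) with hθ'
  have hκ0 : 0 ≤ κ.toReal := ENNReal.toReal_nonneg
  have hθ'0 : 0 < θ' := by positivity
  have hκθ : κ.toReal * θ' ≤ θ := by
    rw [hθ', mul_div_assoc', div_le_iff₀ (by positivity)]
    nlinarith
  have hθ'θ : θ' ≤ θ := div_le_self hθ0.le (by linarith)
  obtain ⟨P', hP', hPN'⟩ := hu₀.2 θ' hθ'0
  have hPc' := hP'.exists_modulus.1
  obtain ⟨R₁, hR₁0, hR₁⟩ := exists_of_besicovitchSeminorm_le hθ0 hPN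
  obtain ⟨R₁', hR₁0', hR₁'⟩ := exists_of_besicovitchSeminorm_le hθ'0 hPN'
  have hp : IsTrigPoly fun x => P' x - P x := by
    rw [isTrigPoly_iff] at hP hP' ⊢
    exact Submodule.sub_mem _ hP' hP
  have hpmean : ∀ R ≥ max R₁ R₁', ∫⁻ x in cube R 0, ‖P' x - P x‖ₑ ≤
      ENNReal.ofReal (4 * θ) * ENNReal.ofReal (R ^ d) := by
    intro R hR
    calc _ ≤ ∫⁻ x in cube R 0, (‖(u₀ x : ℂ) - P x‖ₑ + ‖(u₀ x : ℂ) - P' x‖ₑ) := by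
          refine lintegral_mono fun x => ?_
          rw [← sub_sub_sub_cancel_left (P x) (P' x) (u₀ x : ℂ)]
          exact enorm_sub_le
      _ = (∫⁻ x in cube R 0, ‖(u₀ x : ℂ) - P x‖ₑ) + ∫⁻ x in cube R 0, ‖(u₀ x : ℂ) - P' x‖ₑ :=
          lintegral_add_left' (hmc.sub hPc.measurable.aemeasurable).enorm.restrict _
      _ ≤ ENNReal.ofReal (2 * θ) * ENNReal.ofReal (R ^ d) +
          ENNReal.ofReal (2 * θ) * ENNReal.ofReal (R ^ d) := by
        refine add_le_add (hR₁ R ((le_max_left _ _).trans hR))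
          ((hR₁' R ((le_max_right _ _).trans hR)).trans ?_)
        gcongr
      _ = _ := by
        rw [← add_mul, ← ENNReal.ofReal_add (by positivity) (by positivity)]
        congr 2
        ring
  obtain ⟨R₂, hR₂⟩ := hp.uniform_mean (by positivity) hpmean hθ0
  obtain ⟨Q, hQt, φ, hφ, hle⟩ := hQ w M hw hM
  refine ⟨Q, hQt, ?_⟩
  refine limsup_le_of_le (by isBoundedDefault) ?_
  filter_upwards [eventually_ge_atTop 1, eventually_ge_atTop R₁, eventually_ge_atTop R₂]
    with L hL1 hLR₁ hLR₂
  have hL : 0 < L := by linarith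
  refine ENNReal.div_le_of_le_mul ?_
  set W := ENNReal.ofReal (weightConst d * L ^ d) with hW
  have hsmall : ∀ᶠ n in atTop, ∫⁻ τ, (∫⁻ x, ENNReal.ofReal (weight L 0 x) * ‖w (x + τ) - w x‖ₑ) ∂ν (φ n) ≤
      ENNReal.ofReal D * (W * ENNReal.ofReal (θ * E)) := by
    filter_upwards [(hrt.comp hφ.tendsto_atTop).eventually_ge_atTop R₁'] with n hrn
    have hrn : R₁' ≤ r (φ n) := hrn
    have hpr := hprob (φ n)
    have hr := hr0 (φ n)
    have hG : AEMeasurable fun x => ‖(u₀ x : ℂ) - P' x‖ₑ :=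
      (hmc.sub hPc'.measurable.aemeasurable).enorm
    -- By the density bound, the `ν`-average is at most `κ` times the mean over `I_r`; the resulting
    -- double average needs only the means of `u₀ - P'` over large cubes centered at 0.
    have hI4 : ∫⁻ τ, (∫⁻ x, ENNReal.ofReal (weight L 0 x) * ‖(u₀ (x + τ) : ℂ) - P' (x + τ)‖ₑ) ∂ν (φ n) ≤
        W * ENNReal.ofReal (2 * 2 ^ d * θ) := by
      refine (hνκ (φ n) _).trans ?_
      have hsw : ∫⁻ τ in cube (r (φ n)) 0,
          (∫⁻ x, ENNReal.ofReal (weight L 0 x) * ‖(u₀ (x + τ) : ℂ) - P' (x + τ)‖ₑ) =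
          ∫⁻ x, ENNReal.ofReal (weight L 0 x) *
            ∫⁻ τ in cube (r (φ n)) 0, ‖(u₀ (x + τ) : ℂ) - P' (x + τ)‖ₑ := by
        rw [lintegral_lintegral_swap]
        · exact lintegral_congr fun x => lintegral_const_mul' _ _ ENNReal.ofReal_ne_top
        · refine AEMeasurable.mono_measure ?_ (Measure.prod_mono Measure.restrict_le_self le_rfl)
          refine ((measurable_ofReal_weight L 0).comp measurable_snd).aemeasurable.mul ?_
          have := hG.comp_quasiMeasurePreserving
            ((quasiMeasurePreserving_add_space d).comp
              Measure.measurePreserving_swap.quasiMeasurePreserving)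
          exact this
      have hHm : AEMeasurable fun x => ∫⁻ τ in cube (r (φ n)) 0, ‖(u₀ (x + τ) : ℂ) - P' (x + τ)‖ₑ := by
        refine AEMeasurable.lintegral_prod_right'
          (f := fun q : Space d × Space d => ‖(u₀ (q.1 + q.2) : ℂ) - P' (q.1 + q.2)‖ₑ) ?_
        refine AEMeasurable.mono_measure ?_ (Measure.prod_mono le_rfl Measure.restrict_le_self)
        exact hG.comp_quasiMeasurePreserving (quasiMeasurePreserving_add_space d)
      rw [hsw]
      have h1 := lintegral_weight_mul_le hL 0 hHm fun R hR =>
        lintegral_double_average_le hG hR₁' (R := R) (by linarith) hr.le hrn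
      have hrd : 0 < r (φ n) ^ d := pow_pos hr d
      calc _ ≤ κ * ((ENNReal.ofReal (r (φ n) ^ d))⁻¹ *
            (W * (ENNReal.ofReal (2 * θ') * ENNReal.ofReal (2 ^ d * r (φ n) ^ d)))) := by gcongr
        _ = W * ENNReal.ofReal (2 * 2 ^ d * (κ.toReal * θ')) := by
          rw [← ENNReal.ofReal_inv_of_pos hrd]
          nth_rewrite 1 [← ENNReal.ofReal_toReal hκ]
          rw [hW, ← ENNReal.ofReal_mul (by positivity), ← ENNReal.ofReal_mul (by positivity),
            ← ENNReal.ofReal_mul (by positivity), ← ENNReal.ofReal_mul (by positivity),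
            ← ENNReal.ofReal_mul (by positivity)]
          congr 1
          field_simp
        _ ≤ _ := by gcongr
    calc _ ≤ ∫⁻ τ, ENNReal.ofReal D *
          (W * ENNReal.ofReal (∑ l ∈ Λ, a l * ‖expChar l τ - 1‖) +
            (W * (ENNReal.ofReal (2 * θ) + ENNReal.ofReal (2 ^ d * (4 * θ) + θ)) +
            ∫⁻ x, ENNReal.ofReal (weight L 0 x) * ‖(u₀ (x + τ) : ℂ) - P' (x + τ)‖ₑ)) ∂ν (φ n) := by
          refine lintegral_mono fun τ => (h τ L hL1).trans ?_
          gcongr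
          rw [← add_assoc]
          have := lintegral_weight_translate_sub_le hmc hPc hPc' hL (τ := τ)
            (m := ENNReal.ofReal (∑ l ∈ Λ, a l * ‖expChar l τ - 1‖))
            (fun x => by rw [← ofReal_norm]; exact ENNReal.ofReal_le_ofReal (hmod x τ))
            (fun R hR => hR₁ R (by linarith)) (fun R hR => hR₂ R (by linarith))
          refine le_trans (le_of_eq ?_) this
          exact lintegral_congr fun x => by rw [← Complex.ofReal_sub, hn]
      _ = ENNReal.ofReal D * (W * (∫⁻ τ, ENNReal.ofReal (∑ l ∈ Λ, a l * ‖expChar l τ - 1‖) ∂ν (φ n)) +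
            (W * (ENNReal.ofReal (2 * θ) + ENNReal.ofReal (2 ^ d * (4 * θ) + θ)) +
            ∫⁻ τ, (∫⁻ x, ENNReal.ofReal (weight L 0 x) *
              ‖(u₀ (x + τ) : ℂ) - P' (x + τ)‖ₑ) ∂ν (φ n))) := by
          have hmm : Measurable fun τ => ENNReal.ofReal (∑ l ∈ Λ, a l * ‖expChar l τ - 1‖) :=
            (continuous_finsetSum _ fun l _ => continuous_const.mul
              ((continuous_expChar l).sub continuous_const).norm).measurable.ennreal_ofReal
          rw [lintegral_const_mul' _ _ ENNReal.ofReal_ne_top, lintegral_add_left (hmm.const_mul W),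
            lintegral_const_mul _ hmm, lintegral_add_left measurable_const, lintegral_const,
            measure_univ, mul_one]
      _ ≤ ENNReal.ofReal D * (W * ENNReal.ofReal θ +
            (W * (ENNReal.ofReal (2 * θ) + ENNReal.ofReal (2 ^ d * (4 * θ) + θ)) +
            W * ENNReal.ofReal (2 * 2 ^ d * θ))) := by
          gcongr
          exact (lintegral_modulus_le ha hδ0.le (hν (φ n))).trans (ENNReal.ofReal_le_ofReal hsδ)
      _ = _ := by
          rw [← mul_add, ← mul_add, ← ENNReal.ofReal_add (by positivity) (by positivity),
            ← ENNReal.ofReal_add (by positivity) (by positivity),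
            ← ENNReal.ofReal_add (by positivity) (by positivity)]
          congr 3
          rw [hE]
          ring
  have hmain := (hle _ (measurable_ofReal_weight L 0) fun x => ENNReal.ofReal_ne_top).trans
    ((liminf_le_liminf hsmall).trans (liminf_const _).le)
  calc _ ≤ ENNReal.ofReal (cubeConst d) *
        ∫⁻ x, ENNReal.ofReal (weight L 0 x) * ‖(w x : ℂ) - Q x‖ₑ :=
        setLIntegral_cube_le_weight hL 0 fun x => ‖(w x : ℂ) - Q x‖ₑ
    _ ≤ ENNReal.ofReal (cubeConst d) * (ENNReal.ofReal D * (W * ENNReal.ofReal (θ * E))) := by gcongr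
    _ ≤ _ := by
      rw [hW, ← ENNReal.ofReal_mul (by positivity), ← ENNReal.ofReal_mul hD,
        ← ENNReal.ofReal_mul hc.le, ← ENNReal.ofReal_mul hε.le]
      refine ENNReal.ofReal_le_ofReal ?_
      have hkey : cubeConst d * D * weightConst d * E * θ ≤ ε := by
        rw [hθ, mul_div_assoc', div_le_iff₀ (by positivity)]
        nlinarith
      calc _ = cubeConst d * D * weightConst d * E * θ * L ^ d := by ring
        _ ≤ _ := by gcongr

end

/-! ### The two assertions for entropy solutions -/

section
variable {d : ℕ}

lemma IsBAP.congr_ae {g g' : Space d → ℂ} (h : IsBAP g) (hg : ∀ᵐ x, g x = g' x) : IsBAP g' := by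
  refine ⟨h.1.congr hg, fun ε hε => ?_⟩
  obtain ⟨P, hP, hN⟩ := h.2 ε hε
  refine ⟨P, hP, le_trans (le_of_eq ?_) hN⟩
  unfold besicovitchSeminorm
  congr 1
  ext R
  congr 1
  exact lintegral_congr_ae ((ae_restrict_of_ae hg).mono fun x hx => by simp only [hx])

variable {f : Fin d → ℝ → ℝ} {A σ : Fin d → Fin d → ℝ → ℝ}

/-- Entropy solutions with trigonometric polynomials as data. -/
theorem IsAdmissible.trigPoly_data (hadm : IsAdmissible f A σ) (M : ℝ) :
    ∃ C : ℝ, 0 < C ∧ ∀ u₀ : Space d → ℝ, IsTrigPoly (fun x => (u₀ x : ℂ)) → (∀ x, |u₀ x| ≤ M) →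
      ∀ u : ℝ → Space d → ℝ, IsEntropySolution f A σ u₀ u →
        ∃ w : ℝ → Space d → ℝ, IsContinuousVersion u₀ u w ∧ ∀ t : ℝ, 0 < t →
          IsSAP (fun x => (w t x : ℂ)) ∧
          (∀ ε : ℝ, 0 < ε → ∃ l : ℝ, IsInclusionInterval ε (fun x => (w t x : ℂ)) l) ∧
          (∀ ε : ℝ, 0 < ε → stepanoffConst d ≤ |Real.log ε| →
            (∃ l : ℝ, IsInclusionInterval
              (ε * |Real.log ε|⁻¹ * Real.exp (-C * t)) (fun x => (u₀ x : ℂ)) l) ∧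
            ∀ l : ℝ, IsInclusionInterval
                (ε * |Real.log ε|⁻¹ * Real.exp (-C * t)) (fun x => (u₀ x : ℂ)) l →
              IsInclusionInterval ε (fun x => (w t x : ℂ)) l) := by
  obtain ⟨C, hC, hmain⟩ := exists_continuousVersion hadm M
  refine ⟨C, hC, fun u₀ htrig hM u hu => ?_⟩
  have hcont : Continuous u₀ := by
    have := Complex.continuous_re.comp htrig.exists_modulus.1
    exact this
  have hm : AEMeasurable u₀ := hcont.measurable.aemeasurable
  obtain ⟨w, hwv, hwB, hshift⟩ := hmain u₀ u hm (Eventually.of_forall hM) hu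
  refine ⟨w, hwv, fun t ht => ?_⟩
  obtain ⟨hwm, hwM⟩ := hwB t ht.le
  have hK := stepanoffConst_pos d
  set D : ℝ := stepanoffConst d * Real.exp (C * t) with hD
  have hD0 : 0 ≤ D := by positivity
  have key : ∀ τ, stepanoffNorm (fun x => (w t (x + τ) : ℂ) - w t x) ≤
      ENNReal.ofReal D * stepanoffNorm (fun x => (u₀ (x + τ) : ℂ) - u₀ x) := by
    intro τ
    have hb : AEMeasurable fun x => u₀ (x + τ) - u₀ x :=
      ((hcont.comp (continuous_add_const τ)).sub hcont).measurable.aemeasurable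
    have := stepanoffNorm_le_of_weightedNorm_le hb (Real.exp_pos (C * t)).le
      fun z => hshift t ht.le τ 1 le_rfl z
    simpa only [Complex.ofReal_sub] using this
  have hper : ∀ ε ε' l : ℝ, IsInclusionInterval ε' (fun x => (u₀ x : ℂ)) l → D * ε' ≤ ε →
      IsInclusionInterval ε (fun x => (w t x : ℂ)) l := fun ε ε' l hl hε =>
    IsInclusionInterval.of_stepanoffNorm_le (v := fun x => (u₀ x : ℂ))
      (w := fun x => (w t x : ℂ)) hD0 key hε hl
  refine ⟨isSAP_of_stepanoffNorm_le htrig hwm hwM hD0 key, fun ε hε => ?_,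
    fun ε hε hKε => ⟨?_, fun l hl => ?_⟩⟩
  · obtain ⟨l, hl⟩ := htrig.exists_inclusionInterval (ε := ε / (D + 1)) (by positivity)
    refine ⟨l, hper _ _ l hl ?_⟩
    rw [mul_div_assoc', div_le_iff₀ (by positivity)]
    nlinarith
  · have : 0 < |Real.log ε| := hK.trans_le hKε
    exact htrig.exists_inclusionInterval (mul_pos (mul_pos hε (inv_pos.2 this)) (Real.exp_pos _))
  · refine hper _ _ l hl ?_
    have hlog : 0 < |Real.log ε| := hK.trans_le hKε
    have he : Real.exp (C * t) * Real.exp (-C * t) = 1 := by rw [← Real.exp_add]; simp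
    -- The exponentials cancel, and the dimensional constant left over is at most `|log ε|`.
    calc D * (ε * |Real.log ε|⁻¹ * Real.exp (-C * t)) =
        ε * (stepanoffConst d * |Real.log ε|⁻¹) * (Real.exp (C * t) * Real.exp (-C * t)) := by
          rw [hD]; ring
      _ = ε * (stepanoffConst d * |Real.log ε|⁻¹) := by rw [he, mul_one]
      _ ≤ ε * 1 := by
        gcongr
        rw [← div_eq_mul_inv]
        exact (div_le_one hlog).2 hKε
      _ = ε := mul_one ε

/-- Entropy solutions with bounded Besicovitch almost periodic data. -/
theorem IsAdmissible.besicovitch_data (hadm : IsAdmissible f A σ) {u₀ : Space d → ℝ}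
    (hu₀ : IsBAP fun x => (u₀ x : ℂ)) (hL : MemLp u₀ ⊤ volume) {u : ℝ → Space d → ℝ}
    (hu : IsEntropySolution f A σ u₀ u) :
    ∀ᵐ t ∂(volume.restrict (Ioi (0 : ℝ))), IsBAP fun x => (u t x : ℂ) := by
  have hm : AEMeasurable u₀ := hL.1.aemeasurable
  have hM : ∀ᵐ x, |u₀ x| ≤ (eLpNorm u₀ ⊤ volume).toReal := by
    filter_upwards [ae_le_eLpNormEssSup (f := u₀) (μ := volume)] with x hx
    rw [← Real.norm_eq_abs, ← toReal_enorm]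
    exact ENNReal.toReal_mono hL.2.ne (by rwa [eLpNorm_exponent_top])
  obtain ⟨C, -, hmain⟩ := exists_continuousVersion hadm (eLpNorm u₀ ⊤ volume).toReal
  obtain ⟨w, hwv, hwB, hshift⟩ := hmain u₀ u hm hM hu
  rw [ae_restrict_iff' measurableSet_Ioi]
  filter_upwards [ae_domain (P := fun p => w p.1 p.2 = u p.1 p.2) hwv.ae_eq] with t ht ht0
  have ht0 : 0 < t := ht0
  obtain ⟨hwm, hwM⟩ := hwB t ht0.le
  have hw : IsBAP fun x => (w t x : ℂ) :=
    isBAP_of_weightedNorm_le hu₀ hm hwm hwM (Real.exp_pos (C * t)).le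
      fun τ L hL => hshift t ht0.le τ L hL 0
  exact hw.congr_ae ((ht ht0).mono fun x hx => by rw [hx])

end

end AnisotropicAP

end

theorem lemma4p1 (d : ℕ) :
    ∃ K : ℝ, 0 < K ∧
      ∀ (f : Fin d → ℝ → ℝ) (A σ : Fin d → Fin d → ℝ → ℝ), AnisotropicAP.IsAdmissible f A σ →
        -- trigonometric polynomials as initial data
        (∀ M : ℝ, ∃ C : ℝ, 0 < C ∧
          ∀ u₀ : AnisotropicAP.Space d → ℝ,
            AnisotropicAP.IsTrigPoly (fun x => (u₀ x : ℂ)) → (∀ x, |u₀ x| ≤ M) →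
            ∀ u : ℝ → AnisotropicAP.Space d → ℝ, AnisotropicAP.IsEntropySolution f A σ u₀ u →
              ∃ w : ℝ → AnisotropicAP.Space d → ℝ, AnisotropicAP.IsContinuousVersion u₀ u w ∧
                ∀ t : ℝ, 0 < t →
                  AnisotropicAP.IsSAP (fun x => (w t x : ℂ)) ∧
                  (∀ ε : ℝ, 0 < ε →
                    ∃ l : ℝ, AnisotropicAP.IsInclusionInterval ε (fun x => (w t x : ℂ)) l) ∧
                  (∀ ε : ℝ, 0 < ε → K ≤ |Real.log ε| →
                    (∃ l : ℝ, AnisotropicAP.IsInclusionInterval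
                      (ε * |Real.log ε|⁻¹ * Real.exp (-C * t)) (fun x => (u₀ x : ℂ)) l) ∧
                    ∀ l : ℝ, AnisotropicAP.IsInclusionInterval
                        (ε * |Real.log ε|⁻¹ * Real.exp (-C * t)) (fun x => (u₀ x : ℂ)) l →
                      AnisotropicAP.IsInclusionInterval ε (fun x => (w t x : ℂ)) l)) ∧
        -- Besicovitch almost periodic bounded initial data
        (∀ u₀ : AnisotropicAP.Space d → ℝ,
          AnisotropicAP.IsBAP (fun x => (u₀ x : ℂ)) → MemLp u₀ ∞ volume →
          ∀ u : ℝ → AnisotropicAP.Space d → ℝ, AnisotropicAP.IsEntropySolution f A σ u₀ u →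
            ∀ᵐ t ∂(volume.restrict (Ioi (0 : ℝ))), AnisotropicAP.IsBAP (fun x => (u t x : ℂ))) := by
  -- `K` is the constant in the comparison of Stepanoff and weighted norms, which knows nothing of
  -- the equation; all dependence on the coefficients and on `M` sits in the exponential rate.
  refine ⟨AnisotropicAP.stepanoffConst d, AnisotropicAP.stepanoffConst_pos d, fun f A σ hadm =>
    ⟨fun M => hadm.trigPoly_data M, fun u₀ hu₀ hL u hu => hadm.besicovitch_data hu₀ hL hu⟩⟩
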